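/- **Setting.** Let $\mathcal N_{\mathbb C}$ be an infinite-dimensional complex nuclear Fréchet space, $\mathcal N_{\mathbb C}=\bigcap_{p\ge 0}\mathcal H_p$, the projective limit of a sequence of separable complex Hilbert spaces along injective Hilbert–Schmidt maps $\mathcal H_{p+1}\hookrightarrow\mathcal H_p$, and let $\mathcal N_{\mathbb C}'$ be its strong dual. Let $\Delta$ be a continuous positive definite hermitian form on $\mathcal N_{\mathbb C}$ and $\mu_c$ the Gaussian Borel probability measure on $\mathcal N_{\mathbb C}'$ with $$\int_{\mathcal N_{\mathbb C}'} e^{i(\overline{\langle\rho,\phi\rangle}+\langle\rho,\phi\rangle)}\,d\mu_c(\phi)=e^{-\Delta(\rho,\rho)}\qquad(\rho\in\mathcal N_{\mathbb C}).$$ A *Hida test function* is a function $\Psi(\phi)=\sum_{n\ge 0}\langle\psi_n,\phi^{\otimes n}\rangle$ on $\mathcal N_{\mathbb C}'$ with symmetric kernels $\psi_n\in\bigcap_p\mathcal H_p^{\hat\otimes n}$ such that $\sum_n n!\,2^{qn}\|\psi_n\|^2_{\mathcal H_p^{\otimes n}}<\infty$ for all integers $p,q\ge 0$. The set of them, regarded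 as $\mu_c$-classes, is $(\mathcal N_{\mathbb C})$. A homogeneous holomorphic polynomial of degree $n$ is a linear combination of functions $\phi\mapsto\prod_{i=1}^n\langle\chi_i,\phi\rangle$ with $\chi_i\in\mathcal N_{\mathbb C}$. For $f:\mathbb N_0\to\mathbb R$ the operator $f(N)$ of the particle number operator $N$ acts on holomorphic polynomials by multiplying the homogeneous part of degree $n$ by $f(n)$; in $L^r(\mu_c)$, $1\le r<\infty$, it is the closure of this operator. Put, for integers $p\ge 1$ and $m\ge 0$, $$\mathbb D^{p,m}_{\mu_c}=\{\Psi:\ (1+N)^{m/2}\Psi \text{ exists in } L^p(\mu_c)\},\qquad \mathcal G_{\mu_c}=\{\Psi:\ 2^{qN/2}\Psi\text{ exists in }L^2(\mu_c)\text{ for all integers } q\ge 0\}.$$ **Claim.** $$(\mathcal N_{\mathbb C})\subsetneq\mathcal G_{\mu_c}\subsetneq\bigcap_{p\ge 1,\,m\ge 0}\mathbb D^{p,m}_{\mu_c}.$$ Moreover, for $\Psi\in\mathcal G_{\mu_c}$, integers $p\ge 1$, $m\ge 0$ and real $\lambda\ge 0$ with $2^{-\lambda}(p-1)\le 1$, $$\|(1+N)^{m/2}\Psi\|_{L^p(\mu_c)}\le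 2^{m/2}\,\|2^{(\lambda+m)N/2}\Psi\|_{L^2(\mu_c)}.$$ -/

import Mathlib

open MeasureTheory Filter Topology
open scoped ENNReal ComplexConjugate

noncomputable section

namespace HidaGauss

/-- A bounded operator between Hilbert spaces is Hilbert–Schmidt if the sums `∑ ‖T eᵢ‖²` over
finite orthonormal families are bounded. -/
def IsHilbertSchmidt {H₁ H₂ : Type*} [NormedAddCommGroup H₁] [InnerProductSpace ℂ H₁]
    [NormedAddCommGroup H₂] [InnerProductSpace ℂ H₂] (T : H₁ →L[ℂ] H₂) : Prop :=
  ∃ C : ℝ, ∀ (k : ℕ) (e : Fin k → H₁), Orthonormal ℂ e → ∑ i, ‖T (e i)‖ ^ 2 ≤ C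

section Chain

variable {E : Type*} [AddCommGroup E] [Module ℂ E] [TopologicalSpace E]
variable {H : ℕ → Type*} [∀ p, NormedAddCommGroup (H p)] [∀ p, InnerProductSpace ℂ (H p)]

/-- `E` is the nuclear Fréchet space `⋂ₚ H p`: the projective limit, as a topological vector space,
of the Hilbert spaces `H p` along injective Hilbert–Schmidt maps `T p : H (p+1) → H p`, with
canonical maps `j p : E → H p`. -/
structure IsNuclearFrechet (j : ∀ p, E →L[ℂ] H p) (T : ∀ p, H (p + 1) →L[ℂ] H p) : Prop where
  injective : ∀ p, Function.Injective (T p)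
  hilbertSchmidt : ∀ p, IsHilbertSchmidt (T p)
  comp : ∀ p x, T p (j (p + 1) x) = j p x
  limit : ∀ x : ∀ p, H p, (∀ p, T p (x (p + 1)) = x p) → ∃! e : E, ∀ p, j p e = x p
  topology : ‹TopologicalSpace E› = ⨅ p, TopologicalSpace.induced (j p) inferInstance

/-- The element `⟨e, ·⟩ₚ` of `E'`, for `e ∈ H p`. Orthonormal families of the dual `H₋ₚ` of `H p`
are the families `⟨eᵢ, ·⟩ₚ` with `(eᵢ)` orthonormal in `H p`. -/
def rieszDual (j : ∀ p, E →L[ℂ] H p) (p : ℕ) (e : H p) : StrongDual ℂ E :=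
  (innerSL ℂ e).comp (j p)

/-- The square of the norm of a kernel of degree `n` in the Hilbert tensor power `(H p)^{⊗ n}`,
possibly `∞`. A kernel `ψ` is seen as the `n`-linear form `(φ₁,…,φₙ) ↦ ⟨ψ, φ₁ ⊗ ⋯ ⊗ φₙ⟩` on `E'`,
and `(H p)^{⊗ n}` as the space of Hilbert–Schmidt `n`-linear forms on the dual of `H p`. -/
def kernelNormSq (j : ∀ p, E →L[ℂ] H p) (p : ℕ) {n : ℕ}
    (ψ : MultilinearMap ℂ (fun _ : Fin n => StrongDual ℂ E) ℂ) : ℝ≥0∞ :=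
  ⨆ (k : ℕ) (e : Fin k → H p) (_ : Orthonormal ℂ e),
    ∑ i : Fin n → Fin k, ‖ψ (fun l => rieszDual j p (e (i l)))‖ₑ ^ 2

/-- Hida test functions: the functions `Ψ(φ) = ∑ₙ ⟨ψₙ, φ^{⊗ n}⟩` on `E'` with symmetric kernels
`ψₙ` such that `(√n! ψₙ)ₙ` lies in the Fock space `Γ H_{p,q}` for all `p, q`, where `H_{p,q}` is
`H p` with the norm `2^{q/2} ‖·‖ₚ`. -/
def IsHidaTest (j : ∀ p, E →L[ℂ] H p) (Ψ : StrongDual ℂ E → ℂ) : Prop :=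
  ∃ ψ : ∀ n : ℕ, MultilinearMap ℂ (fun _ : Fin n => StrongDual ℂ E) ℂ,
    (∀ (n : ℕ) (σ : Equiv.Perm (Fin n)) (φ : Fin n → StrongDual ℂ E),
      ψ n (fun l => φ (σ l)) = ψ n φ) ∧
    (∀ p q : ℕ, ∑' n : ℕ, (n.factorial : ℝ≥0∞) * 2 ^ (q * n) * kernelNormSq j p (ψ n) < ∞) ∧
    ∀ φ, HasSum (fun n => ψ n (fun _ => φ)) (Ψ φ)

end Chain

section Gaussian

variable {E : Type*} [AddCommGroup E] [Module ℂ E] [TopologicalSpace E]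

/-- A continuous positive definite hermitian form on `E`. -/
structure IsCovariance (Δ : E →ₗ⋆[ℂ] E →ₗ[ℂ] ℂ) : Prop where
  hermitian : ∀ ρ χ, Δ ρ χ = conj (Δ χ ρ)
  posDef : ∀ ρ, ρ ≠ 0 → 0 < (Δ ρ ρ).re
  continuous : Continuous fun ρ => Δ ρ ρ

variable [MeasurableSpace (StrongDual ℂ E)]

/-- `μ` is the complex Gaussian measure on `E'` with covariance `Δ`, given by its characteristic
functional. -/
structure IsComplexGaussian (Δ : E →ₗ⋆[ℂ] E →ₗ[ℂ] ℂ) (μ : Measure (StrongDual ℂ E)) : Prop where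
  isProbabilityMeasure : IsProbabilityMeasure μ
  charFun : ∀ ρ : E,
    ∫ φ, Complex.exp (Complex.I * (conj (φ ρ) + φ ρ)) ∂μ = Complex.exp (-Δ ρ ρ)

variable (E) in
/-- Homogeneous holomorphic polynomials of degree `n` on `E'` with coefficients in `E`. -/
def homPoly (n : ℕ) : Submodule ℂ (StrongDual ℂ E → ℂ) :=
  Submodule.span ℂ (Set.range fun χ : Fin n → E => fun φ => ∏ i, φ (χ i))

/-- `Φ = f(N) Ψ` in `L^r_Hol(μ)`, where `N` is the particle number operator. On a holomorphic
polynomial `∑ₙ Pₙ`, `Pₙ` homogeneous of degree `n`, `f(N)` acts as `∑ₙ Pₙ ↦ ∑ₙ f(n) Pₙ`;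
in general it is the closure of this operator in `L^r(μ)`. -/
def NumberOpGraph (μ : Measure (StrongDual ℂ E)) (r : ℝ≥0∞) (f : ℕ → ℝ)
    (Ψ Φ : StrongDual ℂ E →ₘ[μ] ℂ) : Prop :=
  ∃ (d : ℕ → ℕ) (P : ℕ → ℕ → StrongDual ℂ E → ℂ),
    (∀ k n, P k n ∈ homPoly E n) ∧
    Tendsto (fun k => eLpNorm (fun φ => Ψ φ - ∑ n ∈ Finset.range (d k), P k n φ) r μ)
      atTop (𝓝 0) ∧
    Tendsto (fun k => eLpNorm (fun φ => Φ φ - ∑ n ∈ Finset.range (d k), (f n : ℂ) * P k n φ) r μ)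
      atTop (𝓝 0)

/-- The holomorphic Gross–Sobolev space `𝔻^{p,m}` of `μ`: the `Ψ` for which `(1+N)^{m/2} Ψ` exists
in `L^p_Hol(μ)`. -/
def grossSobolev (μ : Measure (StrongDual ℂ E)) (p m : ℕ) : Set (StrongDual ℂ E →ₘ[μ] ℂ) :=
  {Ψ | ∃ Φ, NumberOpGraph μ p (fun n => (1 + n : ℝ) ^ ((m : ℝ) / 2)) Ψ Φ}

/-- The space `𝒢` of `μ`: the `Ψ ∈ L²_Hol(μ)` with `|Ψ|_{0,q} = ‖2^{qN/2} Ψ‖₂ < ∞` for all `q`. -/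
def spaceG (μ : Measure (StrongDual ℂ E)) : Set (StrongDual ℂ E →ₘ[μ] ℂ) :=
  {Ψ | ∀ q : ℕ, ∃ Φ, NumberOpGraph μ 2 (fun n => (2 : ℝ) ^ ((q : ℝ) * n / 2)) Ψ Φ}

/-- The `μ`-classes of Hida test functions. -/
def hidaSpace {H : ℕ → Type*} [∀ p, NormedAddCommGroup (H p)] [∀ p, InnerProductSpace ℂ (H p)]
    (j : ∀ p, E →L[ℂ] H p) (μ : Measure (StrongDual ℂ E)) : Set (StrongDual ℂ E →ₘ[μ] ℂ) :=
  {F | ∃ Ψ, IsHidaTest j Ψ ∧ F =ᵐ[μ] Ψ}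

end Gaussian

end HidaGauss

end

/-! The values of the field on a `Δ`-orthonormal family are independent standard complex Gaussians.
Hence monomials are orthogonal with `‖z^α‖² = α!`, and the `L²` norm of a holomorphic polynomial is
its Fock norm. Any finite set of polynomials lives in finitely many such coordinates, so estimates
are proved there and passed to `L^r` limits.

The norm inequality is hypercontractivity for even exponents: `‖P‖_{2k}^k = ‖P^k‖₂`, and
Cauchy–Schwarz on the coefficients of a product (`fockNormSq_mul_le`) gives by induction `‖P‖_{2k} ≤
‖k^{N/2} P‖₂`. It remains to choose `k` with `p ≤ 2k` and `k ≤ 2^λ`, and to use `1 + n ≤ 2^n`. The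
resulting estimate holds even with constant `1`, and it contains the inclusion of `𝒢` in every
`𝔻^{p,m}`.

That inclusion is strict because in infinitely many variables hypercontractivity is far from sharp
for suitable polynomials. The normalized power sum `G_n` of `z_i^n` over very many `i` has `L^{2n}`
norm at most `e n` (`exists_flat_homPoly`). Then `∑ 2^{-n} G_n` lies in all `𝔻^{p,m}`, while
`2^{qN/2}` with `q = 4` turns the coefficients into `2^n`.

For Hida test functions, `Δ` is bounded by some `‖·‖_p²`, so the Hilbert–Schmidt map makes its trace
on `H (p+1)` finite and `μ` is carried by the dual of `H (p+1)` (`ae_exists_riesz`). There the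
kernels can be evaluated and approximated by finite-dimensional projections. The moments of the
squared dual norm grow at most like `n! D^n`, which the factors `n! 2^{qn}` in the definition
absorb; dominated convergence gives `f(N) Ψ` for every `f` of exponential growth
(`tendsto_kernelApprox`).

Strictness of the first inclusion is already visible in degree one. Square-summable combinations of
linear functionals lie in `𝒢`, whereas the linear part of a Hida test function is `φ ↦ φ y` with `y
∈ E`. Along a suitable orthonormal sequence `g` the coefficients `Δ (g n) y` are `O(4^{-n})`, so `∑
2^{-n} φ(g n)` is not a Hida test function. -/

noncomputable section

namespace HidaGauss

/-! ### Moments and characteristic function of one complex Gaussian variable. -/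

section ComplexGaussian

/-- The standard complex Gaussian measure, with density `π⁻¹ exp (-|z|²)`. -/
def stdComplexGaussian : Measure ℂ :=
  volume.withDensity fun z => ENNReal.ofReal (Real.pi⁻¹ * Real.exp (-‖z‖ ^ 2))

lemma measurable_gaussianDensity :
    Measurable fun z : ℂ => Real.toNNReal (Real.pi⁻¹ * Real.exp (-‖z‖ ^ 2)) := by
  fun_prop

lemma integral_stdComplexGaussian (f : ℂ → ℂ) :
    ∫ z, f z ∂stdComplexGaussian =
      (Real.pi : ℂ)⁻¹ * ∫ z : ℂ, Complex.exp (-(‖z‖ : ℂ) ^ 2) * f z := by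
  have h := integral_withDensity_eq_integral_smul (μ := (volume : Measure ℂ))
    measurable_gaussianDensity f
  refine h.trans ?_
  rw [← integral_const_mul]
  refine integral_congr_ae (Eventually.of_forall fun z => ?_)
  have hp : 0 ≤ Real.pi⁻¹ * Real.exp (-‖z‖ ^ 2) := by positivity
  simp only [NNReal.smul_def, Real.coe_toNNReal _ hp, Complex.real_smul]
  push_cast
  ring

lemma integrable_stdComplexGaussian_iff (f : ℂ → ℂ) :
    Integrable f stdComplexGaussian ↔
      Integrable fun z : ℂ => Complex.exp (-(‖z‖ : ℂ) ^ 2) * f z := by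
  have h := integrable_withDensity_iff_integrable_smul (μ := (volume : Measure ℂ))
    measurable_gaussianDensity (g := f)
  refine h.trans ?_
  have hpi : (Real.pi : ℂ)⁻¹ ≠ 0 := by simp [Real.pi_ne_zero]
  refine Iff.trans ?_ (integrable_const_mul_iff (IsUnit.mk0 _ hpi) _)
  refine integrable_congr (Eventually.of_forall fun z => ?_)
  have hp : 0 ≤ Real.pi⁻¹ * Real.exp (-‖z‖ ^ 2) := by positivity
  simp only [NNReal.smul_def, Real.coe_toNNReal _ hp, Complex.real_smul]
  push_cast
  ring

lemma integral_norm_pow_mul_exp (a : ℕ) :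
    ∫ z : ℂ, ‖z‖ ^ a * Real.exp (-‖z‖ ^ 2) = Real.pi * Real.Gamma ((a + 2) / 2) := by
  have h := Complex.integral_rpow_mul_exp_neg_rpow (p := 2) (q := (a : ℝ)) (by norm_num)
    (by have : (0 : ℝ) ≤ a := by positivity
        linarith)
  simp only [Real.rpow_natCast, Real.rpow_ofNat] at h
  rw [h]
  ring

lemma integrable_norm_pow_mul_exp (a : ℕ) :
    Integrable fun z : ℂ => ‖z‖ ^ a * Real.exp (-‖z‖ ^ 2) := by
  -- A non-integrable function has Bochner integral `0`, but the Gamma value is positive.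
  by_contra h
  have h' := integral_norm_pow_mul_exp a
  rw [integral_undef h] at h'
  have : 0 < Real.Gamma (((a : ℝ) + 2) / 2) := Real.Gamma_pos_of_pos (by positivity)
  have := Real.pi_pos
  exact (by positivity : (0 : ℝ) < Real.pi * Real.Gamma (((a : ℝ) + 2) / 2)).ne h'

lemma integrable_pow_mul_conj_pow (a b : ℕ) :
    Integrable (fun z : ℂ => z ^ a * conj z ^ b) stdComplexGaussian := by
  rw [integrable_stdComplexGaussian_iff]
  refine (integrable_norm_pow_mul_exp (a + b)).mono' (by fun_prop)
    (Eventually.of_forall fun z => le_of_eq ?_)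
  rw [norm_mul, norm_mul, norm_pow, norm_pow, RCLike.norm_conj, Complex.norm_exp, pow_add, mul_comm]
  congr 2
  rw [← Complex.ofReal_pow, ← Complex.ofReal_neg, Complex.ofReal_re]

lemma integral_pow_mul_conj_pow (a b : ℕ) :
    ∫ z, z ^ a * conj z ^ b ∂stdComplexGaussian = if a = b then (a.factorial : ℂ) else 0 := by
  rw [integral_stdComplexGaussian]
  split_ifs with hab
  · subst hab
    have h : ∀ z : ℂ, Complex.exp (-(‖z‖ : ℂ) ^ 2) * (z ^ a * conj z ^ a) =
        ((‖z‖ ^ (2 * a) * Real.exp (-‖z‖ ^ 2) : ℝ) : ℂ) := fun z => by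
      rw [← mul_pow, Complex.mul_conj, Complex.normSq_eq_norm_sq]
      push_cast
      ring
    simp_rw [h]
    rw [integral_complex_ofReal, integral_norm_pow_mul_exp]
    have : ((2 * a : ℕ) + 2 : ℝ) / 2 = a + 1 := by push_cast; ring
    rw [this, Real.Gamma_nat_eq_factorial]
    have := Real.pi_ne_zero
    push_cast
    field_simp
  · have hne : (a : ℂ) - b ≠ 0 := by
      rw [sub_ne_zero]; exact_mod_cast hab
    -- Rotation by `θ` preserves the measure and multiplies the integrand by `e^{iθ(a-b)} = -1`, so
    -- the integral vanishes.
    set θ : ℝ := Real.pi / ((a : ℝ) - b) with hθ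
    set c : Circle := Circle.exp θ with hc
    have hcc : (c : ℂ) ^ a * conj (c : ℂ) ^ b = -1 := by
      rw [hc, Circle.coe_exp, ← Complex.exp_conj, ← Complex.exp_nat_mul, ← Complex.exp_nat_mul,
        ← Complex.exp_add, ← Complex.exp_pi_mul_I]
      congr 1
      simp only [map_mul, Complex.conj_ofReal, Complex.conj_I, hθ]
      push_cast
      field_simp
      ring
    set F : ℂ → ℂ := fun z => Complex.exp (-(‖z‖ : ℂ) ^ 2) * (z ^ a * conj z ^ b) with hF
    have hrot : ∫ z : ℂ, F (rotation c z) = ∫ z : ℂ, F z :=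
      (rotation c).measurePreserving.integral_comp
        (rotation c).toHomeomorph.measurableEmbedding F
    have hFc : ∀ z, F (rotation c z) = -F z := fun z => by
      simp only [hF, rotation_apply, norm_mul, Circle.norm_coe, one_mul, map_mul, mul_pow]
      linear_combination (Complex.exp (-(‖z‖ : ℂ) ^ 2) * (z ^ a * conj z ^ b)) * hcc
    simp_rw [hFc, integral_neg] at hrot
    have : ∫ z : ℂ, F z = 0 := by linear_combination (-1 / 2 : ℂ) * hrot
    rw [this, mul_zero]

instance : IsProbabilityMeasure stdComplexGaussian := by
  have hint := integrable_pow_mul_conj_pow 0 0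
  have h := integral_pow_mul_conj_pow 0 0
  simp only [pow_zero, mul_one, if_true, Nat.factorial_zero, Nat.cast_one] at h hint
  have hfin : IsFiniteMeasure stdComplexGaussian := by
    simpa [integrable_const_iff] using hint
  refine ⟨?_⟩
  rw [integral_const] at h
  have h2 : stdComplexGaussian.real Set.univ = 1 := by
    have := congrArg Complex.re h
    simpa using this
  rw [measureReal_def] at h2
  rw [← ENNReal.toReal_eq_one_iff]
  exact h2

lemma charFun_stdComplexGaussian (t : ℂ) :
    charFun stdComplexGaussian t = Complex.exp (-(‖t‖ : ℂ) ^ 2 / 4) := by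
  rw [charFun_apply, integral_stdComplexGaussian]
  have h := GaussianFourier.integral_cexp_neg_mul_sq_norm_add (b := 1) (V := ℂ) (by simp)
    Complex.I t
  have hpi := Real.pi_ne_zero
  calc _ = (Real.pi : ℂ)⁻¹ * ∫ v : ℂ, Complex.exp (-1 * (‖v‖ : ℂ) ^ 2
          + Complex.I * ((inner ℝ t v : ℝ) : ℂ)) := by
        congr 1
        refine integral_congr_ae (Eventually.of_forall fun z => ?_)
        simp only []
        rw [← Complex.exp_add, real_inner_comm]
        congr 1
        ring
    _ = _ := by
        rw [h, Complex.finrank_real_complex]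
        simp only [div_one, Nat.cast_ofNat, ne_eq, OfNat.ofNat_ne_zero, not_false_eq_true, div_self,
          Complex.cpow_one, Complex.I_sq, mul_one]
        rw [← mul_assoc, inv_mul_cancel₀ (by exact_mod_cast hpi), one_mul]
        congr 1
        ring

end ComplexGaussian

/-! ### Joint law in orthonormal coordinates and orthogonality of monomials. -/

section Law

variable {E : Type*} [AddCommGroup E] [Module ℂ E] [TopologicalSpace E]
  [MeasurableSpace (StrongDual ℂ E)] {Δ : E →ₗ⋆[ℂ] E →ₗ[ℂ] ℂ} {μ : Measure (StrongDual ℂ E)}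
  {ι : Type*} [Fintype ι] [DecidableEq ι]

/-- A family that is orthonormal for the sesquilinear form `Δ`. -/
def FormOrthonormal {κ V : Type*} [DecidableEq κ] [AddCommGroup V] [Module ℂ V]
    (Δ : V →ₗ⋆[ℂ] V →ₗ[ℂ] ℂ) (e : κ → V) : Prop :=
  ∀ i k, Δ (e i) (e k) = if i = k then 1 else 0

lemma FormOrthonormal.apply_sum {V : Type*} [AddCommGroup V] [Module ℂ V]
    {Δ : V →ₗ⋆[ℂ] V →ₗ[ℂ] ℂ} {e : ι → V} (he : FormOrthonormal Δ e) (a b : ι → ℂ) :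
    Δ (∑ i, a i • e i) (∑ i, b i • e i) = ∑ i, conj (a i) * b i := by
  simp only [map_sum, map_smulₛₗ, LinearMap.sum_apply, LinearMap.smul_apply, he _ _,
    smul_eq_mul, RingHom.id_apply]
  refine Finset.sum_congr rfl fun i _ => ?_
  rw [Finset.mul_sum]
  simp [mul_comm]

/-- The values of a complex Gaussian field on an orthonormal family are independent standard
complex Gaussian variables. -/
lemma IsComplexGaussian.map_eval (hμ : IsComplexGaussian Δ μ)
    (hev : ∀ x : E, Measurable fun φ : StrongDual ℂ E => φ x) {e : ι → E}
    (he : FormOrthonormal Δ e) :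
    μ.map (fun φ i => φ (e i)) = Measure.pi fun _ : ι => stdComplexGaussian := by
  have := hμ.isProbabilityMeasure
  have hm : Measurable fun (φ : StrongDual ℂ E) (i : ι) => φ (e i) :=
    measurable_pi_lambda _ fun i => hev (e i)
  have := Measure.isProbabilityMeasure_map (μ := μ) hm.aemeasurable
  rw [← charFun_eq_pi_iff]
  intro t
  rw [charFun_apply, integral_map (by fun_prop) (by fun_prop), integral_map hm.aemeasurable
    (Continuous.aestronglyMeasurable (by fun_prop))]
  -- The factor `1/2` makes `φ ρ + conj (φ ρ)` equal to the real inner product with `t`; then `Δ ρ ρ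
  -- = ∑ |t i|² / 4`, which matches the one-variable characteristic function.
  set ρ : E := ∑ i, (conj (t i) / 2) • e i with hρ
  have h1 : ∀ φ : StrongDual ℂ E,
      Complex.exp (((inner ℝ (WithLp.toLp 2 fun i => φ (e i)) t : ℝ) : ℂ) * Complex.I) =
        Complex.exp (Complex.I * (conj (φ ρ) + φ ρ)) := fun φ => by
    congr 1
    rw [PiLp.inner_apply, mul_comm]
    congr 1
    rw [hρ, map_sum, map_sum, ← Finset.sum_add_distrib]
    push_cast
    refine Finset.sum_congr rfl fun i _ => ?_
    rw [Complex.inner, Complex.re_eq_add_conj]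
    simp only [map_smul, smul_eq_mul, map_mul, map_div₀, Complex.conj_conj, map_ofNat]
    ring
  simp_rw [h1]
  rw [hμ.charFun, hρ, he.apply_sum, ← Finset.sum_neg_distrib, Complex.exp_sum]
  refine Finset.prod_congr rfl fun i _ => ?_
  rw [charFun_stdComplexGaussian]
  congr 1
  simp only [map_div₀, Complex.conj_conj, map_ofNat]
  have := Complex.mul_conj (t i)
  rw [Complex.normSq_eq_norm_sq] at this
  push_cast at this
  linear_combination (-1 / 4 : ℂ) * this

lemma IsComplexGaussian.integral_eval (hμ : IsComplexGaussian Δ μ)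
    (hev : ∀ x : E, Measurable fun φ : StrongDual ℂ E => φ x) {e : ι → E}
    (he : FormOrthonormal Δ e) {F : (ι → ℂ) → ℂ} (hF : Continuous F) :
    ∫ φ, F (fun i => φ (e i)) ∂μ = ∫ z, F z ∂(Measure.pi fun _ : ι => stdComplexGaussian) := by
  rw [← hμ.map_eval hev he, integral_map (measurable_pi_lambda _ fun i => hev (e i)).aemeasurable
    hF.aestronglyMeasurable]

lemma IsComplexGaussian.integrable_eval (hμ : IsComplexGaussian Δ μ)
    (hev : ∀ x : E, Measurable fun φ : StrongDual ℂ E => φ x) {e : ι → E}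
    (he : FormOrthonormal Δ e) {F : (ι → ℂ) → ℂ}
    (hF : Integrable F (Measure.pi fun _ : ι => stdComplexGaussian)) :
    Integrable (fun φ => F fun i => φ (e i)) μ := by
  rw [← hμ.map_eval hev he] at hF
  exact hF.comp_measurable (measurable_pi_lambda _ fun i => hev (e i))

/-- Monomials in orthonormal coordinates are integrable. -/
lemma IsComplexGaussian.integrable_monomial (hμ : IsComplexGaussian Δ μ)
    (hev : ∀ x : E, Measurable fun φ : StrongDual ℂ E => φ x) {e : ι → E}
    (he : FormOrthonormal Δ e) (α β : ι → ℕ) :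
    Integrable (fun φ => (∏ i, φ (e i) ^ α i) * conj (∏ i, φ (e i) ^ β i)) μ := by
  have h : Integrable (fun z : ι → ℂ => ∏ i, (z i ^ α i * conj (z i) ^ β i))
      (Measure.pi fun _ : ι => stdComplexGaussian) :=
    Integrable.fintype_prod (f := fun i (z : ℂ) => z ^ α i * conj z ^ β i)
      fun i => integrable_pow_mul_conj_pow (α i) (β i)
  refine (hμ.integrable_eval hev he h).congr (Eventually.of_forall fun φ => ?_)
  simp [Finset.prod_mul_distrib, map_prod]

/-- Monomials in orthonormal coordinates are orthogonal, and `‖z^α‖² = α!`. -/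
lemma IsComplexGaussian.integral_monomial (hμ : IsComplexGaussian Δ μ)
    (hev : ∀ x : E, Measurable fun φ : StrongDual ℂ E => φ x) {e : ι → E}
    (he : FormOrthonormal Δ e) (α β : ι → ℕ) :
    ∫ φ, (∏ i, φ (e i) ^ α i) * conj (∏ i, φ (e i) ^ β i) ∂μ =
      if α = β then ((∏ i, (α i).factorial : ℕ) : ℂ) else 0 := by
  have h1 := hμ.integral_eval hev he (F := fun z : ι → ℂ => ∏ i, (z i ^ α i * conj (z i) ^ β i))
    (by fun_prop)
  rw [integral_fintype_prod_eq_prod (f := fun i (z : ℂ) => z ^ α i * conj z ^ β i)] at h1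
  calc _ = ∫ φ, ∏ i, (φ (e i) ^ α i * conj (φ (e i)) ^ β i) ∂μ := by
        refine integral_congr_ae (Eventually.of_forall fun φ => ?_)
        simp [Finset.prod_mul_distrib, map_prod]
    _ = _ := by
        rw [h1]
        simp_rw [integral_pow_mul_conj_pow]
        split_ifs with hab
        · subst hab; simp
        · obtain ⟨i, hi⟩ := Function.ne_iff.mp hab
          exact Finset.prod_eq_zero (Finset.mem_univ i) (if_neg hi)

end Law

/-! ### Weighted Fock norms and their submultiplicativity. -/

section WeightedNorm

variable {ι : Type*} [Fintype ι]

/-- The weight `r^|α| α!` of a multi-index. -/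
def multiWeight (r : ℝ) (α : ι →₀ ℕ) : ℝ := ∏ i, (r ^ α i * (α i).factorial)

lemma multiWeight_nonneg {r : ℝ} (hr : 0 ≤ r) (α : ι →₀ ℕ) : 0 ≤ multiWeight r α :=
  Finset.prod_nonneg fun i _ => by positivity

lemma multiWeight_pos {r : ℝ} (hr : 0 < r) (α : ι →₀ ℕ) : 0 < multiWeight r α :=
  Finset.prod_pos fun i _ => by positivity

lemma multiWeight_mul (r s : ℝ) (α : ι →₀ ℕ) :
    multiWeight (r * s) α = r ^ α.degree * multiWeight s α := by
  simp only [multiWeight, mul_pow, mul_assoc, Finset.prod_mul_distrib, Finset.prod_pow_eq_pow_sum,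
    Finsupp.degree_eq_sum]

lemma multiWeight_eq (r : ℝ) (α : ι →₀ ℕ) :
    multiWeight r α = r ^ α.degree * multiWeight 1 α := by
  rw [← multiWeight_mul, mul_one]

/-- The binomial theorem for `u⁻¹ + v⁻¹` divided by `n!`; multiplied over the coordinates it gives
the multi-index version. -/
lemma sum_antidiagonal_pow_div_factorial (u v : ℝ) (n : ℕ) :
    ∑ m ∈ Finset.HasAntidiagonal.antidiagonal n, (u ^ m.1 * m.1.factorial)⁻¹ * (v ^ m.2 * m.2.factorial)⁻¹ =
      (u⁻¹ + v⁻¹) ^ n * (n.factorial : ℝ)⁻¹ := by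
  rw [(Commute.all _ _).add_pow', Finset.sum_mul]
  refine Finset.sum_congr rfl fun m hm => ?_
  have hm' : m.1 + m.2 = n := by simpa using hm
  have h := Nat.choose_mul_factorial_mul_factorial (show m.1 ≤ n by omega)
  rw [show n - m.1 = m.2 by omega] at h
  have h' : (n.factorial : ℝ) = n.choose m.1 * m.1.factorial * m.2.factorial := by
    exact_mod_cast h.symm
  have hc : (n.choose m.1 : ℝ) ≠ 0 := by
    have := Nat.choose_pos (show m.1 ≤ n by omega)
    positivity
  rw [h', nsmul_eq_mul]
  simp only [mul_inv, inv_pow]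
  field_simp

/-- The multinomial theorem for multi-indices, in the form needed for the Cauchy–Schwarz estimate
of a product. -/
lemma sum_antidiagonal_multiWeight_inv [DecidableEq ι] {s t : ℝ} (hst : s⁻¹ + t⁻¹ = 1)
    (β : ι →₀ ℕ) :
    ∑ x ∈ Finset.HasAntidiagonal.antidiagonal β, (multiWeight s x.1)⁻¹ * (multiWeight t x.2)⁻¹ =
      (multiWeight 1 β)⁻¹ := by
  have h := Finset.prod_univ_sum (fun i => Finset.HasAntidiagonal.antidiagonal (β i))
    (fun _ (m : ℕ × ℕ) => (s ^ m.1 * m.1.factorial)⁻¹ * (t ^ m.2 * m.2.factorial)⁻¹)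
  simp only [sum_antidiagonal_pow_div_factorial, hst, one_pow, one_mul] at h
  have h1 : (multiWeight 1 β)⁻¹ = ∏ i, ((β i).factorial : ℝ)⁻¹ := by
    simp [multiWeight]
  rw [h1, h]
  refine Finset.sum_nbij' (fun x i => (x.1 i, x.2 i))
    (fun y => (Finsupp.equivFunOnFinite.symm fun i => (y i).1,
      Finsupp.equivFunOnFinite.symm fun i => (y i).2)) ?_ ?_ ?_ ?_ ?_
  · intro x hx
    have hx' : x.1 + x.2 = β := by simpa using hx
    simp [Fintype.mem_piFinset, ← hx']
  · intro y hy
    rw [Fintype.mem_piFinset] at hy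
    simp only [Finset.HasAntidiagonal.mem_antidiagonal] at hy ⊢
    ext i
    simpa using hy i
  · intro x _
    ext <;> simp
  · intro y _
    ext <;> simp
  · intro x _
    simp [multiWeight, Finset.prod_mul_distrib]

/-- The squared Fock norm of a polynomial, with weight `r` per degree. -/
def fockNormSq (r : ℝ) (p : MvPolynomial ι ℂ) : ℝ :=
  ∑ α ∈ p.support, multiWeight r α * ‖p.coeff α‖ ^ 2

lemma fockNormSq_nonneg {r : ℝ} (hr : 0 ≤ r) (p : MvPolynomial ι ℂ) : 0 ≤ fockNormSq r p :=
  Finset.sum_nonneg fun α _ => mul_nonneg (multiWeight_nonneg hr α) (by positivity)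

lemma fockNormSq_eq_sum (r : ℝ) {p : MvPolynomial ι ℂ} {S : Finset (ι →₀ ℕ)}
    (hS : p.support ⊆ S) : fockNormSq r p = ∑ α ∈ S, multiWeight r α * ‖p.coeff α‖ ^ 2 :=
  Finset.sum_subset hS fun α _ hα => by
    rw [MvPolynomial.notMem_support_iff.mp hα]; simp

/-- A coefficient of `p * q` is a convolution. Cauchy–Schwarz with weights `s^|α| α!` and `t^|γ| γ!`
produces the sum of reciprocal weights, which is exactly `1/β!` when `s⁻¹ + t⁻¹ = 1` and cancels the
factorial in the norm of the product. -/
lemma fockNormSq_mul_le {r s t : ℝ} (hr : 0 ≤ r) (hs : 0 < s) (ht : 0 < t)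
    (hst : s⁻¹ + t⁻¹ = 1) (p q : MvPolynomial ι ℂ) :
    fockNormSq r (p * q) ≤ fockNormSq (r * s) p * fockNormSq (r * t) q := by
  classical
  set A : (ι →₀ ℕ) → ℝ := fun α => multiWeight (r * s) α * ‖p.coeff α‖ ^ 2 with hA
  set B : (ι →₀ ℕ) → ℝ := fun α => multiWeight (r * t) α * ‖q.coeff α‖ ^ 2 with hB
  have hA0 : ∀ α, 0 ≤ A α := fun α =>
    mul_nonneg (multiWeight_nonneg (by positivity) α) (by positivity)
  have hB0 : ∀ α, 0 ≤ B α := fun α =>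
    mul_nonneg (multiWeight_nonneg (by positivity) α) (by positivity)
  have key : ∀ β, multiWeight r β * ‖(p * q).coeff β‖ ^ 2 ≤
      ∑ x ∈ Finset.HasAntidiagonal.antidiagonal β, A x.1 * B x.2 := fun β => by
    have h1 : ‖(p * q).coeff β‖ ^ 2 ≤
        (∑ x ∈ Finset.HasAntidiagonal.antidiagonal β, (multiWeight s x.1 * ‖p.coeff x.1‖ ^ 2) *
          (multiWeight t x.2 * ‖q.coeff x.2‖ ^ 2)) *
        ∑ x ∈ Finset.HasAntidiagonal.antidiagonal β,
          (multiWeight s x.1)⁻¹ * (multiWeight t x.2)⁻¹ := by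
      rw [MvPolynomial.coeff_mul]
      refine le_trans (pow_le_pow_left₀ (norm_nonneg _) (norm_sum_le _ _) 2) ?_
      refine Finset.sum_sq_le_sum_mul_sum_of_sq_le_mul _ ?_ ?_ ?_
      · intro x _
        exact mul_nonneg (mul_nonneg (multiWeight_nonneg hs.le _) (by positivity))
          (mul_nonneg (multiWeight_nonneg ht.le _) (by positivity))
      · intro x _
        exact mul_nonneg (inv_nonneg.mpr (multiWeight_nonneg hs.le _))
          (inv_nonneg.mpr (multiWeight_nonneg ht.le _))
      · intro x _
        have h2 := (multiWeight_pos hs x.1).ne'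
        have h3 := (multiWeight_pos ht x.2).ne'
        rw [norm_mul]
        apply le_of_eq
        field_simp
    rw [sum_antidiagonal_multiWeight_inv hst] at h1
    calc multiWeight r β * ‖(p * q).coeff β‖ ^ 2
        ≤ multiWeight r β * _ := mul_le_mul_of_nonneg_left h1 (multiWeight_nonneg hr β)
      _ = r ^ β.degree * ∑ x ∈ Finset.HasAntidiagonal.antidiagonal β,
          (multiWeight s x.1 * ‖p.coeff x.1‖ ^ 2) *
          (multiWeight t x.2 * ‖q.coeff x.2‖ ^ 2) := by
          have := (multiWeight_pos one_pos β).ne'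
          rw [multiWeight_eq r β]
          field_simp
      _ = _ := by
          rw [Finset.mul_sum]
          refine Finset.sum_congr rfl fun x hx => ?_
          have hx' : x.1 + x.2 = β := by simpa using hx
          rw [hA, hB]
          simp only [multiWeight_mul, ← hx', map_add, pow_add]
          ring
  calc fockNormSq r (p * q)
      ≤ ∑ β ∈ (p * q).support, ∑ x ∈ Finset.HasAntidiagonal.antidiagonal β, A x.1 * B x.2 :=
        Finset.sum_le_sum fun β _ => key β
    _ = ∑ β ∈ (p * q).support, ∑ x ∈ p.support ×ˢ q.support with x.1 + x.2 = β,
          A x.1 * B x.2 := by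
        refine Finset.sum_congr rfl fun β _ => (Finset.sum_subset ?_ ?_).symm
        · intro x hx
          simpa using (Finset.mem_filter.mp hx).2
        · intro x hx hx'
          have hx1 : x.1 + x.2 = β := by simpa using hx
          simp only [Finset.mem_filter, Finset.mem_product, MvPolynomial.mem_support_iff, hx1,
            and_true, not_and_or, not_not] at hx'
          rcases hx' with h | h <;> simp [hA, hB, h]
    _ ≤ ∑ x ∈ p.support ×ˢ q.support, A x.1 * B x.2 :=
        Finset.sum_fiberwise_le_sum_of_sum_fiber_nonneg fun y _ =>
          Finset.sum_nonneg fun x _ => mul_nonneg (hA0 _) (hB0 _)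
    _ = _ := by
        rw [Finset.sum_product, fockNormSq, fockNormSq, Finset.sum_mul_sum]

lemma fockNormSq_pow_le {k : ℕ} (hk : 1 ≤ k) (p : MvPolynomial ι ℂ) :
    ∀ {r : ℝ}, 0 ≤ r → fockNormSq r (p ^ k) ≤ fockNormSq (r * k) p ^ k := by
  induction k, hk using Nat.le_induction with
  | base => intro r _; simp
  | succ k hk ih =>
    intro r hr
    have hk0 : (0 : ℝ) < k := by exact_mod_cast hk
    -- These conjugate weights are balanced: the induction hypothesis multiplies `s` by `k`, so
    -- every one of the `k + 1` factors ends up with weight `r (k + 1)`.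
    have h := fockNormSq_mul_le (s := (k + 1) / k) (t := k + 1) hr (by positivity)
      (by positivity) (by field_simp) (p ^ k) p
    rw [pow_succ p k]
    refine h.trans ?_
    have h2 := ih (r := r * ((k + 1) / k)) (by positivity)
    have h3 : r * (((k : ℝ) + 1) / k) * k = r * (k + 1) := by field_simp
    rw [h3] at h2
    push_cast
    rw [pow_succ]
    exact mul_le_mul_of_nonneg_right h2 (fockNormSq_nonneg (by positivity) p)

lemma coeff_sum_homogeneous {ι : Type*} {p : ℕ → MvPolynomial ι ℂ} (hp : ∀ n, (p n).IsHomogeneous n)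
    (f : ℕ → ℂ) (d : ℕ) (α : ι →₀ ℕ) :
    (∑ n ∈ Finset.range d, MvPolynomial.C (f n) * p n).coeff α =
      if α.degree < d then f α.degree * (p α.degree).coeff α else 0 := by
  rw [MvPolynomial.coeff_sum]
  simp only [MvPolynomial.coeff_C_mul]
  split_ifs with h
  · rw [Finset.sum_eq_single_of_mem α.degree (Finset.mem_range.mpr h)]
    intro n _ hn
    rw [(hp n).coeff_eq_zero hn.symm, mul_zero]
  · refine Finset.sum_eq_zero fun n hn => ?_
    have := Finset.mem_range.mp hn
    rw [(hp n).coeff_eq_zero (by omega), mul_zero]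

/-- Both norms are diagonal in the monomials, and a monomial occurs only in the summand of its own
degree; so a comparison of multipliers degree by degree suffices. -/
lemma fockNormSq_sum_le {p : ℕ → MvPolynomial ι ℂ} (hp : ∀ n, (p n).IsHomogeneous n)
    {f g : ℕ → ℝ} {r : ℝ} (h : ∀ n, r ^ n * f n ^ 2 ≤ g n ^ 2) (d : ℕ) :
    fockNormSq r (∑ n ∈ Finset.range d, MvPolynomial.C (f n : ℂ) * p n) ≤
      fockNormSq 1 (∑ n ∈ Finset.range d, MvPolynomial.C (g n : ℂ) * p n) := by
  classical
  rw [fockNormSq_eq_sum r Finset.subset_union_left, fockNormSq_eq_sum 1 Finset.subset_union_right]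
  refine Finset.sum_le_sum fun α _ => ?_
  rw [coeff_sum_homogeneous hp, coeff_sum_homogeneous hp, multiWeight_eq r]
  split_ifs
  · simp only [norm_mul, mul_pow, Complex.norm_real, Real.norm_eq_abs, sq_abs]
    have h1 := mul_le_mul_of_nonneg_right (h α.degree)
      (mul_nonneg (multiWeight_nonneg zero_le_one α) (sq_nonneg ‖(p α.degree).coeff α‖))
    linarith
  · simp

end WeightedNorm

/-! ### Orthonormal families for a positive definite hermitian form. -/

section FormBasis

variable {V : Type*} [AddCommGroup V] [Module ℂ V] {Δ : V →ₗ⋆[ℂ] V →ₗ[ℂ] ℂ}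

/-- The inner product given by a positive definite hermitian form. -/
@[reducible] def formCore (hherm : ∀ ρ χ, Δ ρ χ = conj (Δ χ ρ)) (hpos : ∀ ρ, ρ ≠ 0 → 0 < (Δ ρ ρ).re) :
    InnerProductSpace.Core ℂ V where
  inner x y := Δ x y
  conj_inner_symm x y := (hherm x y).symm
  re_inner_nonneg x := by
    rcases eq_or_ne x 0 with rfl | hx
    · simp
    · exact (hpos x hx).le
  add_left x y z := by simp
  smul_left x y r := by simp
  definite x hx := by
    by_contra h
    have := hpos x h
    change Δ x x = 0 at hx
    simp [hx] at this

lemma exists_formOrthonormal_span (hherm : ∀ ρ χ, Δ ρ χ = conj (Δ χ ρ))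
    (hpos : ∀ ρ, ρ ≠ 0 → 0 < (Δ ρ ρ).re) (s : Finset V) :
    ∃ (d : ℕ) (e : Fin d → V), FormOrthonormal Δ e ∧
      ∀ x ∈ s, x ∈ Submodule.span ℂ (Set.range e) := by
  let core := formCore hherm hpos
  let : NormedAddCommGroup V := core.toNormedAddCommGroup
  let : InnerProductSpace ℂ V := InnerProductSpace.ofCore core.toCore
  set S : Submodule ℂ V := Submodule.span ℂ (s : Set V) with hS
  have : FiniteDimensional ℂ S := FiniteDimensional.span_finset ℂ s
  refine ⟨Module.finrank ℂ S, fun i => (stdOrthonormalBasis ℂ S i : V), ?_, ?_⟩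
  · intro i k
    have h := orthonormal_iff_ite.mp (stdOrthonormalBasis ℂ S).orthonormal i k
    rw [Submodule.coe_inner] at h
    exact h
  · intro x hx
    have hxS : x ∈ S := Submodule.subset_span hx
    have h := (stdOrthonormalBasis ℂ S).sum_repr ⟨x, hxS⟩
    have h2 := congrArg (Subtype.val) h
    simp only [AddSubmonoidClass.coe_finsetSum, SetLike.val_smul] at h2
    rw [← h2]
    exact Submodule.sum_mem _ fun i _ => Submodule.smul_mem _ _
      (Submodule.subset_span (Set.mem_range_self i))

/-- Gram–Schmidt applied to countably many elements of an algebraic basis; neither completeness nor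
separability for `Δ` is involved. -/
lemma exists_formOrthonormal_nat (hherm : ∀ ρ χ, Δ ρ χ = conj (Δ χ ρ))
    (hpos : ∀ ρ, ρ ≠ 0 → 0 < (Δ ρ ρ).re) (hV : ¬ FiniteDimensional ℂ V) :
    ∃ g : ℕ → V, FormOrthonormal Δ g := by
  let core := formCore hherm hpos
  let : NormedAddCommGroup V := core.toNormedAddCommGroup
  let : InnerProductSpace ℂ V := InnerProductSpace.ofCore core.toCore
  let b := Module.Basis.ofVectorSpace ℂ V
  have hinf : Infinite (Module.Basis.ofVectorSpaceIndex ℂ V) := by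
    by_contra h
    rw [not_infinite_iff_finite] at h
    exact hV (Module.Finite.of_basis b)
  let f : ℕ → V := fun n => b (Infinite.natEmbedding _ n)
  have hf : LinearIndependent ℂ f :=
    b.linearIndependent.comp _ (Infinite.natEmbedding _).injective
  exact ⟨InnerProductSpace.gramSchmidtNormed ℂ f, fun i k =>
    orthonormal_iff_ite.mp (InnerProductSpace.gramSchmidtNormed_orthonormal hf) i k⟩

end FormBasis

/-! ### Holomorphic polynomials in coordinates: `L²` norms and hypercontractivity. -/

section Polynomials

variable {E : Type*} [AddCommGroup E] [Module ℂ E] [TopologicalSpace E]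

/-- A homogeneous polynomial involves finitely many vectors, and becomes a homogeneous
polynomial in the coordinates of any family spanning these. -/
lemma homPoly_exists_finset {n : ℕ} {P : StrongDual ℂ E → ℂ} (hP : P ∈ homPoly E n) :
    ∃ s : Finset E, ∀ (d : ℕ) (e : Fin d → E),
      (∀ x ∈ s, x ∈ Submodule.span ℂ (Set.range e)) →
      ∃ p : MvPolynomial (Fin d) ℂ, p.IsHomogeneous n ∧
        ∀ φ : StrongDual ℂ E, P φ = p.eval fun i => φ (e i) := by
  classical
  induction hP using Submodule.span_induction with
  | mem P hP =>
    obtain ⟨χ, rfl⟩ := hP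
    refine ⟨Finset.univ.image χ, fun d e h => ?_⟩
    have h1 : ∀ l, ∃ c : Fin d → ℂ, ∑ i, c i • e i = χ l := fun l =>
      (Submodule.mem_span_range_iff_exists_fun ℂ).mp (h _ (by simp))
    choose c hc using h1
    refine ⟨∏ l, ∑ i, MvPolynomial.C (c l i) * MvPolynomial.X i, ?_, fun φ => ?_⟩
    · have := MvPolynomial.IsHomogeneous.prod Finset.univ
        (fun l : Fin n => ∑ i, MvPolynomial.C (c l i) * MvPolynomial.X (R := ℂ) i) (fun _ => 1)
        fun l _ => MvPolynomial.IsHomogeneous.sum _ _ _ fun i _ => by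
          simpa using (MvPolynomial.isHomogeneous_C _ _).mul (MvPolynomial.isHomogeneous_X ℂ i)
      simpa using this
    · simp only [map_prod, map_sum, map_mul, MvPolynomial.eval_C, MvPolynomial.eval_X]
      refine Finset.prod_congr rfl fun l _ => ?_
      rw [← hc l]
      simp
  | zero => exact ⟨∅, fun d e _ => ⟨0, MvPolynomial.isHomogeneous_zero _ _ _, by simp⟩⟩
  | add P Q _ _ hP hQ =>
    obtain ⟨s, hs⟩ := hP
    obtain ⟨t, ht⟩ := hQ
    refine ⟨s ∪ t, fun d e h => ?_⟩
    obtain ⟨p, hp, hp'⟩ := hs d e fun x hx => h x (Finset.mem_union_left _ hx)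
    obtain ⟨q, hq, hq'⟩ := ht d e fun x hx => h x (Finset.mem_union_right _ hx)
    exact ⟨p + q, hp.add hq, fun φ => by simp [hp', hq']⟩
  | smul c P _ hP =>
    obtain ⟨s, hs⟩ := hP
    refine ⟨s, fun d e h => ?_⟩
    obtain ⟨p, hp, hp'⟩ := hs d e h
    refine ⟨MvPolynomial.C c * p, ?_, fun φ => by simp [hp']⟩
    simpa using (MvPolynomial.isHomogeneous_C _ c).mul hp

/-- Finitely many homogeneous polynomials can be written in the same orthonormal coordinates. -/
lemma homPoly_exists_coordinates {Δ : E →ₗ⋆[ℂ] E →ₗ[ℂ] ℂ} (hΔ : IsCovariance Δ)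
    {P : ℕ → StrongDual ℂ E → ℂ} (hP : ∀ n, P n ∈ homPoly E n) (N : ℕ) :
    ∃ (d : ℕ) (e : Fin d → E) (p : ℕ → MvPolynomial (Fin d) ℂ), FormOrthonormal Δ e ∧
      (∀ n, (p n).IsHomogeneous n) ∧
      ∀ n < N, ∀ φ : StrongDual ℂ E, P n φ = (p n).eval fun i => φ (e i) := by
  classical
  choose s hs using fun n => homPoly_exists_finset (hP n)
  obtain ⟨d, e, he, hspan⟩ := exists_formOrthonormal_span hΔ.hermitian hΔ.posDef
    ((Finset.range N).biUnion s)
  have h : ∀ n, ∃ p : MvPolynomial (Fin d) ℂ, p.IsHomogeneous n ∧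
      (n < N → ∀ φ : StrongDual ℂ E, P n φ = p.eval fun i => φ (e i)) := fun n => by
    by_cases hn : n < N
    · obtain ⟨p, hp, hp'⟩ := hs n d e fun x hx =>
        hspan x (Finset.mem_biUnion.mpr ⟨n, Finset.mem_range.mpr hn, hx⟩)
      exact ⟨p, hp, fun _ => hp'⟩
    · exact ⟨0, MvPolynomial.isHomogeneous_zero _ _ _, fun h => absurd h hn⟩
  choose p hp hp' using h
  exact ⟨d, e, p, he, hp, hp'⟩

variable [MeasurableSpace (StrongDual ℂ E)] {Δ : E →ₗ⋆[ℂ] E →ₗ[ℂ] ℂ}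
  {μ : Measure (StrongDual ℂ E)} {ι : Type*} [Fintype ι]

lemma measurable_eval_mvPolynomial
    (hev : ∀ x : E, Measurable fun φ : StrongDual ℂ E => φ x) (e : ι → E)
    (p : MvPolynomial ι ℂ) :
    Measurable fun φ : StrongDual ℂ E => p.eval fun i => φ (e i) :=
  (MvPolynomial.continuous_eval p).measurable.comp (measurable_pi_lambda _ fun i => hev (e i))

variable [DecidableEq ι]

lemma IsComplexGaussian.integrable_eval_mul (hμ : IsComplexGaussian Δ μ)
    (hev : ∀ x : E, Measurable fun φ : StrongDual ℂ E => φ x) {e : ι → E}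
    (he : FormOrthonormal Δ e) (p q : MvPolynomial ι ℂ) :
    Integrable (fun φ : StrongDual ℂ E => p.eval (fun i => φ (e i)) *
      conj (q.eval fun i => φ (e i))) μ := by
  simp only [MvPolynomial.eval_eq', map_sum, Finset.sum_mul_sum]
  refine integrable_finsetSum _ fun α _ => integrable_finsetSum _ fun β _ => ?_
  refine ((hμ.integrable_monomial hev he α β).const_mul
    (p.coeff α * conj (q.coeff β))).congr (Eventually.of_forall fun φ => ?_)
  simp only [map_mul]
  ring

lemma IsComplexGaussian.integral_eval_mul (hμ : IsComplexGaussian Δ μ)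
    (hev : ∀ x : E, Measurable fun φ : StrongDual ℂ E => φ x) {e : ι → E}
    (he : FormOrthonormal Δ e) (p q : MvPolynomial ι ℂ) :
    ∫ φ : StrongDual ℂ E, p.eval (fun i => φ (e i)) * conj (q.eval fun i => φ (e i)) ∂μ =
      ∑ α ∈ p.support, (multiWeight 1 α : ℂ) * (p.coeff α * conj (q.coeff α)) := by
  have h : ∀ φ : StrongDual ℂ E, p.eval (fun i => φ (e i)) * conj (q.eval fun i => φ (e i)) =
      ∑ α ∈ p.support, ∑ β ∈ q.support, (p.coeff α * conj (q.coeff β)) *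
        ((∏ i, φ (e i) ^ α i) * conj (∏ i, φ (e i) ^ β i)) := fun φ => by
    simp only [MvPolynomial.eval_eq', map_sum, Finset.sum_mul_sum, map_mul]
    exact Finset.sum_congr rfl fun α _ => Finset.sum_congr rfl fun β _ => by ring
  simp_rw [h]
  have hint : ∀ (α β : ι →₀ ℕ), Integrable (fun φ : StrongDual ℂ E =>
      (p.coeff α * conj (q.coeff β)) * ((∏ i, φ (e i) ^ α i) * conj (∏ i, φ (e i) ^ β i))) μ :=
    fun α β => (hμ.integrable_monomial hev he α β).const_mul _
  rw [integral_finsetSum _ fun α _ => integrable_finsetSum _ fun β _ => hint α β]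
  refine Finset.sum_congr rfl fun α _ => ?_
  rw [integral_finsetSum _ fun β _ => hint α β]
  simp_rw [integral_const_mul, hμ.integral_monomial hev he, DFunLike.coe_fn_eq]
  by_cases hα : α ∈ q.support
  · rw [Finset.sum_eq_single_of_mem α hα fun β _ hβ => by simp [hβ.symm]]
    simp [multiWeight, mul_comm]
  · rw [MvPolynomial.notMem_support_iff.mp hα]
    simp only [map_zero, mul_zero]
    refine Finset.sum_eq_zero fun β hβ => ?_
    rw [if_neg (by rintro rfl; exact hα hβ), mul_zero]

/-- The `L²` norm of a polynomial is its Fock norm. -/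
lemma IsComplexGaussian.lintegral_eval (hμ : IsComplexGaussian Δ μ)
    (hev : ∀ x : E, Measurable fun φ : StrongDual ℂ E => φ x) {e : ι → E}
    (he : FormOrthonormal Δ e) (p : MvPolynomial ι ℂ) :
    ∫⁻ φ : StrongDual ℂ E, ‖p.eval fun i => φ (e i)‖ₑ ^ 2 ∂μ = ENNReal.ofReal (fockNormSq 1 p) := by
  have hsq : ∀ z : ℂ, z * conj z = ((‖z‖ ^ 2 : ℝ) : ℂ) := fun z => by
    rw [Complex.mul_conj, Complex.normSq_eq_norm_sq]
  have hint := hμ.integrable_eval_mul hev he p p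
  have h := hμ.integral_eval_mul hev he p p
  simp_rw [hsq] at h hint
  rw [integral_complex_ofReal] at h
  have h' : ∫ φ : StrongDual ℂ E, ‖p.eval fun i => φ (e i)‖ ^ 2 ∂μ = fockNormSq 1 p := by
    unfold fockNormSq
    exact_mod_cast h
  have hint' : Integrable (fun φ : StrongDual ℂ E => ‖p.eval fun i => φ (e i)‖ ^ 2) μ := by
    exact hint.re
  rw [← h', ofReal_integral_eq_lintegral_ofReal hint' (Eventually.of_forall fun _ => by positivity)]
  refine lintegral_congr fun φ => ?_
  rw [ENNReal.ofReal_pow (norm_nonneg _), ofReal_norm]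

lemma eLpNorm_two_eq {Ω : Type*} [MeasurableSpace Ω] (ν : Measure Ω) (F : Ω → ℂ) :
    eLpNorm F 2 ν = (∫⁻ x, ‖F x‖ₑ ^ 2 ∂ν) ^ (1 / 2 : ℝ) := by
  rw [eLpNorm_eq_lintegral_rpow_enorm_toReal (by norm_num) (by norm_num)]
  simp

/-- Even exponents reduce to `L²` because powers of a holomorphic polynomial are again holomorphic
polynomials, to which the Fock norm applies. -/
lemma eLpNorm_two_mul_eq {Ω : Type*} [MeasurableSpace Ω] (ν : Measure Ω) (F : Ω → ℂ) {k : ℕ}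
    (hk : 1 ≤ k) :
    eLpNorm F ((2 * k : ℕ) : ℝ≥0∞) ν =
      (∫⁻ x, ‖F x ^ k‖ₑ ^ 2 ∂ν) ^ (1 / (2 * k : ℝ)) := by
  rw [eLpNorm_eq_lintegral_rpow_enorm_toReal (by simp; omega)
    (ENNReal.natCast_ne_top _)]
  simp only [ENNReal.toReal_natCast, ENNReal.rpow_natCast, enorm_pow, ← pow_mul, mul_comm k 2]
  push_cast
  rfl

/-- Hypercontractivity in orthonormal coordinates. -/
lemma IsComplexGaussian.eLpNorm_eval_le (hμ : IsComplexGaussian Δ μ)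
    (hev : ∀ x : E, Measurable fun φ : StrongDual ℂ E => φ x) {e : ι → E}
    (he : FormOrthonormal Δ e) (p : MvPolynomial ι ℂ) {k : ℕ} (hk : 1 ≤ k) :
    eLpNorm (fun φ : StrongDual ℂ E => p.eval fun i => φ (e i)) ((2 * k : ℕ) : ℝ≥0∞) μ ≤
      ENNReal.ofReal (fockNormSq k p) ^ (1 / 2 : ℝ) := by
  rw [eLpNorm_two_mul_eq _ _ hk]
  have h1 : ∫⁻ φ : StrongDual ℂ E, ‖(p.eval fun i => φ (e i)) ^ k‖ₑ ^ 2 ∂μ ≤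
      ENNReal.ofReal (fockNormSq k p) ^ k := by
    simp_rw [← map_pow]
    rw [hμ.lintegral_eval hev he, ← ENNReal.ofReal_pow (fockNormSq_nonneg (by positivity) p)]
    refine ENNReal.ofReal_le_ofReal ?_
    simpa using fockNormSq_pow_le hk p zero_le_one
  refine (ENNReal.rpow_le_rpow h1 (by positivity)).trans (le_of_eq ?_)
  rw [← ENNReal.rpow_natCast, ← ENNReal.rpow_mul]
  congr 1
  have : (k : ℝ) ≠ 0 := by positivity
  field_simp

/-- Holomorphic polynomials are in all `L^r`. -/
lemma IsComplexGaussian.memLp_homPoly (hμ : IsComplexGaussian Δ μ) (hΔ : IsCovariance Δ)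
    (hev : ∀ x : E, Measurable fun φ : StrongDual ℂ E => φ x) {n : ℕ}
    {P : StrongDual ℂ E → ℂ} (hP : P ∈ homPoly E n) (r : ℕ) : MemLp P r μ := by
  have := hμ.isProbabilityMeasure
  obtain ⟨s, hs⟩ := homPoly_exists_finset hP
  obtain ⟨d, e, he, hspan⟩ := exists_formOrthonormal_span hΔ.hermitian hΔ.posDef s
  obtain ⟨p, -, hp⟩ := hs d e hspan
  obtain rfl : P = fun φ : StrongDual ℂ E => p.eval fun i => φ (e i) := funext hp
  -- Half the exponent is taken to be `r + 1`, which is at least `1` even for `r = 0`.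
  have h : MemLp (fun φ : StrongDual ℂ E => p.eval fun i => φ (e i))
      ((2 * (r + 1) : ℕ) : ℝ≥0∞) μ := by
    refine ⟨(measurable_eval_mvPolynomial hev e p).aestronglyMeasurable, ?_⟩
    exact (hμ.eLpNorm_eval_le hev he p (by omega)).trans_lt
      (ENNReal.rpow_lt_top_of_nonneg (by norm_num) ENNReal.ofReal_ne_top)
  exact h.mono_exponent (by exact_mod_cast (by omega))

/-- Homogeneous polynomials of different degrees are orthogonal. -/
lemma IsComplexGaussian.integral_homPoly_mul_conj (hμ : IsComplexGaussian Δ μ)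
    (hΔ : IsCovariance Δ) (hev : ∀ x : E, Measurable fun φ : StrongDual ℂ E => φ x) {n m : ℕ}
    (hnm : n ≠ m) {P Q : StrongDual ℂ E → ℂ} (hP : P ∈ homPoly E n) (hQ : Q ∈ homPoly E m) :
    ∫ φ, P φ * conj (Q φ) ∂μ = 0 := by
  classical
  obtain ⟨s, hs⟩ := homPoly_exists_finset hP
  obtain ⟨t, ht⟩ := homPoly_exists_finset hQ
  obtain ⟨d, e, he, hspan⟩ := exists_formOrthonormal_span hΔ.hermitian hΔ.posDef (s ∪ t)
  obtain ⟨p, hp, hp'⟩ := hs d e fun x hx => hspan x (Finset.mem_union_left _ hx)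
  obtain ⟨q, hq, hq'⟩ := ht d e fun x hx => hspan x (Finset.mem_union_right _ hx)
  simp_rw [hp', hq']
  rw [hμ.integral_eval_mul hev he]
  refine Finset.sum_eq_zero fun α _ => ?_
  by_cases hα : α.degree = n
  · rw [hq.coeff_eq_zero (by omega)]; simp
  · rw [hp.coeff_eq_zero hα]; simp

/-- The hypercontractive comparison of two functions of the number operator on polynomials. -/
lemma IsComplexGaussian.eLpNorm_sum_le (hμ : IsComplexGaussian Δ μ) (hΔ : IsCovariance Δ)
    (hev : ∀ x : E, Measurable fun φ : StrongDual ℂ E => φ x)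
    {P : ℕ → StrongDual ℂ E → ℂ} (hP : ∀ n, P n ∈ homPoly E n) (N : ℕ) {k : ℕ} (hk : 1 ≤ k)
    {f g : ℕ → ℝ} (hfg : ∀ n, (k : ℝ) ^ n * f n ^ 2 ≤ g n ^ 2) :
    eLpNorm (fun φ => ∑ n ∈ Finset.range N, (f n : ℂ) * P n φ) ((2 * k : ℕ) : ℝ≥0∞) μ ≤
      eLpNorm (fun φ => ∑ n ∈ Finset.range N, (g n : ℂ) * P n φ) 2 μ := by
  obtain ⟨d, e, p, he, hp, hp'⟩ := homPoly_exists_coordinates hΔ hP N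
  have hrep : ∀ h : ℕ → ℝ, (fun φ => ∑ n ∈ Finset.range N, (h n : ℂ) * P n φ) =
      fun φ : StrongDual ℂ E => (∑ n ∈ Finset.range N, MvPolynomial.C (h n : ℂ) * p n).eval
        fun i => φ (e i) := fun h => by
    funext φ
    simp only [map_sum, map_mul, MvPolynomial.eval_C]
    exact Finset.sum_congr rfl fun n hn => by rw [hp' n (Finset.mem_range.mp hn)]
  rw [hrep f, hrep g]
  refine (hμ.eLpNorm_eval_le hev he _ hk).trans ?_
  rw [eLpNorm_two_eq, hμ.lintegral_eval hev he]
  exact ENNReal.rpow_le_rpow (ENNReal.ofReal_le_ofReal (fockNormSq_sum_le hp hfg N)) (by norm_num)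

end Polynomials

/-! ### Limits in `L^r` and pairings in `L²`. -/

section Limits

variable {Ω : Type*} [MeasurableSpace Ω] {ν : Measure Ω}

/-- Completeness of `L^r`. The Cauchy condition has the form `a k + a l` because in the applications
`a k` is the distance to a limit in another norm, or a tail of a series. -/
lemma exists_eLpNorm_limit {r : ℝ≥0∞} (hr : 1 ≤ r) {u : ℕ → Ω → ℂ} (hu : ∀ k, MemLp (u k) r ν)
    {a : ℕ → ℝ≥0∞} (ha : Tendsto a atTop (𝓝 0))
    (hua : ∀ k l, eLpNorm (u k - u l) r ν ≤ a k + a l) :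
    ∃ F : Ω →ₘ[ν] ℂ, Tendsto (fun k => eLpNorm (fun x => F x - u k x) r ν) atTop (𝓝 0) := by
  have : Fact (1 ≤ r) := ⟨hr⟩
  have hc : CauchySeq fun k => (hu k).toLp (u k) := by
    rw [EMetric.cauchySeq_iff]
    intro ε hε
    obtain ⟨N, hN⟩ := (ENNReal.tendsto_atTop_zero.mp ha) (ε / 3) (ENNReal.div_pos hε.ne' (by simp))
    refine ⟨N, fun k hk l hl => ?_⟩
    rcases eq_or_ne ε ∞ with rfl | hε'
    · exact edist_lt_top _ _
    rw [Lp.edist_toLp_toLp]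
    refine ((hua k l).trans (add_le_add (hN k hk) (hN l hl))).trans_lt ?_
    calc ε / 3 + ε / 3 < ε / 3 + ε / 3 + ε / 3 :=
          ENNReal.lt_add_right (by simp [ENNReal.div_eq_top, hε'])
            (ENNReal.div_pos hε.ne' (by simp)).ne'
      _ = ε := ENNReal.add_thirds ε
  obtain ⟨L, hL⟩ := cauchySeq_tendsto_of_complete hc
  refine ⟨L.val, ?_⟩
  have h := (Lp.tendsto_Lp_iff_tendsto_eLpNorm' _ _).mp hL
  refine h.congr fun k => ?_
  rw [eLpNorm_sub_comm]
  refine eLpNorm_congr_ae ?_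
  filter_upwards [(hu k).coeFn_toLp] with x hx
  simp [hx]

/-- Both limits are limits in measure, hence agree. This identifies limits taken in different
exponents. -/
lemma eq_of_eLpNorm_limits {r s : ℝ≥0∞} (hr : r ≠ 0) (hs : s ≠ 0) {u : ℕ → Ω → ℂ}
    (hu : ∀ k, AEStronglyMeasurable (u k) ν) {F G : Ω →ₘ[ν] ℂ}
    (hF : Tendsto (fun k => eLpNorm (fun x => F x - u k x) r ν) atTop (𝓝 0))
    (hG : Tendsto (fun k => eLpNorm (fun x => G x - u k x) s ν) atTop (𝓝 0)) : F = G := by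
  have h : ∀ {t : ℝ≥0∞}, t ≠ 0 → ∀ {K : Ω →ₘ[ν] ℂ},
      Tendsto (fun k => eLpNorm (fun x => K x - u k x) t ν) atTop (𝓝 0) →
      TendstoInMeasure ν u atTop K := fun ht K hK => by
    refine tendstoInMeasure_of_tendsto_eLpNorm ht hu K.aestronglyMeasurable (hK.congr fun k => ?_)
    exact eLpNorm_sub_comm _ _ _ _
  exact AEEqFun.ext (tendstoInMeasure_ae_unique (h hr hF) (h hs hG))

lemma memLp_of_eLpNorm_limit {r : ℝ≥0∞} {u : ℕ → Ω → ℂ} (hu : ∀ k, MemLp (u k) r ν)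
    {F : Ω →ₘ[ν] ℂ} (hF : Tendsto (fun k => eLpNorm (fun x => F x - u k x) r ν) atTop (𝓝 0)) :
    MemLp F r ν := by
  obtain ⟨k, hk⟩ := ((tendsto_order.mp hF).2 1 one_pos).exists
  have h : MemLp ((F : Ω → ℂ) - u k) r ν :=
    ⟨F.aestronglyMeasurable.sub (hu k).aestronglyMeasurable, hk.trans ENNReal.one_lt_top⟩
  simpa using h.add (hu k)

lemma integral_mul_conj_eq_inner {F G : Ω → ℂ} (hF : MemLp F 2 ν) (hG : MemLp G 2 ν) :
    ∫ x, F x * conj (G x) ∂ν = inner ℂ (hG.toLp G) (hF.toLp F) := by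
  rw [L2.inner_def]
  refine integral_congr_ae ?_
  filter_upwards [hF.coeFn_toLp, hG.coeFn_toLp] with x hx hy
  rw [hx, hy, RCLike.inner_apply]

lemma norm_integral_mul_conj_le {F G : Ω → ℂ} (hF : MemLp F 2 ν) (hG : MemLp G 2 ν) :
    ‖∫ x, F x * conj (G x) ∂ν‖ ≤ (eLpNorm F 2 ν).toReal * (eLpNorm G 2 ν).toReal := by
  rw [integral_mul_conj_eq_inner hF hG, mul_comm, ← Lp.norm_toLp F hF, ← Lp.norm_toLp G hG]
  exact norm_inner_le_norm _ _

lemma tendsto_integral_mul_conj {u : ℕ → Ω → ℂ} (hu : ∀ k, MemLp (u k) 2 ν)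
    {F : Ω →ₘ[ν] ℂ} (hF : Tendsto (fun k => eLpNorm (fun x => F x - u k x) 2 ν) atTop (𝓝 0))
    {G : Ω → ℂ} (hG : MemLp G 2 ν) :
    Tendsto (fun k => ∫ x, u k x * conj (G x) ∂ν) atTop (𝓝 (∫ x, F x * conj (G x) ∂ν)) := by
  have hF2 := memLp_of_eLpNorm_limit hu hF
  simp_rw [fun k => integral_mul_conj_eq_inner (hu k) hG]
  rw [integral_mul_conj_eq_inner hF2 hG]
  refine Tendsto.inner tendsto_const_nhds ?_
  rw [Lp.tendsto_Lp_iff_tendsto_eLpNorm'']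
  exact hF.congr fun k => eLpNorm_sub_comm _ _ _ _

end Limits

/-! ### Functions of the number operator and the norm inequality. -/

section Graph

variable {E : Type*} [AddCommGroup E] [Module ℂ E] [TopologicalSpace E]
  [MeasurableSpace (StrongDual ℂ E)] {Δ : E →ₗ⋆[ℂ] E →ₗ[ℂ] ℂ} {μ : Measure (StrongDual ℂ E)}

lemma IsComplexGaussian.memLp_sum (hμ : IsComplexGaussian Δ μ) (hΔ : IsCovariance Δ)
    (hev : ∀ x : E, Measurable fun φ : StrongDual ℂ E => φ x)
    {P : ℕ → StrongDual ℂ E → ℂ} (hP : ∀ n, P n ∈ homPoly E n) (f : ℕ → ℝ) (N r : ℕ) :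
    MemLp (fun φ => ∑ n ∈ Finset.range N, (f n : ℂ) * P n φ) r μ :=
  memLp_finsetSum _ fun n _ => (hμ.memLp_homPoly hΔ hev (hP n) r).const_mul _

/-- Padding the shorter sum with zeros makes the difference a single polynomial, so
hypercontractivity transfers the Cauchy property from `g(N)` in `L²` to `f(N)` in `L^r`. -/
lemma IsComplexGaussian.eLpNorm_sub_le (hμ : IsComplexGaussian Δ μ) (hΔ : IsCovariance Δ)
    (hev : ∀ x : E, Measurable fun φ : StrongDual ℂ E => φ x)
    {P Q : ℕ → StrongDual ℂ E → ℂ} (hP : ∀ n, P n ∈ homPoly E n) (hQ : ∀ n, Q n ∈ homPoly E n)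
    (a b : ℕ) {k r : ℕ} (hk : 1 ≤ k) (hr : r ≤ 2 * k) {f g : ℕ → ℝ}
    (hfg : ∀ n, (k : ℝ) ^ n * f n ^ 2 ≤ g n ^ 2) :
    eLpNorm ((fun φ => ∑ n ∈ Finset.range a, (f n : ℂ) * P n φ) -
        fun φ => ∑ n ∈ Finset.range b, (f n : ℂ) * Q n φ) r μ ≤
      eLpNorm ((fun φ => ∑ n ∈ Finset.range a, (g n : ℂ) * P n φ) -
        fun φ => ∑ n ∈ Finset.range b, (g n : ℂ) * Q n φ) 2 μ := by
  have := hμ.isProbabilityMeasure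
  set R : ℕ → StrongDual ℂ E → ℂ := fun n =>
    (if n < a then P n else 0) - (if n < b then Q n else 0) with hR
  have hRmem : ∀ n, R n ∈ homPoly E n := fun n =>
    Submodule.sub_mem _ (by split_ifs; exacts [hP n, Submodule.zero_mem _])
      (by split_ifs; exacts [hQ n, Submodule.zero_mem _])
  have hext : ∀ (h : ℕ → ℝ) (S : ℕ → StrongDual ℂ E → ℂ) (c : ℕ), c ≤ max a b → ∀ φ,
      ∑ n ∈ Finset.range c, (h n : ℂ) * S n φ =
        ∑ n ∈ Finset.range (max a b), (h n : ℂ) * (if n < c then S n else 0) φ :=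
    fun h S c hc φ => by
      rw [← Finset.sum_subset (Finset.range_mono hc)]
      · exact Finset.sum_congr rfl fun n hn => by rw [if_pos (Finset.mem_range.mp hn)]
      · intro n _ hn
        rw [if_neg (by simpa using hn)]
        simp
  have hrep : ∀ h : ℕ → ℝ, ((fun φ => ∑ n ∈ Finset.range a, (h n : ℂ) * P n φ) -
      fun φ => ∑ n ∈ Finset.range b, (h n : ℂ) * Q n φ) =
      fun φ => ∑ n ∈ Finset.range (max a b), (h n : ℂ) * R n φ := fun h => by
    funext φ
    simp only [Pi.sub_apply]
    rw [hext h P a (le_max_left _ _), hext h Q b (le_max_right _ _), ← Finset.sum_sub_distrib]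
    refine Finset.sum_congr rfl fun n _ => ?_
    simp only [hR, Pi.sub_apply]
    ring
  rw [hrep f, hrep g]
  refine (eLpNorm_le_eLpNorm_of_exponent_le (by exact_mod_cast hr) ?_).trans
    (hμ.eLpNorm_sum_le hΔ hev hRmem _ hk hfg)
  exact (hμ.memLp_sum hΔ hev hRmem f _ 1).aestronglyMeasurable

/-- If `h(N) Pₖ` converges in `L²`, and `f(N)` is hypercontractively dominated by `h(N)`, then
`f(N) Pₖ` converges in `L^r`. -/
lemma IsComplexGaussian.exists_limit_of_dominated (hμ : IsComplexGaussian Δ μ)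
    (hΔ : IsCovariance Δ) (hev : ∀ x : E, Measurable fun φ : StrongDual ℂ E => φ x)
    {d : ℕ → ℕ} {P : ℕ → ℕ → StrongDual ℂ E → ℂ} (hP : ∀ k n, P k n ∈ homPoly E n)
    {h : ℕ → ℝ} {Φ : StrongDual ℂ E →ₘ[μ] ℂ}
    (hΦ : Tendsto (fun k => eLpNorm
      (fun φ => Φ φ - ∑ n ∈ Finset.range (d k), (h n : ℂ) * P k n φ) 2 μ) atTop (𝓝 0))
    {k r : ℕ} (hk : 1 ≤ k) (hr1 : 1 ≤ r) (hr : r ≤ 2 * k) {f : ℕ → ℝ}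
    (hfh : ∀ n, (k : ℝ) ^ n * f n ^ 2 ≤ h n ^ 2) :
    ∃ F : StrongDual ℂ E →ₘ[μ] ℂ, Tendsto (fun k => eLpNorm
      (fun φ => F φ - ∑ n ∈ Finset.range (d k), (f n : ℂ) * P k n φ) r μ) atTop (𝓝 0) := by
  refine exists_eLpNorm_limit (by exact_mod_cast hr1)
    (fun i => hμ.memLp_sum hΔ hev (hP i) f (d i) r) hΦ fun i l => ?_
  refine (hμ.eLpNorm_sub_le hΔ hev (hP i) (hP l) (d i) (d l) hk hr hfh).trans ?_
  have hm : ∀ i, AEStronglyMeasurable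
      (fun φ => Φ φ - ∑ n ∈ Finset.range (d i), (h n : ℂ) * P i n φ) μ := fun i =>
    Φ.aestronglyMeasurable.sub (hμ.memLp_sum hΔ hev (hP i) h (d i) 1).aestronglyMeasurable
  have heq : ((fun φ => ∑ n ∈ Finset.range (d i), (h n : ℂ) * P i n φ) -
      fun φ => ∑ n ∈ Finset.range (d l), (h n : ℂ) * P l n φ) =
      (fun φ => Φ φ - ∑ n ∈ Finset.range (d l), (h n : ℂ) * P l n φ) -
        fun φ => Φ φ - ∑ n ∈ Finset.range (d i), (h n : ℂ) * P i n φ := by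
    funext φ
    simp
  rw [heq, add_comm]
  exact _root_.MeasureTheory.eLpNorm_sub_le (hm l) (hm i) (by norm_num)

/-- On the component of degree `n`, `f(N)` is multiplication by `f n`. -/
lemma NumberOpGraph.integral_mul_conj (hμ : IsComplexGaussian Δ μ) (hΔ : IsCovariance Δ)
    (hev : ∀ x : E, Measurable fun φ : StrongDual ℂ E => φ x) {f : ℕ → ℝ}
    {Ψ Φ : StrongDual ℂ E →ₘ[μ] ℂ} (h : NumberOpGraph μ 2 f Ψ Φ) {n : ℕ}
    {G : StrongDual ℂ E → ℂ} (hG : G ∈ homPoly E n) :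
    ∫ φ, Φ φ * conj (G φ) ∂μ = f n * ∫ φ, Ψ φ * conj (G φ) ∂μ := by
  obtain ⟨d, P, hP, hΨ, hΦ⟩ := h
  have hG2 : MemLp G 2 μ := by exact_mod_cast hμ.memLp_homPoly hΔ hev hG 2
  have hP2 : ∀ k n, MemLp (P k n) 2 μ := fun k n => by
    exact_mod_cast hμ.memLp_homPoly hΔ hev (hP k n) 2
  have hsum : ∀ (g : ℕ → ℝ) k, MemLp (fun φ => ∑ n ∈ Finset.range (d k), (g n : ℂ) * P k n φ) 2 μ :=
    fun g k => by exact_mod_cast hμ.memLp_sum hΔ hev (hP k) g (d k) 2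
  have hval : ∀ (g : ℕ → ℝ) k,
      ∫ φ, (∑ n ∈ Finset.range (d k), (g n : ℂ) * P k n φ) * conj (G φ) ∂μ =
        g n * ∫ φ, (if n < d k then P k n φ else 0) * conj (G φ) ∂μ := fun g k => by
    have hint : ∀ i, Integrable (fun φ => (g i : ℂ) * (P k i φ * conj (G φ))) μ := fun i =>
      ((hP2 k i).integrable_mul hG2.star).const_mul _
    simp only [Finset.sum_mul, mul_assoc]
    rw [integral_finsetSum _ fun i _ => hint i]
    simp_rw [integral_const_mul]
    split_ifs with hn
    · rw [Finset.sum_eq_single_of_mem n (Finset.mem_range.mpr hn)]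
      intro i _ hi
      rw [hμ.integral_homPoly_mul_conj hΔ hev hi (hP k i) hG, mul_zero]
    · simp only [zero_mul, integral_zero, mul_zero]
      refine Finset.sum_eq_zero fun i hi => ?_
      have := Finset.mem_range.mp hi
      rw [hμ.integral_homPoly_mul_conj hΔ hev (by omega) (hP k i) hG, mul_zero]
  have h1 := tendsto_integral_mul_conj (hsum f) hΦ hG2
  have h2 := tendsto_integral_mul_conj (u := fun k φ => ∑ n ∈ Finset.range (d k),
    ((1 : ℝ) : ℂ) * P k n φ) (hsum fun _ => 1) (by simpa using hΨ) hG2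
  simp_rw [hval f] at h1
  simp_rw [hval fun _ => 1] at h2
  refine tendsto_nhds_unique h1 ?_
  simpa using h2.const_mul (f n : ℂ)

lemma NumberOpGraph.memLp_right (hμ : IsComplexGaussian Δ μ) (hΔ : IsCovariance Δ)
    (hev : ∀ x : E, Measurable fun φ : StrongDual ℂ E => φ x) {f : ℕ → ℝ}
    {Ψ Φ : StrongDual ℂ E →ₘ[μ] ℂ} (h : NumberOpGraph μ 2 f Ψ Φ) : MemLp Φ 2 μ := by
  obtain ⟨d, P, hP, hΨ, hΦ⟩ := h
  exact memLp_of_eLpNorm_limit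
    (fun k => by exact_mod_cast hμ.memLp_sum hΔ hev (hP k) f (d k) 2) hΦ

/-- The witness is `⌈p/2⌉`, which is at most `p - 1 ≤ 2^λ` for `p ≥ 2`. For `p = 1` it is `1`, and
`λ ≥ 0` is what bounds it. -/
lemma exists_even_exponent {p : ℕ} {lam : ℝ} (hp : 1 ≤ p) (hlam : 0 ≤ lam)
    (h : (2 : ℝ) ^ (-lam) * ((p : ℝ) - 1) ≤ 1) :
    ∃ k : ℕ, 1 ≤ k ∧ p ≤ 2 * k ∧ (k : ℝ) ≤ 2 ^ lam := by
  refine ⟨(p + 1) / 2, by omega, by omega, ?_⟩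
  rcases hp.eq_or_lt with rfl | hp2
  · simpa using Real.one_le_rpow one_le_two hlam
  · have h1 : (((p + 1) / 2 : ℕ) : ℝ) ≤ ((p - 1 : ℕ) : ℝ) := by exact_mod_cast (by omega)
    rw [Nat.cast_sub hp, Nat.cast_one] at h1
    refine h1.trans ?_
    rw [Real.rpow_neg zero_le_two] at h
    have h2 : (0 : ℝ) < 2 ^ lam := by positivity
    rwa [inv_mul_le_iff₀ h2, mul_one] at h

lemma rpow_half_sq {x : ℝ} (hx : 0 ≤ x) (a : ℝ) : (x ^ (a / 2)) ^ 2 = x ^ a := by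
  rw [← Real.rpow_mul_natCast hx]
  congr 1
  push_cast
  ring

/-- After squaring this reads `k^n (1+n)^m ≤ 2^{λn} 2^{mn}`, and `1 + n ≤ 2^n`. -/
lemma pow_mul_number_weight_le {k : ℕ} {lam : ℝ} (hk : (k : ℝ) ≤ 2 ^ lam) (m n : ℕ) :
    (k : ℝ) ^ n * ((1 + n : ℝ) ^ ((m : ℝ) / 2)) ^ 2 ≤
      ((2 : ℝ) ^ ((lam + m) * n / 2)) ^ 2 := by
  rw [rpow_half_sq (by positivity), rpow_half_sq (by positivity), Real.rpow_natCast, add_mul,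
    Real.rpow_add two_pos, Real.rpow_mul_natCast zero_le_two, Real.rpow_mul_natCast zero_le_two,
    Real.rpow_natCast, ← pow_mul, mul_comm m n, pow_mul]
  have h : (1 + n : ℝ) ≤ 2 ^ n := by
    have := Nat.lt_two_pow_self (n := n)
    exact_mod_cast (by omega : 1 + n ≤ 2 ^ n)
  gcongr

/-- The number operator estimate for elements of `𝒢`. -/
theorem exists_number_estimate (hμ : IsComplexGaussian Δ μ) (hΔ : IsCovariance Δ)
    (hev : ∀ x : E, Measurable fun φ : StrongDual ℂ E => φ x)
    {Ψ : StrongDual ℂ E →ₘ[μ] ℂ} (hΨ : Ψ ∈ spaceG μ) {p : ℕ} (m : ℕ) {lam : ℝ} (hp : 1 ≤ p)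
    (hlam : 0 ≤ lam) (hpl : (2 : ℝ) ^ (-lam) * ((p : ℝ) - 1) ≤ 1) :
    ∃ Φ Φ' : StrongDual ℂ E →ₘ[μ] ℂ,
      NumberOpGraph μ p (fun n => (1 + n : ℝ) ^ ((m : ℝ) / 2)) Ψ Φ ∧
      NumberOpGraph μ 2 (fun n => (2 : ℝ) ^ ((lam + m) * n / 2)) Ψ Φ' ∧
      eLpNorm Φ p μ ≤ eLpNorm Φ' 2 μ := by
  have := hμ.isProbabilityMeasure
  obtain ⟨k, hk1, hpk, hk⟩ := exists_even_exponent hp hlam hpl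
  -- Membership in `𝒢` is tested on integers only, so `λ + m` is rounded up; the approximating
  -- polynomials for this `q` serve all operators below.
  obtain ⟨q, hq⟩ := exists_nat_ge (lam + m)
  obtain ⟨Φ₀, d, P, hP, hPΨ, hPΦ₀⟩ := hΨ q
  set f : ℕ → ℝ := fun n => (1 + n : ℝ) ^ ((m : ℝ) / 2) with hf
  set g : ℕ → ℝ := fun n => (2 : ℝ) ^ ((lam + m) * n / 2) with hg
  set h : ℕ → ℝ := fun n => (2 : ℝ) ^ ((q : ℝ) * n / 2) with hh
  have hfg : ∀ n, (k : ℝ) ^ n * f n ^ 2 ≤ g n ^ 2 := fun n => pow_mul_number_weight_le hk m n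
  have hgh : ∀ n, g n ^ 2 ≤ h n ^ 2 := fun n => by
    refine pow_le_pow_left₀ (by positivity) ?_ 2
    exact Real.rpow_le_rpow_of_exponent_le one_le_two (by gcongr)
  have h1f : ∀ n, (1 : ℝ) ≤ f n ^ 2 := fun n =>
    one_le_pow₀ (Real.one_le_rpow (by simp) (by positivity))
  obtain ⟨Φ, hΦ⟩ := hμ.exists_limit_of_dominated hΔ hev hP hPΦ₀ hk1 hp hpk
    (f := f) fun n => (hfg n).trans (hgh n)
  obtain ⟨Φ', hΦ'⟩ := hμ.exists_limit_of_dominated hΔ hev hP hPΦ₀ le_rfl one_le_two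
    (by norm_num) (f := g) fun n => by simpa using hgh n
  -- The graph in `L^p` also asks that the polynomials themselves converge in `L^p`, where `p` may
  -- exceed `2`; this is the case of the multiplier `1`, and the limit is then identified with `Ψ`.
  obtain ⟨Ψ', hΨ'⟩ := hμ.exists_limit_of_dominated hΔ hev hP hPΦ₀ hk1 hp hpk
    (f := fun _ => 1) fun n =>
      (mul_le_mul_of_nonneg_left (by simpa using h1f n) (by positivity)).trans
        ((hfg n).trans (hgh n))
  have hmeas : ∀ (a : ℕ → ℝ) i, AEStronglyMeasurable
      (fun φ => ∑ n ∈ Finset.range (d i), (a n : ℂ) * P i n φ) μ := fun a i =>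
    (hμ.memLp_sum hΔ hev (hP i) a (d i) 1).aestronglyMeasurable
  have hΨeq : Ψ = Ψ' := by
    refine eq_of_eLpNorm_limits (r := 2) (s := p) (by norm_num) (by exact_mod_cast (by omega))
      (hmeas fun _ => 1) ?_ hΨ'
    simpa using hPΨ
  subst hΨeq
  refine ⟨Φ, Φ', ⟨d, P, hP, by simpa using hΨ', hΦ⟩, ⟨d, P, hP, hPΨ, by exact_mod_cast hΦ'⟩, ?_⟩
  -- Hypercontractivity for the `i`-th polynomial, with approximation errors on both sides that tend
  -- to `0`.
  have hle : ∀ i, eLpNorm Φ p μ ≤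
      eLpNorm (fun φ => Φ φ - ∑ n ∈ Finset.range (d i), (f n : ℂ) * P i n φ) p μ +
      (eLpNorm (fun φ => Φ' φ - ∑ n ∈ Finset.range (d i), (g n : ℂ) * P i n φ) 2 μ +
        eLpNorm Φ' 2 μ) := fun i => by
    have h1 := eLpNorm_add_le (μ := μ) (p := p) (Φ.aestronglyMeasurable.sub (hmeas f i)) (hmeas f i)
      (by exact_mod_cast hp)
    rw [sub_add_cancel] at h1
    refine h1.trans (add_le_add le_rfl ?_)
    have h2 := hμ.eLpNorm_sum_le hΔ hev (hP i) (d i) hk1 hfg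
    refine (eLpNorm_le_eLpNorm_of_exponent_le (by exact_mod_cast hpk) (hmeas f i)).trans
      (h2.trans ?_)
    have h3 := _root_.MeasureTheory.eLpNorm_sub_le (μ := μ) (p := 2) Φ'.aestronglyMeasurable
      (Φ'.aestronglyMeasurable.sub (hmeas g i)) (by norm_num)
    rw [sub_sub_cancel, add_comm] at h3
    exact h3
  have hlim := hΦ.add (Tendsto.add (show Tendsto (fun i => eLpNorm
    (fun φ => Φ' φ - ∑ n ∈ Finset.range (d i), (g n : ℂ) * P i n φ) 2 μ) atTop (𝓝 0) by
      exact_mod_cast hΦ') (tendsto_const_nhds (x := eLpNorm Φ' 2 μ)))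
  rw [zero_add, zero_add] at hlim
  exact ge_of_tendsto' hlim hle

end Graph

/-! ### Powers of power sums in many variables. -/

section FlatPolynomial

variable {ι : Type*} [Fintype ι]

lemma fockNormSq_C_mul (r : ℝ) (c : ℂ) (p : MvPolynomial ι ℂ) :
    fockNormSq r (MvPolynomial.C c * p) = ‖c‖ ^ 2 * fockNormSq r p := by
  classical
  rw [fockNormSq_eq_sum r Finset.subset_union_left,
    fockNormSq_eq_sum r (Finset.subset_union_right (s₁ := (MvPolynomial.C c * p).support)),
    Finset.mul_sum]
  refine Finset.sum_congr rfl fun α _ => ?_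
  rw [MvPolynomial.coeff_C_mul, norm_mul]
  ring

lemma fockNormSq_sum_monomial {κ : Type*} (r : ℝ) (T : Finset κ) {a : κ → ι →₀ ℕ}
    (ha : Set.InjOn a T) (c : κ → ℂ) :
    fockNormSq r (∑ γ ∈ T, MvPolynomial.monomial (a γ) (c γ)) =
      ∑ γ ∈ T, multiWeight r (a γ) * ‖c γ‖ ^ 2 := by
  classical
  have hsupp : (∑ γ ∈ T, MvPolynomial.monomial (a γ) (c γ)).support ⊆ T.image a := by
    intro α hα
    by_contra h
    refine MvPolynomial.mem_support_iff.mp hα ?_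
    rw [MvPolynomial.coeff_sum]
    refine Finset.sum_eq_zero fun γ hγ => ?_
    rw [MvPolynomial.coeff_monomial, if_neg]
    rintro rfl
    exact h (Finset.mem_image_of_mem a hγ)
  rw [fockNormSq_eq_sum r hsupp, Finset.sum_image ha]
  refine Finset.sum_congr rfl fun γ hγ => ?_
  rw [MvPolynomial.coeff_sum, Finset.sum_eq_single_of_mem γ hγ]
  · rw [MvPolynomial.coeff_monomial, if_pos rfl]
  · intro γ' hγ' hne
    rw [MvPolynomial.coeff_monomial, if_neg]
    exact fun h => hne (ha hγ' hγ h)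

lemma fockNormSq_powerSum {n : ℕ} (hn : 1 ≤ n) (M : ℕ) :
    fockNormSq 1 (∑ i : Fin M, (MvPolynomial.X i : MvPolynomial (Fin M) ℂ) ^ n) =
      M * n.factorial := by
  simp_rw [MvPolynomial.X_pow_eq_monomial]
  rw [fockNormSq_sum_monomial]
  · have h : ∀ i : Fin M, multiWeight 1 (Finsupp.single i n) = n.factorial := fun i => by
      unfold multiWeight
      rw [Finset.prod_eq_single i]
      · simp
      · intro k _ hk
        simp [hk.symm]
      · simp
    simp [h]
  · intro i _ k _ h
    exact (Finsupp.single_left_inj (by omega)).mp h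

/-- In the multinomial expansion the monomials `z^{nγ}` are distinct and the coefficients are at
most `k!`. After division by `(M n!)^k` the squared norms factor over the variables. When `M` is
large, exponents `γ i ≥ 2` cost no more than exponent `1`, and the sum over `γ` is at most `(1 +
k/M)^M ≤ e^k`. -/
lemma fockNormSq_powerSum_pow_le {n k M : ℕ} (hn : 1 ≤ n) (hM : (n * k).factorial ≤ M) :
    fockNormSq 1 ((∑ i : Fin M, (MvPolynomial.X i : MvPolynomial (Fin M) ℂ) ^ n) ^ k) ≤
      (k.factorial : ℝ) ^ 2 * Real.exp k * (M * n.factorial) ^ k := by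
  classical
  have hM0 : 0 < M := (Nat.factorial_pos _).trans_le hM
  have hMR : (0 : ℝ) < M := by exact_mod_cast hM0
  have hnf : (0 : ℝ) < n.factorial := by positivity
  set a : (Fin M → ℕ) → (Fin M →₀ ℕ) := fun γ =>
    Finsupp.equivFunOnFinite.symm fun i => n * γ i with ha
  have hexp : (∑ i : Fin M, (MvPolynomial.X i : MvPolynomial (Fin M) ℂ) ^ n) ^ k =
      ∑ γ ∈ Finset.univ.piAntidiag k,
        MvPolynomial.monomial (a γ) ((Nat.multinomial Finset.univ γ : ℕ) : ℂ) := by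
    rw [Finset.sum_pow_eq_sum_piAntidiag]
    refine Finset.sum_congr rfl fun γ _ => ?_
    rw [MvPolynomial.monomial_eq, Finsupp.prod_fintype _ _ (by simp)]
    simp [ha, ← pow_mul]
  have hinj : Function.Injective a := fun γ γ' h => by
    funext i
    have := DFunLike.congr_fun h i
    simp only [ha, Finsupp.equivFunOnFinite_symm_apply_apply] at this
    exact Nat.eq_of_mul_eq_mul_left (by omega) this
  set w : ℕ → ℝ := fun j => ((n * j).factorial : ℝ) / (M * n.factorial) ^ j with hw
  have hw0 : ∀ j, 0 ≤ w j := fun j => by positivity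
  rw [hexp, fockNormSq_sum_monomial 1 _ hinj.injOn]
  have hterm : ∀ γ ∈ Finset.univ.piAntidiag (ι := Fin M) k,
      multiWeight 1 (a γ) * ‖((Nat.multinomial Finset.univ γ : ℕ) : ℂ)‖ ^ 2 ≤
        (k.factorial : ℝ) ^ 2 * (M * n.factorial) ^ k * ∏ i, w (γ i) := fun γ hγ => by
    have hγ' : ∑ i, γ i = k := (Finset.mem_piAntidiag.mp hγ).1
    have h1 : multiWeight 1 (a γ) = (M * n.factorial) ^ k * ∏ i, w (γ i) := by
      simp only [hw, Finset.prod_div_distrib, Finset.prod_pow_eq_pow_sum, hγ']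
      rw [mul_div_cancel₀ _ (by positivity)]
      simp [multiWeight, ha]
    have h2 : ((Nat.multinomial Finset.univ γ : ℕ) : ℝ) ≤ k.factorial := by
      rw [Nat.multinomial, hγ']
      exact_mod_cast Nat.div_le_self _ _
    rw [h1, Complex.norm_natCast]
    have h3 : 0 ≤ (M * n.factorial : ℝ) ^ k * ∏ i, w (γ i) :=
      mul_nonneg (by positivity) (Finset.prod_nonneg fun i _ => hw0 _)
    calc _ ≤ ((M * n.factorial : ℝ) ^ k * ∏ i, w (γ i)) * (k.factorial : ℝ) ^ 2 :=
          mul_le_mul_of_nonneg_left (pow_le_pow_left₀ (by positivity) h2 2) h3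
      _ = _ := by ring
  refine (Finset.sum_le_sum hterm).trans ?_
  rw [← Finset.mul_sum]
  -- Equality holds for `j = 1`. For `j ≥ 2` the numerator `(nj)!` is at most `M`, while the
  -- denominator is at least `M^j ≥ M²`.
  have hwle : ∀ j ∈ Finset.Icc 1 k, w j ≤ 1 / M := fun j hj => by
    obtain ⟨hj1, hjk⟩ := Finset.mem_Icc.mp hj
    simp only [hw]
    rw [div_le_div_iff₀ (by positivity) hMR, one_mul]
    rcases hj1.eq_or_lt with rfl | hj2
    · simp [mul_comm]
    · have h1 : ((n * j).factorial : ℝ) ≤ M := by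
        exact_mod_cast (Nat.factorial_le (Nat.mul_le_mul_left n hjk)).trans hM
      have h2 : (1 : ℝ) ≤ n.factorial := by exact_mod_cast Nat.factorial_pos n
      have h3 : (1 : ℝ) ≤ M := by exact_mod_cast hM0
      calc ((n * j).factorial : ℝ) * M ≤ M * M := by gcongr
        _ = M ^ 2 := by ring
        _ ≤ (M : ℝ) ^ j := pow_le_pow_right₀ h3 hj2
        _ ≤ (M * n.factorial : ℝ) ^ j :=
          pow_le_pow_left₀ hMR.le (le_mul_of_one_le_right hMR.le h2) j
  have hwsum : ∑ j ∈ Finset.range (k + 1), w j ≤ k / M + 1 := by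
    rw [Finset.sum_range_succ', ]
    have h0 : w 0 = 1 := by simp [hw]
    rw [h0]
    gcongr
    calc ∑ j ∈ Finset.range k, w (j + 1) ≤ ∑ j ∈ Finset.range k, (1 / M : ℝ) :=
          Finset.sum_le_sum fun j hj => hwle _
            (Finset.mem_Icc.mpr ⟨by omega, by have := Finset.mem_range.mp hj; omega⟩)
      _ = k / M := by simp [div_eq_mul_inv]
  -- Dropping the constraint `∑ γ i = k` and keeping only `γ i ≤ k` turns the sum into a full
  -- product.
  have hsum : ∑ γ ∈ Finset.univ.piAntidiag (ι := Fin M) k, ∏ i, w (γ i) ≤ Real.exp k := by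
    calc ∑ γ ∈ Finset.univ.piAntidiag (ι := Fin M) k, ∏ i, w (γ i)
        ≤ ∑ γ ∈ Fintype.piFinset fun _ : Fin M => Finset.range (k + 1), ∏ i, w (γ i) := by
          refine Finset.sum_le_sum_of_subset_of_nonneg ?_
            fun γ _ _ => Finset.prod_nonneg fun i _ => hw0 _
          intro γ hγ
          have hγ' : ∑ i, γ i = k := (Finset.mem_piAntidiag.mp hγ).1
          refine Fintype.mem_piFinset.mpr fun i => Finset.mem_range.mpr ?_
          have := Finset.single_le_sum (f := γ) (fun i _ => Nat.zero_le _) (Finset.mem_univ i)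
          omega
      _ = (∑ j ∈ Finset.range (k + 1), w j) ^ M := by
          rw [← Finset.prod_univ_sum]
          simp
      _ ≤ (k / M + 1) ^ M :=
          pow_le_pow_left₀ (Finset.sum_nonneg fun j _ => hw0 j) hwsum M
      _ ≤ Real.exp (k / M) ^ M := by
          gcongr
          exact Real.add_one_le_exp _
      _ = Real.exp k := by
          rw [← Real.exp_nat_mul]
          congr 1
          field_simp
  calc _ ≤ (k.factorial : ℝ) ^ 2 * (M * n.factorial) ^ k * Real.exp k := by gcongr
    _ = _ := by ring

end FlatPolynomial

/-! ### Homogeneous polynomials with slowly growing norms. -/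

section FlatFunction

variable {E : Type*} [AddCommGroup E] [Module ℂ E] [TopologicalSpace E]

lemma eval_pow_mem_homPoly (x : E) (n : ℕ) :
    (fun φ : StrongDual ℂ E => φ x ^ n) ∈ homPoly E n :=
  Submodule.subset_span ⟨fun _ => x, by simp⟩

variable [MeasurableSpace (StrongDual ℂ E)] {Δ : E →ₗ⋆[ℂ] E →ₗ[ℂ] ℂ}
  {μ : Measure (StrongDual ℂ E)}

/-- In infinitely many variables there are homogeneous polynomials of degree `n` that are
normalized in `L²` and whose `L^{2n}` norm grows only linearly in `n`. -/
lemma IsComplexGaussian.exists_flat_homPoly (hμ : IsComplexGaussian Δ μ)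
    (hev : ∀ x : E, Measurable fun φ : StrongDual ℂ E => φ x) {g : ℕ → E}
    (hg : FormOrthonormal Δ g) {n : ℕ} (hn : 1 ≤ n) :
    ∃ G ∈ homPoly E n, ∫ φ, G φ * conj (G φ) ∂μ = 1 ∧ eLpNorm G 2 μ = 1 ∧
      eLpNorm G ((2 * n : ℕ) : ℝ≥0∞) μ ≤ ENNReal.ofReal (n * Real.exp 1) := by
  -- The number of variables required by the bound on the `n`-th power; `c` normalizes the power
  -- sum, whose squared norm is `M n!`.
  set M : ℕ := (n * n).factorial with hM
  have hM0 : (0 : ℝ) < M := by exact_mod_cast Nat.factorial_pos _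
  have hnf : (0 : ℝ) < n.factorial := by positivity
  set c : ℝ := (Real.sqrt (M * n.factorial))⁻¹ with hc
  have hc2 : c ^ 2 = (M * n.factorial : ℝ)⁻¹ := by
    rw [hc, inv_pow, Real.sq_sqrt (by positivity)]
  set S : MvPolynomial (Fin M) ℂ := ∑ i : Fin M, MvPolynomial.X i ^ n with hS
  set p : MvPolynomial (Fin M) ℂ := MvPolynomial.C (c : ℂ) * S with hp
  set e : Fin M → E := fun i => g i with he
  have heON : FormOrthonormal Δ e := fun i k => by
    rw [he, hg]
    simp only [Fin.ext_iff]
  have hcn : ‖(c : ℂ)‖ ^ 2 = (M * n.factorial : ℝ)⁻¹ := by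
    rw [Complex.norm_real, Real.norm_eq_abs, sq_abs, hc2]
  have hp1 : fockNormSq 1 p = 1 := by
    rw [hp, fockNormSq_C_mul, hS, fockNormSq_powerSum hn, hcn]
    field_simp
  have hpn : fockNormSq 1 (p ^ n) ≤ (n * Real.exp 1) ^ (2 * n) := by
    rw [hp, mul_pow, ← map_pow, fockNormSq_C_mul, norm_pow, ← pow_mul, mul_comm n 2, pow_mul, hcn]
    calc _ ≤ ((M * n.factorial : ℝ)⁻¹) ^ n *
          ((n.factorial : ℝ) ^ 2 * Real.exp n * (M * n.factorial) ^ n) :=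
          mul_le_mul_of_nonneg_left (fockNormSq_powerSum_pow_le hn hM.ge) (by positivity)
      _ = (n.factorial : ℝ) ^ 2 * Real.exp n := by
          rw [inv_pow]
          field_simp
      -- The extra factor `e^n` is wasted on purpose, to obtain a perfect `2n`-th power.
      _ ≤ ((n : ℝ) ^ n) ^ 2 * Real.exp n ^ 2 := by
          have h1 : (n.factorial : ℝ) ≤ (n : ℝ) ^ n := by exact_mod_cast Nat.factorial_le_pow n
          have h2 : 1 ≤ Real.exp n := Real.one_le_exp (by positivity)
          gcongr
          exact le_self_pow₀ h2 (by norm_num)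
      _ = _ := by
          rw [mul_pow, ← Real.exp_nat_mul 1, ← Real.exp_nat_mul, ← pow_mul]
          push_cast
          ring_nf
  set G : StrongDual ℂ E → ℂ := fun φ => p.eval fun i => φ (e i) with hG
  have hGmem : G ∈ homPoly E n := by
    have : G = (c : ℂ) • ∑ i : Fin M, fun φ : StrongDual ℂ E => φ (e i) ^ n := by
      funext φ
      simp [hG, hp, hS]
    rw [this]
    exact Submodule.smul_mem _ _ (Submodule.sum_mem _ fun i _ => eval_pow_mem_homPoly _ _)
  refine ⟨G, hGmem, ?_, ?_, ?_⟩
  · rw [hG, hμ.integral_eval_mul hev heON]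
    have : ∀ α, (multiWeight 1 α : ℂ) * (p.coeff α * conj (p.coeff α)) =
        ((multiWeight 1 α * ‖p.coeff α‖ ^ 2 : ℝ) : ℂ) := fun α => by
      rw [Complex.mul_conj, Complex.normSq_eq_norm_sq]
      push_cast
      ring
    simp_rw [this]
    rw [← Complex.ofReal_sum]
    exact_mod_cast hp1
  · rw [eLpNorm_two_eq, hG, hμ.lintegral_eval hev heON, hp1]
    simp
  · rw [eLpNorm_two_mul_eq _ _ hn, hG]
    simp_rw [← map_pow]
    rw [hμ.lintegral_eval hev heON]
    refine (ENNReal.rpow_le_rpow (ENNReal.ofReal_le_ofReal hpn) (by positivity)).trans ?_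
    rw [ENNReal.ofReal_rpow_of_nonneg (by positivity) (by positivity), ← Real.rpow_natCast,
      ← Real.rpow_mul (by positivity)]
    have hn0 : (n : ℝ) ≠ 0 := by positivity
    have : ((2 * n : ℕ) : ℝ) * (1 / (2 * n : ℝ)) = 1 := by
      push_cast
      field_simp
    rw [this, Real.rpow_one]

end FlatFunction

lemma exists_eLpNorm_series {Ω : Type*} [MeasurableSpace Ω] {ν : Measure Ω} {r : ℝ≥0∞}
    (hr : 1 ≤ r) {u : ℕ → Ω → ℂ} (hu : ∀ n, MemLp (u n) r ν)
    (hsum : ∑' n, eLpNorm (u n) r ν ≠ ∞) :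
    ∃ F : Ω →ₘ[ν] ℂ, Tendsto (fun k => eLpNorm
      (fun x => F x - ∑ n ∈ Finset.range k, u n x) r ν) atTop (𝓝 0) := by
  refine exists_eLpNorm_limit hr (u := fun k x => ∑ n ∈ Finset.range k, u n x)
    (fun k => memLp_finsetSum _ fun n _ => hu n) (ENNReal.tendsto_sum_nat_add _ hsum)
    fun k l => ?_
  have key : ∀ a b, a ≤ b → eLpNorm ((fun x => ∑ n ∈ Finset.range b, u n x) -
      fun x => ∑ n ∈ Finset.range a, u n x) r ν ≤ ∑' n, eLpNorm (u (n + a)) r ν := fun a b hab => by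
    obtain ⟨c, rfl⟩ := Nat.exists_eq_add_of_le hab
    have heq : ((fun x => ∑ n ∈ Finset.range (a + c), u n x) -
        fun x => ∑ n ∈ Finset.range a, u n x) = ∑ n ∈ Finset.range c, u (n + a) := by
      funext x
      simp [Finset.sum_range_add, add_comm _ a]
    rw [heq]
    refine (eLpNorm_sum_le (fun n _ => (hu _).aestronglyMeasurable) hr).trans ?_
    exact ENNReal.sum_le_tsum _
  rcases le_total k l with h | h
  · rw [eLpNorm_sub_comm]
    exact (key k l h).trans le_self_add
  · exact (key l k h).trans le_add_self

/-! ### Strictness of the second inclusion. -/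

section Strict

variable {E : Type*} [AddCommGroup E] [Module ℂ E] [TopologicalSpace E]
  [MeasurableSpace (StrongDual ℂ E)] {Δ : E →ₗ⋆[ℂ] E →ₗ[ℂ] ℂ} {μ : Measure (StrongDual ℂ E)}

lemma summable_number_weight (m : ℕ) :
    Summable fun n : ℕ => (1 + n : ℝ) ^ m * ((1 / 2 : ℝ) ^ n * (n * Real.exp 1)) := by
  have h := summable_pow_mul_geometric_of_norm_lt_one (R := ℝ) (m + 1) (r := 1 / 2) (by norm_num)
  have h2 := ((summable_nat_add_iff 1).mpr h).mul_left (2 * Real.exp 1)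
  refine Summable.of_nonneg_of_le (fun n => by positivity) (fun n => ?_) h2
  have hn : (n : ℝ) ≤ 1 + n := by linarith
  calc (1 + n : ℝ) ^ m * ((1 / 2 : ℝ) ^ n * (n * Real.exp 1))
      ≤ (1 + n : ℝ) ^ m * ((1 / 2 : ℝ) ^ n * ((1 + n) * Real.exp 1)) := by gcongr
    _ = _ := by push_cast; ring

/-- In infinite dimensions, `𝒢` is strictly smaller than the intersection of the Gross–Sobolev
spaces. -/
theorem exists_mem_grossSobolev_notMem_spaceG (hμ : IsComplexGaussian Δ μ) (hΔ : IsCovariance Δ)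
    (hev : ∀ x : E, Measurable fun φ : StrongDual ℂ E => φ x) (hdim : ¬ FiniteDimensional ℂ E) :
    ∃ Ψ : StrongDual ℂ E →ₘ[μ] ℂ, (∀ p m : ℕ, 1 ≤ p → Ψ ∈ grossSobolev μ p m) ∧
      Ψ ∉ spaceG μ := by
  have := hμ.isProbabilityMeasure
  obtain ⟨g, hg⟩ := exists_formOrthonormal_nat hΔ.hermitian hΔ.posDef hdim
  have hex : ∀ n : ℕ, ∃ G ∈ homPoly E n,
      (1 ≤ n → ∫ φ, G φ * conj (G φ) ∂μ = 1 ∧ eLpNorm G 2 μ = 1) ∧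
      eLpNorm G ((2 * n : ℕ) : ℝ≥0∞) μ ≤ ENNReal.ofReal (n * Real.exp 1) := fun n => by
    rcases Nat.eq_zero_or_pos n with rfl | hn
    · exact ⟨0, Submodule.zero_mem _, fun h => absurd h (by omega), by simp⟩
    · obtain ⟨G, hG, h1, h2, h3⟩ := hμ.exists_flat_homPoly hev hg hn
      exact ⟨G, hG, fun _ => ⟨h1, h2⟩, h3⟩
  choose G hG hG1 hGn using hex
  -- The coefficients `2^{-n}` beat every polynomial weight but lose against `4^n`.
  set P : ℕ → StrongDual ℂ E → ℂ := fun n => ((1 / 2 : ℂ) ^ n) • G n with hP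
  have hPmem : ∀ n, P n ∈ homPoly E n := fun n => Submodule.smul_mem _ _ (hG n)
  have hlim : ∀ p m : ℕ, 1 ≤ p → ∃ F : StrongDual ℂ E →ₘ[μ] ℂ, Tendsto (fun k => eLpNorm
      (fun φ => F φ - ∑ n ∈ Finset.range k, (((1 + n : ℝ) ^ ((m : ℝ) / 2) : ℝ) : ℂ) * P n φ) p μ)
      atTop (𝓝 0) := fun p m hp => by
    have hmem : ∀ n : ℕ, MemLp (fun φ => (((1 + n : ℝ) ^ ((m : ℝ) / 2) : ℝ) : ℂ) * P n φ) p μ :=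
      fun n => (hμ.memLp_homPoly hΔ hev (hPmem n) p).const_mul _
    refine exists_eLpNorm_series (by exact_mod_cast hp) hmem ?_
    -- The bound in `L^{2n}` controls the `L^p` norm once `p ≤ 2n`; the finitely many earlier terms
    -- only need to be finite.
    have hbound : ∀ n : ℕ, p ≤ n →
        eLpNorm (fun φ => (((1 + n : ℝ) ^ ((m : ℝ) / 2) : ℝ) : ℂ) * P n φ) p μ ≤
          ENNReal.ofReal ((1 + n : ℝ) ^ m * ((1 / 2 : ℝ) ^ n * (n * Real.exp 1))) := fun n hn => by
      have heq : (fun φ => (((1 + n : ℝ) ^ ((m : ℝ) / 2) : ℝ) : ℂ) * P n φ) =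
          ((((1 + n : ℝ) ^ ((m : ℝ) / 2) : ℝ) : ℂ) * (1 / 2 : ℂ) ^ n) • G n := by
        funext φ
        simp [hP, mul_assoc]
      have hw : (1 + n : ℝ) ^ ((m : ℝ) / 2) ≤ (1 + n : ℝ) ^ m := by
        rw [← Real.rpow_natCast]
        refine Real.rpow_le_rpow_of_exponent_le (by simp) ?_
        have : (0 : ℝ) ≤ m := by positivity
        linarith
      rw [heq, eLpNorm_const_smul, ← mul_assoc, ENNReal.ofReal_mul (by positivity)]
      refine mul_le_mul' ?_ ?_
      · rw [← ofReal_norm, norm_mul, norm_pow, Complex.norm_real, Real.norm_of_nonneg (by positivity)]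
        refine ENNReal.ofReal_le_ofReal ?_
        have : ‖(1 / 2 : ℂ)‖ = 1 / 2 := by simp
        rw [this]
        gcongr
      · refine (eLpNorm_le_eLpNorm_of_exponent_le ?_
          (hμ.memLp_homPoly hΔ hev (hG n) 1).aestronglyMeasurable).trans (hGn n)
        exact_mod_cast (by omega)
    have hs : Summable fun n : ℕ =>
        (eLpNorm (fun φ => (((1 + n : ℝ) ^ ((m : ℝ) / 2) : ℝ) : ℂ) * P n φ) p μ).toReal := by
      refine Summable.of_norm_bounded_eventually_nat (summable_number_weight m) ?_
      filter_upwards [eventually_ge_atTop p] with n hn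
      rw [Real.norm_of_nonneg ENNReal.toReal_nonneg]
      exact ENNReal.toReal_le_of_le_ofReal (by positivity) (hbound n hn)
    have heq : ∀ n : ℕ, eLpNorm (fun φ => (((1 + n : ℝ) ^ ((m : ℝ) / 2) : ℝ) : ℂ) * P n φ) p μ =
        ENNReal.ofReal
          (eLpNorm (fun φ => (((1 + n : ℝ) ^ ((m : ℝ) / 2) : ℝ) : ℂ) * P n φ) p μ).toReal :=
      fun n => (ENNReal.ofReal_toReal (hmem n).eLpNorm_ne_top).symm
    rw [tsum_congr heq]
    exact hs.tsum_ofReal_ne_top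
  have hlim1 : ∀ p : ℕ, 1 ≤ p → ∃ F : StrongDual ℂ E →ₘ[μ] ℂ, Tendsto (fun k => eLpNorm
      (fun φ => F φ - ∑ n ∈ Finset.range k, P n φ) p μ) atTop (𝓝 0) := fun p hp => by
    simpa using hlim p 0 hp
  obtain ⟨Ψ, hΨ⟩ := hlim1 2 one_le_two
  have hΨ2 : Tendsto (fun k => eLpNorm (fun φ => Ψ φ - ∑ n ∈ Finset.range k, P n φ) 2 μ)
      atTop (𝓝 0) := by exact_mod_cast hΨ
  have hP2 : ∀ n, MemLp (P n) 2 μ := fun n => by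
    exact_mod_cast hμ.memLp_homPoly hΔ hev (hPmem n) 2
  have hG2 : ∀ n, MemLp (G n) 2 μ := fun n => by
    exact_mod_cast hμ.memLp_homPoly hΔ hev (hG n) 2
  refine ⟨Ψ, fun p m hp => ?_, fun hmem => ?_⟩
  · obtain ⟨Φ, hΦ⟩ := hlim p m hp
    obtain ⟨Ψ', hΨ'⟩ := hlim1 p hp
    have : Ψ = Ψ' := eq_of_eLpNorm_limits (r := 2) (s := p) (by norm_num)
      (by exact_mod_cast (by omega))
      (fun k => (memLp_finsetSum _ fun n _ => hP2 n).aestronglyMeasurable) hΨ2 hΨ'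
    subst this
    exact ⟨Φ, fun k => k, fun _ => P, fun _ => hPmem, hΨ', hΦ⟩
  -- For `q = 4` the multiplier is `4^n`, so pairing with the unit vector `G n` gives `4^n 2^{-n} =
  -- 2^n`, unbounded in contradiction to `Φ ∈ L²`.
  · obtain ⟨Φ, hΦ⟩ := hmem 4
    have hval : ∀ n, 1 ≤ n → ∫ φ, Ψ φ * conj (G n φ) ∂μ = (1 / 2 : ℂ) ^ n := fun n hn => by
      refine tendsto_nhds_unique (tendsto_integral_mul_conj
        (fun k => memLp_finsetSum (Finset.range k) fun i _ => hP2 i) hΨ2 (hG2 n)) ?_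
      refine tendsto_const_nhds.congr' ?_
      filter_upwards [eventually_gt_atTop n] with k hk
      simp only [Finset.sum_mul]
      have hint : ∀ i, Integrable (fun φ => P i φ * conj (G n φ)) μ := fun i =>
        (hP2 i).integrable_mul (hG2 n).star
      rw [integral_finsetSum _ fun i _ => hint i,
        Finset.sum_eq_single_of_mem n (Finset.mem_range.mpr hk)]
      · simp only [hP, Pi.smul_apply, smul_eq_mul, mul_assoc]
        rw [integral_const_mul, (hG1 n hn).1, mul_one]
      · intro i _ hi
        exact hμ.integral_homPoly_mul_conj hΔ hev hi (hPmem i) (hG n)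
    have hΦ2 : MemLp Φ 2 μ := hΦ.memLp_right hμ hΔ hev
    have hle : ∀ n : ℕ, 1 ≤ n → (2 : ℝ) ^ n ≤ (eLpNorm Φ 2 μ).toReal := fun n hn => by
      have h1 := norm_integral_mul_conj_le hΦ2 (hG2 n)
      rw [hΦ.integral_mul_conj hμ hΔ hev (hG n), hval n hn, (hG1 n hn).2] at h1
      have h2 : (2 : ℝ) ^ (((4 : ℕ) : ℝ) * n / 2) = 4 ^ n := by
        have : ((4 : ℕ) : ℝ) * n / 2 = ((2 * n : ℕ) : ℝ) := by push_cast; ring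
        rw [this, Real.rpow_natCast, pow_mul]
        norm_num
      rw [h2, norm_mul, norm_pow, Complex.norm_real] at h1
      have h3 : ‖(1 / 2 : ℂ)‖ = 1 / 2 := by simp
      rw [h3, Real.norm_of_nonneg (by positivity), ← mul_pow] at h1
      norm_num at h1
      exact h1
    obtain ⟨n, hn⟩ := pow_unbounded_of_one_lt (eLpNorm Φ 2 μ).toReal (one_lt_two (α := ℝ))
    have h4 := hle (n + 1) (by omega)
    have h5 : (2 : ℝ) ^ n ≤ 2 ^ (n + 1) := pow_le_pow_right₀ one_le_two (by omega)
    linarith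

end Strict

/-! ### Orthonormal expansions in Hilbert spaces. -/

section Hilbert

variable {K : Type*} [NormedAddCommGroup K] [InnerProductSpace ℂ K]

lemma norm_sq_sum_orthonormal {κ : Type*} {e : κ → K} (he : Orthonormal ℂ e) (s : Finset κ)
    (c : κ → ℂ) : ‖∑ i ∈ s, c i • e i‖ ^ 2 = ∑ i ∈ s, ‖c i‖ ^ 2 := by
  have h := he.inner_sum c c s
  rw [inner_self_eq_norm_sq_to_K] at h
  have h2 : ∀ i, conj (c i) * c i = ((‖c i‖ ^ 2 : ℝ) : ℂ) := fun i => by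
    rw [mul_comm, Complex.mul_conj, Complex.normSq_eq_norm_sq]
  simp_rw [h2] at h
  rw [← Complex.ofReal_sum, ← RCLike.ofReal_pow] at h
  exact Complex.ofReal_injective h

/-- The Fourier expansion of a vector in the closed span of an orthonormal sequence. -/
lemma tendsto_fourier_of_mem_closure {e : ℕ → K} (he : Orthonormal ℂ e) {x : K}
    (hx : x ∈ closure (Submodule.span ℂ (Set.range e) : Set K)) :
    Tendsto (fun N => ∑ k ∈ Finset.range N, inner ℂ (e k) x • e k) atTop (𝓝 x) := by
  have hfix : ∀ y ∈ Submodule.span ℂ (Set.range e), ∃ N₀, ∀ N ≥ N₀,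
      ∑ k ∈ Finset.range N, inner ℂ (e k) y • e k = y := fun y hy => by
    induction hy using Submodule.span_induction with
    | mem y hy =>
      obtain ⟨m, rfl⟩ := hy
      refine ⟨m + 1, fun N hN => ?_⟩
      simp only [orthonormal_iff_ite.mp he, ite_smul, one_smul, zero_smul]
      rw [Finset.sum_ite_eq', if_pos (Finset.mem_range.mpr (by omega))]
    | zero => exact ⟨0, fun N _ => by simp⟩
    | add y z _ _ hy hz =>
      obtain ⟨N₁, h₁⟩ := hy
      obtain ⟨N₂, h₂⟩ := hz
      refine ⟨max N₁ N₂, fun N hN => ?_⟩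
      simp only [inner_add_right, add_smul, Finset.sum_add_distrib]
      rw [h₁ N (le_trans (le_max_left _ _) hN), h₂ N (le_trans (le_max_right _ _) hN)]
    | smul c y _ hy =>
      obtain ⟨N₁, h₁⟩ := hy
      refine ⟨N₁, fun N hN => ?_⟩
      simp only [inner_smul_right, mul_smul, ← Finset.smul_sum]
      rw [h₁ N hN]
  -- The partial sums are contractions that eventually fix each element of the span, so convergence
  -- extends to the closure.
  have hbound : ∀ (N : ℕ) (z : K), ‖∑ k ∈ Finset.range N, inner ℂ (e k) z • e k‖ ≤ ‖z‖ :=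
    fun N z => by
      refine le_of_sq_le_sq ?_ (norm_nonneg _)
      rw [norm_sq_sum_orthonormal he]
      exact he.sum_inner_products_le z
  rw [Metric.tendsto_atTop]
  intro ε hε
  obtain ⟨y, hy, hxy⟩ := Metric.mem_closure_iff.mp hx (ε / 2) (by positivity)
  obtain ⟨N₀, hN₀⟩ := hfix y hy
  refine ⟨N₀, fun N hN => ?_⟩
  have h1 : (∑ k ∈ Finset.range N, inner ℂ (e k) x • e k) - x =
      (∑ k ∈ Finset.range N, inner ℂ (e k) (x - y) • e k) - (x - y) := by
    simp only [inner_sub_right, sub_smul, Finset.sum_sub_distrib]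
    rw [hN₀ N hN]
    abel
  rw [dist_eq_norm, h1]
  rw [dist_eq_norm] at hxy
  calc _ ≤ _ := norm_sub_le _ _
    _ ≤ ‖x - y‖ + ‖x - y‖ := by gcongr; exact hbound N _
    _ < ε := by linarith

lemma IsHilbertSchmidt.summable {K' : Type*} [NormedAddCommGroup K'] [InnerProductSpace ℂ K']
    {S : K →L[ℂ] K'} (hS : IsHilbertSchmidt S) {e : ℕ → K} (he : Orthonormal ℂ e) :
    Summable fun k => ‖S (e k)‖ ^ 2 := by
  obtain ⟨C, hC⟩ := hS
  refine summable_of_sum_range_le (c := C) (fun k => by positivity) fun n => ?_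
  rw [Finset.sum_range]
  exact hC n (fun i => e i) (he.comp _ Fin.val_injective)

end Hilbert

/-! ### Nuclear Fréchet spaces and kernels. -/

section Nuclear

variable {E : Type*} [AddCommGroup E] [Module ℂ E] [TopologicalSpace E]
variable {H : ℕ → Type*} [∀ p, NormedAddCommGroup (H p)] [∀ p, InnerProductSpace ℂ (H p)]
variable {j : ∀ p, E →L[ℂ] H p} {T : ∀ p, H (p + 1) →L[ℂ] H p}

lemma IsNuclearFrechet.isTopologicalAddGroup (hE : IsNuclearFrechet j T) :
    IsTopologicalAddGroup E := by
  rw [hE.topology]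
  exact topologicalAddGroup_iInf fun p => topologicalAddGroup_induced (j p)

lemma IsNuclearFrechet.continuousSMul (hE : IsNuclearFrechet j T) : ContinuousSMul ℂ E := by
  rw [hE.topology]
  exact continuousSMul_iInf fun p => continuousSMul_induced (j p)

lemma IsNuclearFrechet.secondCountableTopology (hE : IsNuclearFrechet j T)
    [∀ p, TopologicalSpace.SeparableSpace (H p)] : SecondCountableTopology E := by
  rw [hE.topology]
  have := fun p => UniformSpace.secondCountable_of_separable (H p)
  exact TopologicalSpace.secondCountableTopology_iInf fun p =>
    TopologicalSpace.secondCountableTopology_induced _ _ (j p)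

/-- Vanishing at level `p` moves up the chain by injectivity of the `T q` and down by compatibility;
uniqueness in the projective limit concludes. -/
lemma IsNuclearFrechet.injective_canonical (hE : IsNuclearFrechet j T) (p : ℕ) :
    Function.Injective (j p) := by
  rw [injective_iff_map_eq_zero]
  intro x hx
  have hup : ∀ q, j (p + q) x = 0 := fun q => by
    induction q with
    | zero => exact hx
    | succ q ih =>
      refine hE.injective (p + q) ?_
      rw [map_zero]
      exact (hE.comp (p + q) x).trans ih
  have hdown : ∀ q r, j (r + q) x = 0 → j r x = 0 := fun q => by
    induction q with
    | zero => exact fun r h => h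
    | succ q ih =>
      intro r h
      refine ih r ?_
      have h2 := hE.comp (r + q) x
      rw [← h2, show j (r + q + 1) x = 0 from h, map_zero]
  have hall : ∀ r, j r x = 0 := fun r => by
    refine hdown p r ?_
    rw [add_comm]
    exact hup r
  obtain ⟨e, -, huniq⟩ := hE.limit (fun p => 0) (fun p => map_zero _)
  rw [huniq x hall, huniq 0 fun p => map_zero _]

lemma IsNuclearFrechet.t2Space (hE : IsNuclearFrechet j T) : T2Space E :=
  T2Space.of_injective_continuous (hE.injective_canonical 0) (j 0).continuous

/-- The balls of the norms `‖j p ·‖` form a neighbourhood basis at the origin. -/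
lemma IsNuclearFrechet.exists_ball_subset (hE : IsNuclearFrechet j T) {U : Set E}
    (hU : U ∈ 𝓝 (0 : E)) : ∃ p, ∃ δ > 0, ∀ x, ‖j p x‖ < δ → x ∈ U := by
  have h0 : 𝓝 (0 : E) = ⨅ p, comap (j p) (𝓝 0) := by
    conv_lhs => rw [hE.topology, nhds_iInf]
    refine iInf_congr fun p => ?_
    rw [nhds_induced, map_zero]
  have hanti : Antitone fun p => comap (j p) (𝓝 (0 : H p)) := by
    refine antitone_nat_of_succ_le fun p => ?_
    have h1 : (j p : E → H p) = T p ∘ j (p + 1) := funext fun x => (hE.comp p x).symm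
    rw [h1, ← comap_comap]
    refine comap_mono ?_
    have := (T p).continuous.tendsto 0
    rw [map_zero] at this
    exact this.le_comap
  rw [h0, mem_iInf_of_directed hanti.directed_ge] at hU
  obtain ⟨p, hp⟩ := hU
  obtain ⟨V, hV, hVU⟩ := mem_comap.mp hp
  obtain ⟨δ, hδ, hball⟩ := Metric.mem_nhds_iff.mp hV
  exact ⟨p, δ, hδ, fun x hx => hVU (hball (by simpa using hx))⟩

lemma re_form_smul {E : Type*} [AddCommGroup E] [Module ℂ E] {Δ : E →ₗ⋆[ℂ] E →ₗ[ℂ] ℂ} (t : ℝ) (x : E) :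
    (Δ ((t : ℂ) • x) ((t : ℂ) • x)).re = t ^ 2 * (Δ x x).re := by
  simp only [map_smulₛₗ, LinearMap.smul_apply, smul_eq_mul, Complex.conj_ofReal, RingHom.id_apply]
  rw [← mul_assoc, ← Complex.ofReal_mul, Complex.re_ofReal_mul]
  ring

lemma IsCovariance.re_nonneg {Δ : E →ₗ⋆[ℂ] E →ₗ[ℂ] ℂ} (hΔ : IsCovariance Δ) (x : E) :
    0 ≤ (Δ x x).re := by
  rcases eq_or_ne x 0 with rfl | hx
  · simp
  · exact (hΔ.posDef x hx).le

/-- Continuity at `0` bounds the quadratic form by `1` on a ball of some `‖j p ·‖`, and homogeneity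
does the rest. -/
lemma IsCovariance.exists_bound {Δ : E →ₗ⋆[ℂ] E →ₗ[ℂ] ℂ} (hΔ : IsCovariance Δ)
    (hE : IsNuclearFrechet j T) :
    ∃ (p : ℕ) (C : ℝ), 0 ≤ C ∧ ∀ x, (Δ x x).re ≤ C * ‖j p x‖ ^ 2 := by
  have hc : Continuous fun x => (Δ x x).re := Complex.continuous_re.comp hΔ.continuous
  have hU : {x : E | (Δ x x).re < 1} ∈ 𝓝 (0 : E) :=
    (isOpen_lt hc continuous_const).mem_nhds (by simp)
  obtain ⟨p, δ, hδ, hball⟩ := hE.exists_ball_subset hU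
  refine ⟨p, (δ ^ 2)⁻¹, by positivity, fun x => ?_⟩
  by_contra! h
  have hpos : 0 < (Δ x x).re := lt_of_le_of_lt (by positivity) h
  set t : ℝ := (Real.sqrt (Δ x x).re)⁻¹ with ht
  have ht2 : t ^ 2 = ((Δ x x).re)⁻¹ := by rw [ht, inv_pow, Real.sq_sqrt hpos.le]
  have ht0 : 0 ≤ t := by positivity
  have h1 := hball ((t : ℂ) • x) (by
    refine lt_of_pow_lt_pow_left₀ 2 hδ.le ?_
    rw [map_smul, norm_smul, mul_pow, Complex.norm_real, Real.norm_of_nonneg ht0, ht2]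
    rw [inv_mul_lt_iff₀ (by positivity)] at h ⊢
    linarith)
  rw [Set.mem_ofPred_eq, re_form_smul, ht2, inv_mul_cancel₀ hpos.ne'] at h1
  exact lt_irrefl _ h1

/-- The map `rieszDual` as a conjugate-linear map. -/
def rieszDualₗ (j : ∀ p, E →L[ℂ] H p) (p : ℕ) : H p →ₗ⋆[ℂ] StrongDual ℂ E where
  toFun := rieszDual j p
  map_add' x y := by
    ext z
    simp [rieszDual]
  map_smul' c x := by
    ext z
    simp [rieszDual]

lemma rieszDual_apply (p : ℕ) (v : H p) (x : E) : rieszDual j p v x = inner ℂ v (j p x) := by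
  simp [rieszDual]

/-- Expand in an orthonormal basis of the span of the `v l` and apply Cauchy–Schwarz: the
coefficients form a pure tensor of norm `∏ ‖v l‖`, and the values of `ψ` on the basis are controlled
by the Hilbert–Schmidt norm. -/
lemma norm_kernel_sq_le {n p : ℕ}
    {ψ : MultilinearMap ℂ (fun _ : Fin n => StrongDual ℂ E) ℂ} (hψ : kernelNormSq j p ψ ≠ ∞)
    (v : Fin n → H p) :
    ‖ψ fun l => rieszDual j p (v l)‖ ^ 2 ≤ (kernelNormSq j p ψ).toReal * ∏ l, ‖v l‖ ^ 2 := by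
  set S : Submodule ℂ (H p) := Submodule.span ℂ (Set.range v) with hS
  have : FiniteDimensional ℂ S := FiniteDimensional.span_of_finite ℂ (Set.finite_range v)
  set b := stdOrthonormalBasis ℂ S with hb
  set e : Fin (Module.finrank ℂ S) → H p := fun i => b i with he
  have heON : Orthonormal ℂ e := b.orthonormal.comp_linearIsometry S.subtypeₗᵢ
  have hvl : ∀ l, ∃ c : Fin (Module.finrank ℂ S) → ℂ, ∑ i, c i • e i = v l := fun l => by
    have h := b.sum_repr ⟨v l, Submodule.subset_span (Set.mem_range_self l)⟩
    have h2 := congrArg Subtype.val h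
    simp only [AddSubmonoidClass.coe_finsetSum, SetLike.val_smul] at h2
    exact ⟨_, h2⟩
  choose c hc using hvl
  have hexp : (ψ fun l => rieszDual j p (v l)) =
      ∑ r : Fin n → Fin (Module.finrank ℂ S), (∏ l, conj (c l (r l))) *
        ψ fun l => rieszDual j p (e (r l)) := by
    have h1 : ∀ l, rieszDual j p (v l) = ∑ i, conj (c l i) • rieszDual j p (e i) := fun l => by
      have := map_sum (rieszDualₗ j p) (fun i => c l i • e i) Finset.univ
      rw [hc l] at this
      refine this.trans (Finset.sum_congr rfl fun i _ => ?_)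
      exact map_smulₛₗ _ _ _
    simp_rw [h1]
    rw [MultilinearMap.map_sum]
    refine Finset.sum_congr rfl fun r _ => ?_
    rw [MultilinearMap.map_smul_univ, smul_eq_mul]
  have hker : ∑ r : Fin n → Fin (Module.finrank ℂ S), ‖ψ fun l => rieszDual j p (e (r l))‖ ^ 2 ≤
      (kernelNormSq j p ψ).toReal := by
    have h1 : ∑ r : Fin n → Fin (Module.finrank ℂ S),
        ‖ψ fun l => rieszDual j p (e (r l))‖ₑ ^ 2 ≤ kernelNormSq j p ψ :=
      le_iSup_of_le _ (le_iSup_of_le e (le_iSup_of_le heON le_rfl))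
    have h2 := ENNReal.toReal_mono hψ h1
    rw [ENNReal.toReal_sum (fun r _ => by finiteness)] at h2
    simpa using h2
  have hprod : ∑ r : Fin n → Fin (Module.finrank ℂ S), ‖∏ l, conj (c l (r l))‖ ^ 2 =
      ∏ l, ‖v l‖ ^ 2 := by
    have h1 : ∀ l, ‖v l‖ ^ 2 = ∑ i, ‖c l i‖ ^ 2 := fun l => by
      rw [← hc l, norm_sq_sum_orthonormal heON]
    simp_rw [h1]
    rw [Finset.prod_univ_sum, Fintype.piFinset_univ]
    refine Finset.sum_congr rfl fun r _ => ?_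
    rw [norm_prod, ← Finset.prod_pow]
    simp
  calc ‖ψ fun l => rieszDual j p (v l)‖ ^ 2
      ≤ (∑ r : Fin n → Fin (Module.finrank ℂ S), ‖∏ l, conj (c l (r l))‖ *
          ‖ψ fun l => rieszDual j p (e (r l))‖) ^ 2 := by
        rw [hexp]
        refine pow_le_pow_left₀ (norm_nonneg _) ((norm_sum_le _ _).trans_eq ?_) 2
        exact Finset.sum_congr rfl fun r _ => norm_mul _ _
    _ ≤ _ := Finset.sum_mul_sq_le_sq_mul_sq _ _ _
    _ ≤ _ := by
        rw [hprod, mul_comm]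
        exact mul_le_mul_of_nonneg_right hker (Finset.prod_nonneg fun l _ => by positivity)

lemma norm_kernel_le {n p : ℕ}
    {ψ : MultilinearMap ℂ (fun _ : Fin n => StrongDual ℂ E) ℂ} (hψ : kernelNormSq j p ψ ≠ ∞)
    (v : Fin n → H p) :
    ‖ψ fun l => rieszDual j p (v l)‖ ≤ Real.sqrt (kernelNormSq j p ψ).toReal * ∏ l, ‖v l‖ := by
  refine le_of_sq_le_sq ?_ (mul_nonneg (by positivity) (Finset.prod_nonneg fun _ _ => by positivity))
  rw [mul_pow, Real.sq_sqrt ENNReal.toReal_nonneg, ← Finset.prod_pow]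
  exact norm_kernel_sq_le hψ v

lemma continuous_kernel_rieszDual {n p : ℕ}
    {ψ : MultilinearMap ℂ (fun _ : Fin n => StrongDual ℂ E) ℂ} (hψ : kernelNormSq j p ψ ≠ ∞) :
    Continuous fun v : H p => ψ fun _ => rieszDual j p v := by
  -- The Riesz map is conjugate-linear, so multilinearity of the composition is available over `ℝ`
  -- only; this is enough for continuity.
  let R : H p →ₗ[ℝ] StrongDual ℂ E :=
    { toFun := rieszDual j p
      map_add' := (rieszDualₗ j p).map_add
      map_smul' := fun c x => by
        ext z
        simp [rieszDual, inner_smul_left_eq_smul] }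
  let B : MultilinearMap ℝ (fun _ : Fin n => H p) ℂ :=
    (ψ.restrictScalars ℝ).compLinearMap fun _ => R
  have hB : Continuous B := MultilinearMap.continuous_of_bound B _ (norm_kernel_le hψ)
  exact hB.comp (continuous_pi fun _ => continuous_id)

/-- An orthonormal sequence of `H p` consisting of elements of `E`, whose closed span contains the
image of `E`. -/
lemma IsNuclearFrechet.exists_orthonormal (hE : IsNuclearFrechet j T)
    [∀ p, TopologicalSpace.SeparableSpace (H p)] (hdim : ¬ FiniteDimensional ℂ E) (p : ℕ) :
    ∃ ε : ℕ → E, Orthonormal ℂ (fun k => j p (ε k)) ∧ ∀ x : E,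
      j p x ∈ closure (Submodule.span ℂ (Set.range fun k => j p (ε k)) : Set (H p)) := by
  have := hE.isTopologicalAddGroup
  have := hE.continuousSMul
  have := hE.secondCountableTopology
  have := hE.t2Space
  set t : Set E := Set.range (TopologicalSpace.denseSeq E) with ht
  obtain ⟨b, hbt, hspan, hli⟩ := exists_linearIndependent ℂ t
  have hbc : b.Countable := (Set.countable_range _).mono hbt
  -- Otherwise the span of the dense sequence would be finite-dimensional, hence closed, hence all
  -- of `E`.
  have hbinf : Infinite b := by
    by_contra h
    rw [not_infinite_iff_finite] at h
    have : FiniteDimensional ℂ (Submodule.span ℂ b) :=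
      FiniteDimensional.span_of_finite ℂ (Set.toFinite b)
    have hcl := Submodule.closed_of_finiteDimensional (Submodule.span ℂ b)
    have hd : Dense (Submodule.span ℂ b : Set E) := by
      rw [hspan]
      exact (TopologicalSpace.denseRange_denseSeq E).mono Submodule.subset_span
    have htop : Submodule.span ℂ b = ⊤ := by
      rw [← SetLike.coe_set_eq, Submodule.top_coe, ← hcl.closure_eq, hd.closure_eq]
    rw [htop] at this
    exact hdim (Module.Finite.equiv (Submodule.topEquiv : (⊤ : Submodule ℂ E) ≃ₗ[ℂ] E))
  have : Countable b := hbc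
  obtain ⟨σ⟩ := nonempty_equiv_of_countable (α := ℕ) (β := b)
  set f : ℕ → H p := fun k => j p (σ k : E) with hf
  have hfli : LinearIndependent ℂ f := by
    have h1 : LinearIndependent ℂ fun k => (σ k : E) := hli.comp σ σ.injective
    exact h1.map' (j p : E →ₗ[ℂ] H p)
      (LinearMap.ker_eq_bot.mpr (hE.injective_canonical p))
  set g := InnerProductSpace.gramSchmidtNormed ℂ f with hg
  have hgspan : Submodule.span ℂ (Set.range g) = Submodule.span ℂ (Set.range f) := by
    rw [hg, InnerProductSpace.span_gramSchmidtNormed_range, InnerProductSpace.span_gramSchmidt]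
  have hfspan : Submodule.span ℂ (Set.range f) =
      (Submodule.span ℂ t).map (j p : E →ₗ[ℂ] H p) := by
    rw [← hspan, Submodule.map_span]
    congr 1
    ext y
    constructor
    · rintro ⟨k, rfl⟩
      exact ⟨σ k, (σ k).2, rfl⟩
    · rintro ⟨x, hx, rfl⟩
      exact ⟨σ.symm ⟨x, hx⟩, by simp [hf]⟩
  have hgE : ∀ k, ∃ x : E, j p x = g k := fun k => by
    have h1 : g k ∈ Submodule.span ℂ (Set.range g) := Submodule.subset_span ⟨k, rfl⟩
    rw [hgspan, hfspan] at h1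
    obtain ⟨x, -, hx⟩ := h1
    exact ⟨x, hx⟩
  choose ε hε using hgE
  refine ⟨ε, ?_, fun x => ?_⟩
  · simp_rw [hε]
    exact InnerProductSpace.gramSchmidtNormed_orthonormal hfli
  · simp_rw [hε]
    change j p x ∈ closure (Submodule.span ℂ (Set.range g) : Set (H p))
    rw [hgspan, hfspan]
    have hx : x ∈ closure (Submodule.span ℂ t : Set E) :=
      ((TopologicalSpace.denseRange_denseSeq E).mono Submodule.subset_span) x
    exact image_closure_subset_closure_image (j p).continuous ⟨x, hx, rfl⟩

end Nuclear

/-- Minkowski's inequality for a series, for functions with proportional moments. -/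
lemma lintegral_tsum_pow_le {Ω : Type*} [MeasurableSpace Ω] {ν : Measure Ω}
    {f : ℕ → Ω → ℝ≥0∞} (hf : ∀ k, Measurable (f k)) {n : ℕ} (hn : 1 ≤ n) {A : ℕ → ℝ≥0∞}
    {B : ℝ≥0∞} (hAB : ∀ k, ∫⁻ x, f k x ^ n ∂ν ≤ B * A k ^ n) :
    ∫⁻ x, (∑' k, f k x) ^ n ∂ν ≤ B * (∑' k, A k) ^ n := by
  have hn0 : (n : ℝ) ≠ 0 := by positivity
  have hn1 : (1 : ℝ) ≤ n := by exact_mod_cast hn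
  have hroot : ∀ a b : ℝ≥0∞, (a * b ^ n) ^ (1 / n : ℝ) = a ^ (1 / n : ℝ) * b := fun a b => by
    rw [ENNReal.mul_rpow_of_nonneg _ _ (by positivity), ← ENNReal.rpow_natCast_mul,
      mul_one_div_cancel hn0, ENNReal.rpow_one]
  have hfin : ∀ N, (∫⁻ x, (∑ k ∈ Finset.range N, f k x) ^ n ∂ν) ^ (1 / n : ℝ) ≤
      ∑ k ∈ Finset.range N, B ^ (1 / n : ℝ) * A k := fun N => by
    induction N with
    | zero => simp [show n ≠ 0 by omega, show 0 < n by omega]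
    | succ N ih =>
      simp_rw [Finset.sum_range_succ]
      have h := ENNReal.lintegral_Lp_add_le (μ := ν) (p := n)
        (f := fun x => ∑ k ∈ Finset.range N, f k x) (g := f N)
        (Finset.measurable_fun_sum _ fun k _ => hf k).aemeasurable (hf N).aemeasurable hn1
      simp only [Pi.add_apply, ENNReal.rpow_natCast] at h
      refine h.trans (add_le_add ih ?_)
      rw [← hroot]
      exact ENNReal.rpow_le_rpow (hAB N) (by positivity)
  have hle : ∀ N, ∫⁻ x, (∑ k ∈ Finset.range N, f k x) ^ n ∂ν ≤ B * (∑' k, A k) ^ n := fun N => by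
    have h1 := (hfin N).trans (ENNReal.sum_le_tsum _)
    rw [ENNReal.tsum_mul_left, ← hroot] at h1
    exact (ENNReal.rpow_le_rpow_iff (by positivity)).mp h1
  refine le_of_tendsto' (lintegral_tendsto_of_tendsto_of_monotone
    (fun N => ((Finset.measurable_fun_sum (Finset.range N) fun k _ => hf k).pow_const
      n).aemeasurable)
    (Eventually.of_forall fun x => fun a b hab => ?_) (Eventually.of_forall fun x => ?_)) hle
  · exact pow_le_pow_left₀ (by positivity)
      (Finset.sum_le_sum_of_subset (Finset.range_mono hab)) n
  · exact ENNReal.Tendsto.pow (ENNReal.tendsto_nat_tsum _)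

/-! ### Moments of a single evaluation. -/

section Moments

variable {E : Type*} [AddCommGroup E] [Module ℂ E] [TopologicalSpace E]
  [MeasurableSpace (StrongDual ℂ E)] {Δ : E →ₗ⋆[ℂ] E →ₗ[ℂ] ℂ} {μ : Measure (StrongDual ℂ E)}

lemma IsCovariance.eq_ofReal_re {E : Type*} [AddCommGroup E] [Module ℂ E] [TopologicalSpace E]
    {Δ : E →ₗ⋆[ℂ] E →ₗ[ℂ] ℂ} (hΔ : IsCovariance Δ) (x : E) : Δ x x = ((Δ x x).re : ℂ) :=
  (Complex.conj_eq_iff_re.mp (hΔ.hermitian x x).symm).symm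

/-- For `x ≠ 0`, normalization reduces to one standard variable `z` with `‖z^n‖² = n!`. The constant
`n!` is independent of `x`, as Minkowski's inequality for the series over `k` requires. -/
lemma IsComplexGaussian.lintegral_eval_pow (hμ : IsComplexGaussian Δ μ) (hΔ : IsCovariance Δ)
    (hev : ∀ x : E, Measurable fun φ : StrongDual ℂ E => φ x) (x : E) {n : ℕ} (hn : 1 ≤ n) :
    ∫⁻ φ : StrongDual ℂ E, (‖φ x‖ₑ ^ 2) ^ n ∂μ =
      ENNReal.ofReal (n.factorial) * ENNReal.ofReal (Δ x x).re ^ n := by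
  rcases eq_or_ne x 0 with rfl | hx
  · simp [show n ≠ 0 by omega]
  have hpos := hΔ.posDef x hx
  set a : ℝ := Real.sqrt (Δ x x).re with ha
  have ha0 : 0 < a := Real.sqrt_pos.mpr hpos
  have ha2 : a ^ 2 = (Δ x x).re := Real.sq_sqrt hpos.le
  set e : Unit → E := fun _ => ((a⁻¹ : ℝ) : ℂ) • x with he
  have heON : FormOrthonormal Δ e := fun i k => by
    have h1 := hΔ.eq_ofReal_re (e i)
    rw [he, re_form_smul, inv_pow, ha2, inv_mul_cancel₀ hpos.ne'] at h1
    rw [he, h1]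
    simp
  have h := hμ.lintegral_eval hev heON (MvPolynomial.monomial (Finsupp.single () n) 1)
  have hf : fockNormSq 1 (MvPolynomial.monomial (Finsupp.single () n) (1 : ℂ)) = n.factorial := by
    have := fockNormSq_sum_monomial (ι := Unit) 1 {()} (a := fun _ => Finsupp.single () n)
      (by simp) (fun _ => 1)
    simpa [multiWeight] using this
  rw [hf] at h
  rw [← h, ← ENNReal.ofReal_pow hpos.le, mul_comm, ← lintegral_const_mul']
  · refine lintegral_congr fun φ => ?_
    have hφ : φ x = (a : ℂ) * φ (e ()) := by
      simp only [he, map_smul, smul_eq_mul, ← mul_assoc]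
      rw [← Complex.ofReal_mul, mul_inv_cancel₀ ha0.ne']
      simp
    rw [hφ]
    simp only [MvPolynomial.eval_monomial, one_mul, Finsupp.prod_single_index, pow_zero]
    have hae : ‖(a : ℂ)‖ₑ = ENNReal.ofReal a := by
      rw [← ofReal_norm, Complex.norm_real, Real.norm_of_nonneg ha0.le]
    rw [enorm_mul, enorm_pow, ← ha2, hae, ENNReal.ofReal_pow (by positivity),
      ENNReal.ofReal_pow ha0.le]
    ring
  · exact ENNReal.ofReal_ne_top

lemma IsComplexGaussian.eLpNorm_eval_two (hμ : IsComplexGaussian Δ μ) (hΔ : IsCovariance Δ)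
    (hev : ∀ x : E, Measurable fun φ : StrongDual ℂ E => φ x) (x : E) :
    eLpNorm (fun φ : StrongDual ℂ E => φ x) 2 μ = ENNReal.ofReal (Δ x x).re ^ (1 / 2 : ℝ) := by
  have h := hμ.lintegral_eval_pow hΔ hev x le_rfl
  simp only [pow_one, Nat.factorial_one, Nat.cast_one, ENNReal.ofReal_one, one_mul] at h
  rw [eLpNorm_two_eq, h]

end Moments

/-! ### The Gaussian measure is carried by a Hilbert space dual. -/

section Support

variable {E : Type*} [AddCommGroup E] [Module ℂ E] [TopologicalSpace E]
variable {H : ℕ → Type*} [∀ p, NormedAddCommGroup (H p)] [∀ p, InnerProductSpace ℂ (H p)]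
variable {j : ∀ p, E →L[ℂ] H p}

/-- The partial sums of the expansion of the Riesz representative of `φ` in the orthonormal
sequence `j p (ε k)`. -/
def rieszPartial (j : ∀ p, E →L[ℂ] H p) (p : ℕ) (ε : ℕ → E) (N : ℕ) (φ : StrongDual ℂ E) : H p :=
  ∑ k ∈ Finset.range N, conj (φ (ε k)) • j p (ε k)

lemma inner_rieszPartial (p : ℕ) (ε : ℕ → E) (N : ℕ) (φ : StrongDual ℂ E) (x : E) :
    inner ℂ (rieszPartial j p ε N φ) (j p x) =
      φ (∑ k ∈ Finset.range N, inner ℂ (j p (ε k)) (j p x) • ε k) := by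
  rw [rieszPartial, sum_inner, map_sum]
  refine Finset.sum_congr rfl fun k _ => ?_
  rw [inner_smul_left, map_smul, smul_eq_mul, Complex.conj_conj, mul_comm]

lemma norm_sq_rieszPartial {p : ℕ} {ε : ℕ → E} (hε : Orthonormal ℂ fun k => j p (ε k)) (N : ℕ)
    (φ : StrongDual ℂ E) :
    ‖rieszPartial j p ε N φ‖ ^ 2 = ∑ k ∈ Finset.range N, ‖φ (ε k)‖ ^ 2 := by
  rw [rieszPartial, norm_sq_sum_orthonormal hε]
  simp

lemma tsum_enorm_sq_eq {p : ℕ} {ε : ℕ → E} (hε : Orthonormal ℂ fun k => j p (ε k))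
    {φ : StrongDual ℂ E} {v : H p}
    (hv : Tendsto (fun N => rieszPartial j p ε N φ) atTop (𝓝 v)) :
    ∑' k, ‖φ (ε k)‖ₑ ^ 2 = ENNReal.ofReal (‖v‖ ^ 2) := by
  have h1 := ENNReal.tendsto_nat_tsum fun k => ‖φ (ε k)‖ₑ ^ 2
  have h2 : Tendsto (fun N => ENNReal.ofReal (‖rieszPartial j p ε N φ‖ ^ 2)) atTop
      (𝓝 (ENNReal.ofReal (‖v‖ ^ 2))) :=
    (ENNReal.continuous_ofReal.tendsto _).comp (hv.norm.pow 2)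
  refine tendsto_nhds_unique h1 (h2.congr fun N => ?_)
  rw [norm_sq_rieszPartial hε, ENNReal.ofReal_sum_of_nonneg fun _ _ => by positivity]
  exact Finset.sum_congr rfl fun k _ => by rw [ENNReal.ofReal_pow (norm_nonneg _), ofReal_norm]

lemma norm_rieszPartial_le {p : ℕ} {ε : ℕ → E} (hε : Orthonormal ℂ fun k => j p (ε k))
    {φ : StrongDual ℂ E} {v : H p}
    (hv : Tendsto (fun N => rieszPartial j p ε N φ) atTop (𝓝 v)) (N : ℕ) :
    ‖rieszPartial j p ε N φ‖ ≤ ‖v‖ := by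
  refine le_of_sq_le_sq ?_ (norm_nonneg _)
  refine ge_of_tendsto (hv.norm.pow 2) ?_
  filter_upwards [eventually_ge_atTop N] with N' hN'
  rw [norm_sq_rieszPartial hε, norm_sq_rieszPartial hε]
  exact Finset.sum_le_sum_of_subset_of_nonneg (Finset.range_mono hN') fun _ _ _ => by positivity

lemma exists_tendsto_rieszPartial [∀ p, CompleteSpace (H p)] {p : ℕ} {ε : ℕ → E}
    (hε : Orthonormal ℂ fun k => j p (ε k)) {φ : StrongDual ℂ E}
    (hφ : ∑' k, ‖φ (ε k)‖ₑ ^ 2 ≠ ∞) :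
    ∃ v : H p, Tendsto (fun N => rieszPartial j p ε N φ) atTop (𝓝 v) := by
  have hs : Summable fun k => ‖conj (φ (ε k))‖ ^ 2 := by
    have := ENNReal.summable_toReal hφ
    simpa using this
  have h := (hε.orthogonalFamily.summable_iff_norm_sq_summable fun k => conj (φ (ε k))).mpr hs
  exact ⟨_, h.hasSum.tendsto_sum_nat⟩

variable {T : ∀ p, H (p + 1) →L[ℂ] H p} [∀ p, CompleteSpace (H p)]
  [∀ p, TopologicalSpace.SeparableSpace (H p)]
  [MeasurableSpace (StrongDual ℂ E)] {Δ : E →ₗ⋆[ℂ] E →ₗ[ℂ] ℂ} {μ : Measure (StrongDual ℂ E)}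

/-- The Gaussian measure is carried by the dual of `H p`, if `Δ` is bounded on `H p` and has finite
trace there. -/
lemma IsComplexGaussian.ae_exists_riesz (hμ : IsComplexGaussian Δ μ) (hΔ : IsCovariance Δ)
    (hE : IsNuclearFrechet j T) (hev : ∀ x : E, Measurable fun φ : StrongDual ℂ E => φ x)
    {p : ℕ} {ε : ℕ → E} (hε : Orthonormal ℂ fun k => j p (ε k))
    (hcl : ∀ x : E, j p x ∈ closure (Submodule.span ℂ (Set.range fun k => j p (ε k)) : Set (H p)))
    {C : ℝ} (hC : ∀ x, (Δ x x).re ≤ C * ‖j p x‖ ^ 2)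
    (hsum : Summable fun k => (Δ (ε k) (ε k)).re) :
    ∀ᵐ φ ∂μ, ∃ v : H p, Tendsto (fun N => rieszPartial j p ε N φ) atTop (𝓝 v) ∧
      φ = rieszDual j p v := by
  have := hμ.isProbabilityMeasure
  have := hE.secondCountableTopology
  have := hE.t2Space
  -- The expectation of this sum is the trace of `Δ`.
  have hfin : ∀ᵐ φ ∂μ, ∑' k, ‖φ (ε k)‖ₑ ^ 2 < ∞ := by
    refine ae_lt_top (Measurable.tsum fun k => (hev (ε k)).enorm.pow_const 2) ?_
    rw [lintegral_tsum fun k => ((hev (ε k)).enorm.pow_const 2).aemeasurable]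
    have h1 : ∀ k, ∫⁻ φ : StrongDual ℂ E, ‖φ (ε k)‖ₑ ^ 2 ∂μ =
        ENNReal.ofReal (Δ (ε k) (ε k)).re := fun k => by
      simpa using hμ.lintegral_eval_pow hΔ hev (ε k) le_rfl
    simp_rw [h1]
    exact hsum.tsum_ofReal_ne_top
  -- The Fourier sums `y N` of `x` converge in `H p` but need not converge in `E`, so continuity of
  -- `φ` cannot be used. The bound on `Δ` gives `φ (y N) → φ x` in `L²`, hence almost surely along a
  -- subsequence.
  have hexp : ∀ x : E, ∀ᵐ φ ∂μ, ∃ ns : ℕ → ℕ, StrictMono ns ∧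
      Tendsto (fun i => inner ℂ (rieszPartial j p ε (ns i) φ) (j p x)) atTop (𝓝 (φ x)) :=
    fun x => by
      set y : ℕ → E := fun N => ∑ k ∈ Finset.range N, inner ℂ (j p (ε k)) (j p x) • ε k with hy
      have hyx : Tendsto (fun N => ‖j p (y N - x)‖ ^ 2) atTop (𝓝 0) := by
        have h1 := tendsto_fourier_of_mem_closure hε (hcl x)
        have h2 : ∀ N, j p (y N - x) =
            (∑ k ∈ Finset.range N, inner ℂ (j p (ε k)) (j p x) • j p (ε k)) - j p x := fun N => by
          simp [hy]
        simp_rw [h2]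
        have h3 := ((h1.sub_const (j p x)).norm.pow 2)
        simpa using h3
      have hlp : Tendsto (fun N => eLpNorm ((fun φ : StrongDual ℂ E => φ (y N)) -
          fun φ => φ x) 2 μ) atTop (𝓝 0) := by
        have h1 : ∀ N, eLpNorm ((fun φ : StrongDual ℂ E => φ (y N)) - fun φ => φ x) 2 μ ≤
            ENNReal.ofReal (C * ‖j p (y N - x)‖ ^ 2) ^ (1 / 2 : ℝ) := fun N => by
          have h2 : ((fun φ : StrongDual ℂ E => φ (y N)) - fun φ => φ x) =
              fun φ : StrongDual ℂ E => φ (y N - x) := by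
            funext φ
            simp
          rw [h2, hμ.eLpNorm_eval_two hΔ hev]
          exact ENNReal.rpow_le_rpow (ENNReal.ofReal_le_ofReal (hC _)) (by norm_num)
        have h3 : Tendsto (fun N => ENNReal.ofReal (C * ‖j p (y N - x)‖ ^ 2) ^ (1 / 2 : ℝ)) atTop
            (𝓝 0) := by
          have h4 := (ENNReal.continuous_ofReal.tendsto _).comp (hyx.const_mul C)
          have h5 := ((ENNReal.continuous_rpow_const (y := 1 / 2)).tendsto _).comp h4
          simpa [Function.comp_def] using h5
        exact tendsto_of_tendsto_of_tendsto_of_le_of_le tendsto_const_nhds h3 (fun _ => zero_le)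
          h1
      obtain ⟨ns, hns, hae⟩ := (tendstoInMeasure_of_tendsto_eLpNorm (by norm_num)
        (fun N => (hev (y N)).aestronglyMeasurable) (hev x).aestronglyMeasurable
        hlp).exists_seq_tendsto_ae
      filter_upwards [hae] with φ hφ
      refine ⟨ns, hns, hφ.congr fun i => ?_⟩
      rw [inner_rieszPartial]
  -- The null set depends on `x`; a countable dense set suffices because both functionals are
  -- continuous on `E`.
  have hall := ae_all_iff.mpr fun m : ℕ => hexp (TopologicalSpace.denseSeq E m)
  filter_upwards [hfin, hall] with φ hφ hφd
  obtain ⟨v, hv⟩ := exists_tendsto_rieszPartial hε hφ.ne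
  refine ⟨v, hv, ?_⟩
  refine DFunLike.coe_injective ((TopologicalSpace.denseRange_denseSeq E).equalizer
    φ.continuous (rieszDual j p v).continuous (funext fun m => ?_))
  obtain ⟨ns, hns, hlim⟩ := hφd m
  refine tendsto_nhds_unique hlim ?_
  have h1 := (hv.comp hns.tendsto_atTop).inner (𝕜 := ℂ)
    (tendsto_const_nhds (x := j p (TopologicalSpace.denseSeq E m)))
  simpa [rieszDual_apply] using h1

end Support

/-! ### Hida test functions as `L²` limits of polynomials. -/

section Hida

variable {E : Type*} [AddCommGroup E] [Module ℂ E] [TopologicalSpace E]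
variable {H : ℕ → Type*} [∀ p, NormedAddCommGroup (H p)] [∀ p, InnerProductSpace ℂ (H p)]
variable {j : ∀ p, E →L[ℂ] H p}

/-- The polynomial approximation `φ ↦ ψ(φ_N, …, φ_N)` of `φ ↦ ψ(φ, …, φ)`, where `φ_N` is the
projection of `φ` onto the span of the first `N` basis vectors. -/
def kernelApprox (j : ∀ p, E →L[ℂ] H p) (p : ℕ) (ε : ℕ → E) {n : ℕ}
    (ψ : MultilinearMap ℂ (fun _ : Fin n => StrongDual ℂ E) ℂ) (N : ℕ) (φ : StrongDual ℂ E) : ℂ :=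
  ψ fun _ => rieszDual j p (rieszPartial j p ε N φ)

lemma kernelApprox_mem_homPoly (p : ℕ) (ε : ℕ → E) {n : ℕ}
    (ψ : MultilinearMap ℂ (fun _ : Fin n => StrongDual ℂ E) ℂ) (N : ℕ) :
    kernelApprox j p ε ψ N ∈ homPoly E n := by
  have heq : kernelApprox j p ε ψ N = ∑ r : Fin n → Fin N,
      (ψ fun l => rieszDual j p (j p (ε (r l)))) •
        fun φ : StrongDual ℂ E => ∏ l, φ (ε (r l)) := by
    funext φ
    have h1 : rieszDual j p (rieszPartial j p ε N φ) =
        ∑ k : Fin N, φ (ε k) • rieszDual j p (j p (ε k)) := by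
      have h2 := map_sum (rieszDualₗ j p) (fun k => conj (φ (ε k)) • j p (ε k)) (Finset.range N)
      refine h2.trans ?_
      rw [Finset.sum_range]
      refine Finset.sum_congr rfl fun k _ => ?_
      rw [map_smulₛₗ, Complex.conj_conj]
      rfl
    rw [kernelApprox, h1, MultilinearMap.map_sum]
    simp only [Finset.sum_apply, Pi.smul_apply, smul_eq_mul]
    refine Finset.sum_congr rfl fun r _ => ?_
    rw [MultilinearMap.map_smul_univ, smul_eq_mul, mul_comm]
  rw [heq]
  exact Submodule.sum_mem _ fun r _ => Submodule.smul_mem _ _ (Submodule.subset_span ⟨_, rfl⟩)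

/-- A spare factor `4^n` in a bound for squares buys geometric decay of the terms, uniformly in the
approximation. -/
lemma le_sqrt_mul_geometric {t V : ℝ} {n : ℕ} (h : 4 ^ n * t ^ 2 ≤ V) :
    t ≤ Real.sqrt V * (1 / 2) ^ n := by
  have hV : 0 ≤ V := le_trans (by positivity) h
  refine le_of_sq_le_sq ?_ (by positivity)
  rw [mul_pow, Real.sq_sqrt hV, ← pow_mul, mul_comm n 2, pow_mul]
  norm_num
  rw [one_div, inv_pow, ← div_eq_mul_inv, le_div_iff₀ (by positivity)]
  linarith

lemma kernelNormSq_ne_top {p : ℕ}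
    {ψ : ∀ n : ℕ, MultilinearMap ℂ (fun _ : Fin n => StrongDual ℂ E) ℂ}
    (hκ : ∀ q : ℕ, ∑' n : ℕ, (n.factorial : ℝ≥0∞) * 2 ^ (q * n) * kernelNormSq j p (ψ n) < ∞)
    (n : ℕ) : kernelNormSq j p (ψ n) ≠ ∞ := by
  intro h
  have h1 := (ENNReal.le_tsum n).trans_lt (hκ 0)
  rw [h] at h1
  simp [Nat.factorial_ne_zero] at h1

variable [MeasurableSpace (StrongDual ℂ E)] {Δ : E →ₗ⋆[ℂ] E →ₗ[ℂ] ℂ} {μ : Measure (StrongDual ℂ E)}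

/-- The function dominating a Hida test function and its polynomial approximations is
integrable. -/
lemma IsComplexGaussian.lintegral_dominating_ne_top (hμ : IsComplexGaussian Δ μ)
    (hΔ : IsCovariance Δ) (hev : ∀ x : E, Measurable fun φ : StrongDual ℂ E => φ x) {ε : ℕ → E}
    (hsum : Summable fun k => (Δ (ε k) (ε k)).re) {κ : ℕ → ℝ≥0∞}
    (hκ : ∀ q : ℕ, ∑' n : ℕ, (n.factorial : ℝ≥0∞) * 2 ^ (q * n) * κ n < ∞) (a : ℕ) :
    ∫⁻ φ : StrongDual ℂ E, ∑' n, 2 ^ (a * n) * κ n * (∑' k, ‖φ (ε k)‖ₑ ^ 2) ^ n ∂μ ≠ ∞ := by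
  have := hμ.isProbabilityMeasure
  have hS : Measurable fun φ : StrongDual ℂ E => ∑' k, ‖φ (ε k)‖ₑ ^ 2 :=
    Measurable.tsum fun k => (hev (ε k)).enorm.pow_const 2
  set D : ℝ≥0∞ := ∑' k, ENNReal.ofReal (Δ (ε k) (ε k)).re with hD
  have hDtop : D ≠ ∞ := hsum.tsum_ofReal_ne_top
  -- The moments are at most `n! D^n`, so the growth is absorbed by the kernel condition with `q = a
  -- + b`.
  obtain ⟨b, hb⟩ : ∃ b : ℕ, D ≤ 2 ^ b := by
    obtain ⟨m, hm⟩ := ENNReal.exists_nat_gt hDtop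
    refine ⟨m, hm.le.trans ?_⟩
    exact_mod_cast Nat.lt_two_pow_self.le
  have hmom : ∀ n, ∫⁻ φ : StrongDual ℂ E, (∑' k, ‖φ (ε k)‖ₑ ^ 2) ^ n ∂μ ≤
      n.factorial * 2 ^ (b * n) := fun n => by
    rcases Nat.eq_zero_or_pos n with rfl | hn
    · simp
    refine (lintegral_tsum_pow_le (fun k => (hev (ε k)).enorm.pow_const 2) hn
      fun k => (hμ.lintegral_eval_pow hΔ hev (ε k) hn).le).trans ?_
    rw [ENNReal.ofReal_natCast, pow_mul]
    gcongr
  rw [lintegral_tsum fun n => ((hS.pow_const n).const_mul _).aemeasurable]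
  refine ((ENNReal.tsum_le_tsum fun n => ?_).trans_lt (hκ (a + b))).ne
  rw [lintegral_const_mul _ (hS.pow_const n)]
  calc _ ≤ 2 ^ (a * n) * κ n * (n.factorial * 2 ^ (b * n)) := by gcongr; exact hmom n
    _ = _ := by rw [add_mul, pow_add]; ring

/-- `f(N)` acts on Hida test functions kernel by kernel, and the result is approximated in `L²` by
polynomials that do not depend on `f`. -/
lemma IsComplexGaussian.tendsto_kernelApprox (hμ : IsComplexGaussian Δ μ)
    (hΔ : IsCovariance Δ) (hev : ∀ x : E, Measurable fun φ : StrongDual ℂ E => φ x)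
    {p : ℕ} {ε : ℕ → E} (hε : Orthonormal ℂ fun k => j p (ε k))
    (hsum : Summable fun k => (Δ (ε k) (ε k)).re)
    (hae : ∀ᵐ φ ∂μ, ∃ v : H p, Tendsto (fun N => rieszPartial j p ε N φ) atTop (𝓝 v) ∧
      φ = rieszDual j p v)
    {ψ : ∀ n : ℕ, MultilinearMap ℂ (fun _ : Fin n => StrongDual ℂ E) ℂ}
    (hκ : ∀ q : ℕ, ∑' n : ℕ, (n.factorial : ℝ≥0∞) * 2 ^ (q * n) * kernelNormSq j p (ψ n) < ∞)
    {f : ℕ → ℝ} {a : ℕ} (hf : ∀ n, |f n| ≤ 2 ^ (a * n)) :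
    AEStronglyMeasurable (fun φ => ∑' n, (f n : ℂ) * ψ n fun _ => φ) μ ∧
    Tendsto (fun N => eLpNorm (fun φ => (∑' n, (f n : ℂ) * ψ n fun _ => φ) -
      ∑ n ∈ Finset.range N, (f n : ℂ) * kernelApprox j p ε (ψ n) N φ) 2 μ) atTop (𝓝 0) := by
  have hκt := kernelNormSq_ne_top hκ
  -- In the exponent, `2a` pays for `|f n|²` and the additional `2` for the factor `4^n` that makes
  -- the series geometric.
  set V : StrongDual ℂ E → ℝ≥0∞ := fun φ =>
    ∑' n, 2 ^ ((2 * a + 2) * n) * kernelNormSq j p (ψ n) * (∑' k, ‖φ (ε k)‖ₑ ^ 2) ^ n with hV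
  have hVint : ∫⁻ φ, V φ ∂μ ≠ ∞ := hμ.lintegral_dominating_ne_top hΔ hev hsum hκ (2 * a + 2)
  have hVmeas : Measurable V := by
    refine Measurable.tsum fun n => Measurable.const_mul (Measurable.pow_const ?_ n) _
    exact Measurable.tsum fun k => (hev (ε k)).enorm.pow_const 2
  set F : StrongDual ℂ E → ℂ := fun φ => ∑' n, (f n : ℂ) * ψ n fun _ => φ with hF
  set U : ℕ → StrongDual ℂ E → ℂ := fun N φ =>
    ∑ n ∈ Finset.range N, (f n : ℂ) * kernelApprox j p ε (ψ n) N φ with hU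
  have hUmeas : ∀ N, AEStronglyMeasurable (U N) μ := fun N =>
    (hμ.memLp_sum hΔ hev (fun n => kernelApprox_mem_homPoly p ε (ψ n) N) f N
      1).aestronglyMeasurable
  -- Both `F` and `U N` are bounded by `2 √V`, the sum of the geometric majorant, whence the
  -- constant `16 = 4²`.
  have hpt : ∀ᵐ φ ∂μ, Tendsto (fun N => U N φ) atTop (𝓝 (F φ)) ∧
      ∀ N, ‖F φ - U N φ‖ₑ ^ 2 ≤ 16 * V φ := by
    filter_upwards [hae, ae_lt_top hVmeas hVint] with φ ⟨v, hv, hφv⟩ hVφ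
    have hS := tsum_enorm_sq_eq hε hv
    set bnd : ℕ → ℝ := fun n => Real.sqrt (V φ).toReal * (1 / 2) ^ n with hbnd
    have hbsum : HasSum bnd (Real.sqrt (V φ).toReal * 2) := hasSum_geometric_two.mul_left _
    have hterm : ∀ (n : ℕ) (w : H p), ‖w‖ ≤ ‖v‖ →
        ‖(f n : ℂ) * ψ n fun _ => rieszDual j p w‖ ≤ bnd n := fun n w hw => by
      refine le_sqrt_mul_geometric ?_
      have h1 := norm_kernel_sq_le (hκt n) (fun _ => w)
      simp only [Finset.prod_const, Finset.card_univ, Fintype.card_fin] at h1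
      have h2 : 2 ^ ((2 * a + 2) * n) * (kernelNormSq j p (ψ n)).toReal * (‖v‖ ^ 2) ^ n ≤
          (V φ).toReal := by
        have h3 := ENNReal.toReal_mono hVφ.ne (ENNReal.le_tsum (f := fun n =>
          2 ^ ((2 * a + 2) * n) * kernelNormSq j p (ψ n) * (∑' k, ‖φ (ε k)‖ₑ ^ 2) ^ n) n)
        rw [hS] at h3
        simpa [ENNReal.toReal_ofReal (sq_nonneg ‖v‖)] using h3
      refine le_trans ?_ h2
      rw [norm_mul, mul_pow, Complex.norm_real, Real.norm_eq_abs]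
      have h4 : |f n| ^ 2 ≤ (2 : ℝ) ^ (2 * a * n) := by
        calc |f n| ^ 2 ≤ ((2 : ℝ) ^ (a * n)) ^ 2 := pow_le_pow_left₀ (abs_nonneg _) (hf n) 2
          _ = _ := by rw [← pow_mul]; ring_nf
      have h5 : ‖ψ n fun _ => rieszDual j p w‖ ^ 2 ≤
          (kernelNormSq j p (ψ n)).toReal * (‖v‖ ^ 2) ^ n := by
        refine h1.trans (mul_le_mul_of_nonneg_left ?_ ENNReal.toReal_nonneg)
        gcongr
      calc (4 : ℝ) ^ n * (|f n| ^ 2 * ‖ψ n fun _ => rieszDual j p w‖ ^ 2)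
          ≤ 4 ^ n * ((2 : ℝ) ^ (2 * a * n) *
            ((kernelNormSq j p (ψ n)).toReal * (‖v‖ ^ 2) ^ n)) := by gcongr
        _ = _ := by
          rw [add_mul, pow_add, show (4 : ℝ) = 2 ^ 2 by norm_num, ← pow_mul 2 2 n]
          ring
    have hNterm : ∀ N n, ‖(f n : ℂ) * kernelApprox j p ε (ψ n) N φ‖ ≤ bnd n := fun N n =>
      hterm n _ (norm_rieszPartial_le hε hv N)
    have hFterm : ∀ n, ‖(f n : ℂ) * ψ n fun _ => φ‖ ≤ bnd n := fun n => by
      rw [hφv]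
      exact hterm n v le_rfl
    have hUtsum : ∀ N, U N φ = ∑' n, if n < N then (f n : ℂ) * kernelApprox j p ε (ψ n) N φ else 0 :=
      fun N => by
        rw [tsum_eq_sum (s := Finset.range N)]
        · exact Finset.sum_congr rfl fun n hn => by rw [if_pos (Finset.mem_range.mp hn)]
        · intro n hn
          rw [if_neg (by simpa using hn)]
    constructor
    · simp_rw [hUtsum]
      refine tendsto_tsum_of_dominated_convergence hbsum.summable (fun n => ?_)
        (Eventually.of_forall fun N n => ?_)
      · have h1 : Tendsto (fun N => (f n : ℂ) * kernelApprox j p ε (ψ n) N φ) atTop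
            (𝓝 ((f n : ℂ) * ψ n fun _ => φ)) := by
          have h2 := ((continuous_kernel_rieszDual (hκt n)).tendsto v).comp hv
          rw [← hφv] at h2
          exact h2.const_mul _
        refine h1.congr' ?_
        filter_upwards [eventually_gt_atTop n] with N hN
        rw [if_pos hN]
      · split_ifs
        · exact hNterm N n
        · rw [norm_zero]
          positivity
    · intro N
      have h1 : ‖F φ‖ ≤ Real.sqrt (V φ).toReal * 2 := tsum_of_norm_bounded hbsum hFterm
      have h2 : ‖U N φ‖ ≤ Real.sqrt (V φ).toReal * 2 := by
        rw [hUtsum]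
        refine tsum_of_norm_bounded hbsum fun n => ?_
        split_ifs
        · exact hNterm N n
        · rw [norm_zero]
          positivity
      have h3 : ‖F φ - U N φ‖ ^ 2 ≤ 16 * (V φ).toReal := by
        have h4 := (norm_sub_le (F φ) (U N φ)).trans (add_le_add h1 h2)
        calc _ ≤ (Real.sqrt (V φ).toReal * 2 + Real.sqrt (V φ).toReal * 2) ^ 2 :=
              pow_le_pow_left₀ (norm_nonneg _) h4 2
          _ = 16 * Real.sqrt (V φ).toReal ^ 2 := by ring
          _ = _ := by rw [Real.sq_sqrt ENNReal.toReal_nonneg]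
      rw [← ofReal_norm, ← ENNReal.ofReal_pow (norm_nonneg _)]
      refine (ENNReal.ofReal_le_ofReal h3).trans_eq ?_
      rw [ENNReal.ofReal_mul (by norm_num), ENNReal.ofReal_toReal hVφ.ne]
      norm_num
  have hFmeas : AEStronglyMeasurable F μ :=
    aestronglyMeasurable_of_tendsto_ae atTop hUmeas (hpt.mono fun φ h => h.1)
  refine ⟨hFmeas, ?_⟩
  have hlim := tendsto_lintegral_of_dominated_convergence' (μ := μ)
    (F := fun N φ => ‖F φ - U N φ‖ₑ ^ 2) (f := fun _ => 0) (fun φ => 16 * V φ)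
    (fun N => (hFmeas.sub (hUmeas N)).enorm.pow_const 2)
    (fun N => hpt.mono fun φ h => h.2 N)
    (by rw [lintegral_const_mul _ hVmeas]; exact ENNReal.mul_ne_top (by norm_num) hVint)
    (hpt.mono fun φ h => by
      have h1 := (tendsto_const_nhds (x := F φ)).sub h.1
      rw [sub_self] at h1
      simpa using ENNReal.Tendsto.pow (n := 2) h1.enorm)
  rw [lintegral_zero] at hlim
  have h5 := ((ENNReal.continuous_rpow_const (y := 1 / 2)).tendsto _).comp hlim
  rw [ENNReal.zero_rpow_of_pos (by norm_num)] at h5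
  exact h5.congr fun N => (eLpNorm_two_eq _ _).symm

/-- The action of `f(N)` on a Hida test function. -/
lemma IsComplexGaussian.exists_graph_of_kernels (hμ : IsComplexGaussian Δ μ)
    (hΔ : IsCovariance Δ) (hev : ∀ x : E, Measurable fun φ : StrongDual ℂ E => φ x)
    {p : ℕ} {ε : ℕ → E} (hε : Orthonormal ℂ fun k => j p (ε k))
    (hsum : Summable fun k => (Δ (ε k) (ε k)).re)
    (hae : ∀ᵐ φ ∂μ, ∃ v : H p, Tendsto (fun N => rieszPartial j p ε N φ) atTop (𝓝 v) ∧
      φ = rieszDual j p v)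
    {ψ : ∀ n : ℕ, MultilinearMap ℂ (fun _ : Fin n => StrongDual ℂ E) ℂ}
    (hκ : ∀ q : ℕ, ∑' n : ℕ, (n.factorial : ℝ≥0∞) * 2 ^ (q * n) * kernelNormSq j p (ψ n) < ∞)
    {Ψ : StrongDual ℂ E →ₘ[μ] ℂ} (hΨ : Ψ =ᵐ[μ] fun φ => ∑' n, ψ n fun _ => φ)
    {f : ℕ → ℝ} {a : ℕ} (hf : ∀ n, |f n| ≤ 2 ^ (a * n)) :
    ∃ Φ : StrongDual ℂ E →ₘ[μ] ℂ, (Φ =ᵐ[μ] fun φ => ∑' n, (f n : ℂ) * ψ n fun _ => φ) ∧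
      NumberOpGraph μ 2 f Ψ Φ := by
  obtain ⟨hm, hlim⟩ := hμ.tendsto_kernelApprox hΔ hev hε hsum hae hκ hf
  -- The multiplier `1` shows that the same polynomials approximate `Ψ` itself.
  obtain ⟨-, hlim1⟩ := hμ.tendsto_kernelApprox hΔ hev hε hsum hae hκ (f := fun _ => 1) (a := 0)
    (fun n => by simp)
  refine ⟨AEEqFun.mk _ hm, AEEqFun.coeFn_mk _ hm, fun N => N,
    fun N n => kernelApprox j p ε (ψ n) N, fun N n => kernelApprox_mem_homPoly p ε (ψ n) N, ?_, ?_⟩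
  · refine hlim1.congr fun N => eLpNorm_congr_ae ?_
    filter_upwards [hΨ] with φ hφ
    simp [hφ]
  · refine hlim.congr fun N => eLpNorm_congr_ae ?_
    filter_upwards [AEEqFun.coeFn_mk _ hm] with φ hφ
    rw [hφ]

/-- Orthonormal coordinates adapted to the covariance: the setting in which Hida test functions
are expanded. -/
lemma IsComplexGaussian.exists_coordinates {T : ∀ p, H (p + 1) →L[ℂ] H p}
    [∀ p, CompleteSpace (H p)] [∀ p, TopologicalSpace.SeparableSpace (H p)]
    (hμ : IsComplexGaussian Δ μ) (hΔ : IsCovariance Δ) (hE : IsNuclearFrechet j T)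
    (hdim : ¬ FiniteDimensional ℂ E) (hev : ∀ x : E, Measurable fun φ : StrongDual ℂ E => φ x) :
    ∃ (p : ℕ) (ε : ℕ → E) (C : ℝ), Orthonormal ℂ (fun k => j p (ε k)) ∧
      (∀ x : E,
        j p x ∈ closure (Submodule.span ℂ (Set.range fun k => j p (ε k)) : Set (H p))) ∧
      (∀ x, (Δ x x).re ≤ C * ‖j p x‖ ^ 2) ∧ (Summable fun k => (Δ (ε k) (ε k)).re) ∧
      ∀ᵐ φ ∂μ, ∃ v : H p, Tendsto (fun N => rieszPartial j p ε N φ) atTop (𝓝 v) ∧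
        φ = rieszDual j p v := by
  obtain ⟨p, C, hC0, hC⟩ := hΔ.exists_bound hE
  -- One level above the bound for `Δ`, so that the Hilbert–Schmidt map `T p` makes the trace
  -- finite.
  obtain ⟨ε, hε, hcl⟩ := hE.exists_orthonormal hdim (p + 1)
  have hsum : Summable fun k => (Δ (ε k) (ε k)).re := by
    refine Summable.of_nonneg_of_le (fun k => hΔ.re_nonneg _) (fun k => ?_)
      (((hE.hilbertSchmidt p).summable hε).mul_left C)
    rw [hE.comp]
    exact hC _
  have hC' : ∀ x, (Δ x x).re ≤ C * ‖T p‖ ^ 2 * ‖j (p + 1) x‖ ^ 2 := fun x => by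
    refine (hC x).trans ?_
    rw [mul_assoc, ← mul_pow, ← hE.comp]
    gcongr
    exact (T p).le_opNorm _
  exact ⟨p + 1, ε, _, hε, hcl, hC', hsum, hμ.ae_exists_riesz hΔ hE hev hε hcl hC' hsum⟩

end Hida

/-! ### Bessel's inequality for the covariance. -/

section Bessel

variable {V : Type*} [AddCommGroup V] [Module ℂ V] {Δ : V →ₗ⋆[ℂ] V →ₗ[ℂ] ℂ}

/-- Bessel's inequality for a positive definite hermitian form. -/
lemma FormOrthonormal.sum_norm_sq_le {κ : Type*} [DecidableEq κ]
    (hherm : ∀ ρ χ, Δ ρ χ = conj (Δ χ ρ)) (hpos : ∀ ρ, ρ ≠ 0 → 0 < (Δ ρ ρ).re) {g : κ → V}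
    (hg : FormOrthonormal Δ g) (s : Finset κ) (y : V) :
    ∑ k ∈ s, ‖Δ (g k) y‖ ^ 2 ≤ (Δ y y).re := by
  let core := formCore hherm hpos
  let : NormedAddCommGroup V := core.toNormedAddCommGroup
  let : InnerProductSpace ℂ V := InnerProductSpace.ofCore core.toCore
  have hON : Orthonormal ℂ g := orthonormal_iff_ite.mpr hg
  have h := hON.sum_inner_products_le y (s := s)
  rw [norm_sq_eq_re_inner (𝕜 := ℂ)] at h
  exact h

end Bessel

/-! ### Decaying orthonormal sequences and kernels of degree one. -/

section Strict

variable {E : Type*} [AddCommGroup E] [Module ℂ E] [TopologicalSpace E]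
variable {H : ℕ → Type*} [∀ p, NormedAddCommGroup (H p)] [∀ p, InnerProductSpace ℂ (H p)]
variable {j : ∀ p, E →L[ℂ] H p} {Δ : E →ₗ⋆[ℂ] E →ₗ[ℂ] ℂ}

/-- The norm of `Δ(x, ·)` on `H p` in terms of the coordinates of an orthonormal sequence. -/
lemma IsCovariance.norm_sq_apply_le (hΔ : IsCovariance Δ) {p : ℕ} {ε : ℕ → E}
    (hε : Orthonormal ℂ fun k => j p (ε k))
    (hcl : ∀ x : E, j p x ∈ closure (Submodule.span ℂ (Set.range fun k => j p (ε k)) : Set (H p)))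
    {C : ℝ} (hC : ∀ x, (Δ x x).re ≤ C * ‖j p x‖ ^ 2) {x : E} (hx : Δ x x = 1)
    (hsum : Summable fun i => ‖Δ x (ε i)‖ ^ 2) (y : E) :
    ‖Δ x y‖ ^ 2 ≤ (∑' i, ‖Δ x (ε i)‖ ^ 2) * ‖j p y‖ ^ 2 := by
  set c : ℕ → ℂ := fun i => inner ℂ (j p (ε i)) (j p y) with hc
  set z : ℕ → E := fun N => ∑ i ∈ Finset.range N, c i • ε i with hz
  have hbess : ∀ w, ‖Δ x w‖ ^ 2 ≤ (Δ w w).re := fun w => by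
    have hON : FormOrthonormal Δ fun _ : Unit => x := fun i k => by simp [hx]
    simpa using hON.sum_norm_sq_le hΔ.hermitian hΔ.posDef Finset.univ w
  have hzy : Tendsto (fun N => Δ x (z N)) atTop (𝓝 (Δ x y)) := by
    rw [tendsto_iff_norm_sub_tendsto_zero]
    have h1 : Tendsto (fun N => C * ‖j p (z N - y)‖ ^ 2) atTop (𝓝 0) := by
      have h2 := tendsto_fourier_of_mem_closure hε (hcl y)
      have h3 : ∀ N, j p (z N - y) =
          (∑ k ∈ Finset.range N, inner ℂ (j p (ε k)) (j p y) • j p (ε k)) - j p y := fun N => by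
        simp [hz, hc]
      simp_rw [h3]
      simpa using (((h2.sub_const (j p y)).norm.pow 2).const_mul C)
    have h4 : Tendsto (fun N => ‖Δ x (z N) - Δ x y‖ ^ 2) atTop (𝓝 0) := by
      refine squeeze_zero (fun N => by positivity) (fun N => ?_) h1
      rw [← map_sub]
      exact (hbess _).trans (hC _)
    have h5 := h4.sqrt
    simpa [Real.sqrt_sq (norm_nonneg _)] using h5
  refine le_of_tendsto (hzy.norm.pow 2) (Eventually.of_forall fun N => ?_)
  have h6 : Δ x (z N) = ∑ i ∈ Finset.range N, c i * Δ x (ε i) := by simp [hz]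
  rw [h6]
  calc ‖∑ i ∈ Finset.range N, c i * Δ x (ε i)‖ ^ 2
      ≤ (∑ i ∈ Finset.range N, ‖c i‖ * ‖Δ x (ε i)‖) ^ 2 := by
        refine pow_le_pow_left₀ (norm_nonneg _) ((norm_sum_le _ _).trans_eq ?_) 2
        exact Finset.sum_congr rfl fun i _ => norm_mul _ _
    _ ≤ (∑ i ∈ Finset.range N, ‖c i‖ ^ 2) * ∑ i ∈ Finset.range N, ‖Δ x (ε i)‖ ^ 2 :=
        Finset.sum_mul_sq_le_sq_mul_sq _ _ _
    _ ≤ ‖j p y‖ ^ 2 * ∑' i, ‖Δ x (ε i)‖ ^ 2 := by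
        gcongr
        · exact hε.sum_inner_products_le _
        · exact hsum.sum_le_tsum _ fun i _ => by positivity
    _ = _ := mul_comm _ _

/-- There is a `Δ`-orthonormal sequence on which the elements of `E` decay rapidly. -/
lemma IsCovariance.exists_decaying_orthonormal (hΔ : IsCovariance Δ)
    (hdim : ¬ FiniteDimensional ℂ E) {p : ℕ} {ε : ℕ → E}
    (hε : Orthonormal ℂ fun k => j p (ε k))
    (hcl : ∀ x : E, j p x ∈ closure (Submodule.span ℂ (Set.range fun k => j p (ε k)) : Set (H p)))
    {C : ℝ} (hC : ∀ x, (Δ x x).re ≤ C * ‖j p x‖ ^ 2)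
    (hsum : Summable fun k => (Δ (ε k) (ε k)).re) :
    ∃ g : ℕ → E, FormOrthonormal Δ g ∧ ∀ n y, ‖Δ (g n) y‖ ≤ (1 / 4) ^ n * ‖j p y‖ := by
  obtain ⟨g, hg⟩ := exists_formOrthonormal_nat hΔ.hermitian hΔ.posDef hdim
  -- After exchanging the sums, Bessel's inequality in `k` bounds the total by the trace of `Δ`.
  -- Hence the functionals `Δ (g k) ·` tend to `0` in the dual of `H p`, and a subsequence does so
  -- as fast as desired.
  have htot : ∑' k, ∑' i, ‖Δ (g k) (ε i)‖ₑ ^ 2 ≠ ∞ := by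
    rw [ENNReal.tsum_comm]
    refine ((ENNReal.tsum_le_tsum fun i => ?_).trans_lt hsum.tsum_ofReal_lt_top).ne
    refine le_of_tendsto' (ENNReal.tendsto_nat_tsum _) fun N => ?_
    have h1 := ENNReal.ofReal_le_ofReal
      (hg.sum_norm_sq_le hΔ.hermitian hΔ.posDef (Finset.range N) (ε i))
    rw [ENNReal.ofReal_sum_of_nonneg fun _ _ => by positivity] at h1
    simpa [ENNReal.ofReal_pow] using h1
  have hfin : ∀ k, ∑' i, ‖Δ (g k) (ε i)‖ₑ ^ 2 ≠ ∞ := ENNReal.ne_top_of_tsum_ne_top htot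
  have hsumk : ∀ k, Summable fun i => ‖Δ (g k) (ε i)‖ ^ 2 := fun k => by
    simpa using ENNReal.summable_toReal (hfin k)
  have hzero : Tendsto (fun k => ∑' i, ‖Δ (g k) (ε i)‖ ^ 2) atTop (𝓝 0) := by
    have h1 := (ENNReal.summable_toReal htot).tendsto_atTop_zero
    refine h1.congr fun k => ?_
    rw [ENNReal.tsum_toReal_eq fun i => by finiteness]
    simp
  obtain ⟨σ, hσ, hσ'⟩ := extraction_forall_of_eventually'
    (P := fun n k => ∑' i, ‖Δ (g k) (ε i)‖ ^ 2 ≤ ((1 / 4 : ℝ) ^ n) ^ 2)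
    fun n => eventually_atTop.mp
      (hzero.eventually_le_const (show (0 : ℝ) < ((1 / 4 : ℝ) ^ n) ^ 2 by positivity))
  refine ⟨g ∘ σ, fun i k => ?_, fun n y => ?_⟩
  · simp only [Function.comp_apply, hg _ _, hσ.injective.eq_iff]
  · refine le_of_sq_le_sq ?_ (by positivity)
    rw [mul_pow]
    refine (hΔ.norm_sq_apply_le hε hcl hC (by simpa using hg (σ n) (σ n)) (hsumk _) y).trans ?_
    exact mul_le_mul_of_nonneg_right (hσ' n) (by positivity)

/-- A kernel of degree one with finite norms is an element of `E`. -/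
lemma IsNuclearFrechet.exists_eq_of_kernel_one {T : ∀ p, H (p + 1) →L[ℂ] H p}
    [∀ p, CompleteSpace (H p)] (hE : IsNuclearFrechet j T)
    {ψ : MultilinearMap ℂ (fun _ : Fin 1 => StrongDual ℂ E) ℂ}
    (hψ : ∀ p, kernelNormSq j p ψ ≠ ∞) :
    ∃ y : E, ∀ p (v : H p), (ψ fun _ => rieszDual j p v) = rieszDual j p v y := by
  have hL : ∀ p, ∃ u : H p, ∀ v, (ψ fun _ => rieszDual j p v) = inner ℂ v u := fun p => by
    have hadd : ∀ a b : StrongDual ℂ E, (ψ fun _ => a + b) = (ψ fun _ => a) + ψ fun _ => b :=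
      fun a b => by
        have hu : ∀ c : StrongDual ℂ E,
            Function.update (fun _ : Fin 1 => (0 : StrongDual ℂ E)) 0 c = fun _ => c :=
          fun c => funext fun i => by rw [Subsingleton.elim i 0, Function.update_self]
        have h := ψ.map_update_add (fun _ => 0) 0 a b
        rwa [hu, hu, hu] at h
    have hsmul : ∀ (c : ℂ) (a : StrongDual ℂ E), (ψ fun _ => c • a) = c * ψ fun _ => a :=
      fun c a => by
        simpa using ψ.map_smul_univ (fun _ => c) (fun _ => a)
    let L : H p →ₗ[ℂ] ℂ :=
      { toFun := fun v => conj (ψ fun _ => rieszDual j p v)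
        map_add' := fun v w => by
          have h1 : rieszDual j p (v + w) = rieszDual j p v + rieszDual j p w :=
            (rieszDualₗ j p).map_add v w
          rw [h1, hadd, map_add]
        map_smul' := fun c v => by
          have h1 : rieszDual j p (c • v) = conj c • rieszDual j p v :=
            (rieszDualₗ j p).map_smulₛₗ c v
          rw [h1, hsmul, map_mul, Complex.conj_conj, smul_eq_mul, RingHom.id_apply] }
    let L' : StrongDual ℂ (H p) := L.mkContinuous (Real.sqrt (kernelNormSq j p ψ).toReal)
      fun v => by
        have := norm_kernel_le (hψ p) fun _ => v
        simpa [L] using this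
    refine ⟨(InnerProductSpace.toDual ℂ (H p)).symm L', fun v => ?_⟩
    have h1 : inner ℂ ((InnerProductSpace.toDual ℂ (H p)).symm L') v = L' v :=
      InnerProductSpace.toDual_symm_apply
    rw [← inner_conj_symm, h1]
    change _ = conj (conj (ψ fun _ => rieszDual j p v))
    rw [Complex.conj_conj]
  choose u hu using hL
  -- The Riesz representatives at successive levels are compatible because a functional on `H p`
  -- pulled back along `T p` restricts to the same element of `E'`.
  obtain ⟨y, hy, -⟩ := hE.limit u fun p => by
    refine ext_inner_left ℂ fun v => ?_
    rw [← ContinuousLinearMap.adjoint_inner_left, ← hu, ← hu]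
    congr 1
    funext _
    ext x
    rw [rieszDual_apply, rieszDual_apply, ContinuousLinearMap.adjoint_inner_left, hE.comp]
  refine ⟨y, fun p v => ?_⟩
  rw [hu, rieszDual_apply, hy]

lemma eval_mem_homPoly_one (x : E) : (fun φ : StrongDual ℂ E => φ x) ∈ homPoly E 1 := by
  simpa using eval_pow_mem_homPoly x 1

variable [MeasurableSpace (StrongDual ℂ E)] {μ : Measure (StrongDual ℂ E)}

/-- The covariance of a complex Gaussian field. -/
lemma IsComplexGaussian.integral_eval_mul_conj (hμ : IsComplexGaussian Δ μ) (hΔ : IsCovariance Δ)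
    (hev : ∀ x : E, Measurable fun φ : StrongDual ℂ E => φ x) (x y : E) :
    ∫ φ : StrongDual ℂ E, φ y * conj (φ x) ∂μ = Δ x y := by
  classical
  obtain ⟨d, e, he, hspan⟩ := exists_formOrthonormal_span hΔ.hermitian hΔ.posDef {x, y}
  obtain ⟨a, rfl⟩ := (Submodule.mem_span_range_iff_exists_fun ℂ).mp (hspan x (by simp))
  obtain ⟨b, rfl⟩ := (Submodule.mem_span_range_iff_exists_fun ℂ).mp (hspan y (by simp))
  have hmem : ∀ i, MemLp (fun φ : StrongDual ℂ E => φ (e i)) 2 μ := fun i => by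
    exact_mod_cast hμ.memLp_homPoly hΔ hev (eval_mem_homPoly_one (e i)) 2
  have hint : ∀ i k, Integrable (fun φ : StrongDual ℂ E =>
      (b i * conj (a k)) * (φ (e i) * conj (φ (e k)))) μ := fun i k =>
    ((hmem i).integrable_mul (hmem k).star).const_mul _
  have hcov : ∀ i k, ∫ φ : StrongDual ℂ E, φ (e i) * conj (φ (e k)) ∂μ =
      if i = k then 1 else 0 := fun i k => by
    have h := hμ.integral_monomial hev he (Pi.single i 1) (Pi.single k 1)
    have h1 : ∀ (i : Fin d) (φ : StrongDual ℂ E),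
        ∏ l, φ (e l) ^ (Pi.single i 1 : Fin d → ℕ) l = φ (e i) := fun i φ => by
      rw [Finset.prod_eq_single i]
      · simp
      · intro l _ hl
        simp [hl]
      · simp
    have h2 : ∏ l, ((Pi.single i 1 : Fin d → ℕ) l).factorial = 1 :=
      Finset.prod_eq_one fun l _ => by
        by_cases hl : l = i
        · subst hl; simp
        · simp [hl]
    simp_rw [h1] at h
    rw [h, h2, Nat.cast_one]
    congr 1
    refine propext ⟨fun h => ?_, fun h => by rw [h]⟩
    by_contra hik
    simpa [Pi.single_apply, hik] using congrFun h i
  have hexp : ∀ φ : StrongDual ℂ E, φ (∑ i, b i • e i) * conj (φ (∑ i, a i • e i)) =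
      ∑ i, ∑ k, (b i * conj (a k)) * (φ (e i) * conj (φ (e k))) := fun φ => by
    simp only [map_sum, map_smul, smul_eq_mul, map_mul, Finset.sum_mul_sum]
    exact Finset.sum_congr rfl fun i _ => Finset.sum_congr rfl fun k _ => by ring
  simp_rw [hexp]
  rw [integral_finsetSum _ fun i _ => integrable_finsetSum _ fun k _ => hint i k, he.apply_sum]
  refine Finset.sum_congr rfl fun i _ => ?_
  rw [integral_finsetSum _ fun k _ => hint i k]
  simp_rw [integral_const_mul, hcov]
  simp [mul_comm]

end Strict

/-! ### The inclusion of Hida test functions in `𝒢` and its strictness. -/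

variable {E : Type*} [AddCommGroup E] [Module ℂ E] [TopologicalSpace E]
variable {H : ℕ → Type*} [∀ p, NormedAddCommGroup (H p)] [∀ p, InnerProductSpace ℂ (H p)]
variable [∀ p, CompleteSpace (H p)] [∀ p, TopologicalSpace.SeparableSpace (H p)]
variable {j : ∀ p, E →L[ℂ] H p} {T : ∀ p, H (p + 1) →L[ℂ] H p} {Δ : E →ₗ⋆[ℂ] E →ₗ[ℂ] ℂ}
variable [MeasurableSpace (StrongDual ℂ E)] {μ : Measure (StrongDual ℂ E)}

/-- The multiplier `2^{qn/2}` grows at most like `2^{qn}`, so it acts on the kernels; a single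
Hilbert norm that carries `μ` is enough. -/
theorem hidaSpace_subset_spaceG (hμ : IsComplexGaussian Δ μ) (hΔ : IsCovariance Δ)
    (hE : IsNuclearFrechet j T) (hdim : ¬ FiniteDimensional ℂ E)
    (hev : ∀ x : E, Measurable fun φ : StrongDual ℂ E => φ x) : hidaSpace j μ ⊆ spaceG μ := by
  rintro Ψ ⟨Ψ₀, ⟨ψ, -, hκ, hsumΨ⟩, hΨ⟩ q
  obtain ⟨p, ε, C, hε, hcl, hC, hsum, hae⟩ := hμ.exists_coordinates hΔ hE hdim hev
  obtain ⟨Φ, -, hΦ⟩ := hμ.exists_graph_of_kernels hΔ hev hε hsum hae (hκ p)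
    (hΨ.trans (Eventually.of_forall fun φ => (hsumΨ φ).tsum_eq.symm))
    (f := fun n => (2 : ℝ) ^ ((q : ℝ) * n / 2)) (a := q) fun n => by
      rw [abs_of_nonneg (by positivity), ← Real.rpow_natCast]
      refine Real.rpow_le_rpow_of_exponent_le one_le_two ?_
      have : (0 : ℝ) ≤ (q : ℝ) * n := by positivity
      push_cast
      linarith
  exact ⟨Φ, hΦ⟩

/-- An `L²`-limit of linear functionals belongs to `𝒢`. -/
lemma mem_spaceG_of_tendsto_homPoly_one {Ψ : StrongDual ℂ E →ₘ[μ] ℂ}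
    {L : ℕ → StrongDual ℂ E → ℂ} (hL : ∀ k, L k ∈ homPoly E 1)
    (h : Tendsto (fun k => eLpNorm (fun φ => Ψ φ - L k φ) 2 μ) atTop (𝓝 0)) :
    Ψ ∈ spaceG μ := fun q => by
  set f : ℕ → ℝ := fun n => (2 : ℝ) ^ ((q : ℝ) * n / 2) with hf
  -- The range of length `2` consists of degrees `0` and `1`, and only degree `1` is occupied, where
  -- the operator is the scalar `f 1`.
  refine ⟨(f 1 : ℂ) • Ψ, fun _ => 2, fun k n => if n = 1 then L k else 0, fun k n => ?_, ?_, ?_⟩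
  · dsimp only
    split_ifs with hn
    · rw [hn]; exact hL k
    · exact Submodule.zero_mem _
  · simpa [Finset.sum_range_succ] using h
  · have h1 : Tendsto (fun k => ‖(f 1 : ℂ)‖ₑ * eLpNorm (fun φ => Ψ φ - L k φ) 2 μ) atTop (𝓝 0) := by
      simpa using ENNReal.Tendsto.const_mul h (Or.inr enorm_ne_top)
    refine h1.congr fun k => ?_
    rw [← eLpNorm_const_smul]
    refine eLpNorm_congr_ae ?_
    filter_upwards [AEEqFun.coeFn_smul (f 1 : ℂ) Ψ] with φ hφ
    simp [hφ, Finset.sum_range_succ, mul_sub]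

/-- The witness is `∑ 2^{-n} φ(g n)`: in `L²` any square-summable coefficients are allowed, but
coefficients that come from an element of `E` decay like `4^{-n}`. -/
theorem exists_mem_spaceG_notMem_hidaSpace (hμ : IsComplexGaussian Δ μ) (hΔ : IsCovariance Δ)
    (hE : IsNuclearFrechet j T) (hdim : ¬ FiniteDimensional ℂ E)
    (hev : ∀ x : E, Measurable fun φ : StrongDual ℂ E => φ x) :
    ∃ Ψ ∈ spaceG μ, Ψ ∉ hidaSpace j μ := by
  have := hμ.isProbabilityMeasure
  obtain ⟨p, ε, C, hε, hcl, hC, hsum, hae⟩ := hμ.exists_coordinates hΔ hE hdim hev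
  obtain ⟨g, hg, hdecay⟩ := hΔ.exists_decaying_orthonormal hdim hε hcl hC hsum
  have hg2 : ∀ n, MemLp (fun φ : StrongDual ℂ E => φ (g n)) 2 μ := fun n => by
    exact_mod_cast hμ.memLp_homPoly hΔ hev (eval_mem_homPoly_one (g n)) 2
  set u : ℕ → StrongDual ℂ E → ℂ := fun n => (1 / 2 : ℂ) ^ n • fun φ => φ (g n) with hu
  have hu2 : ∀ n, MemLp (u n) 2 μ := fun n => (hg2 n).const_smul _
  have hunorm : ∀ n, eLpNorm (u n) 2 μ = ENNReal.ofReal ((1 / 2) ^ n) := fun n => by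
    rw [hu, eLpNorm_const_smul, hμ.eLpNorm_eval_two hΔ hev, hg n n, ← ofReal_norm]
    simp
  obtain ⟨Ψ, hΨ⟩ := exists_eLpNorm_series one_le_two hu2 (by
    simp_rw [hunorm]
    exact (summable_geometric_two).tsum_ofReal_ne_top)
  have hL : ∀ k, (fun φ => ∑ n ∈ Finset.range k, u n φ) ∈ homPoly E 1 := fun k => by
    have h1 : (fun φ => ∑ n ∈ Finset.range k, u n φ) = ∑ n ∈ Finset.range k, u n := by
      ext φ; simp
    rw [h1]
    exact Submodule.sum_mem _ fun n _ => Submodule.smul_mem _ _ (eval_mem_homPoly_one (g n))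
  refine ⟨Ψ, mem_spaceG_of_tendsto_homPoly_one hL hΨ, ?_⟩
  rintro ⟨Ψ₀, ⟨ψ, -, hκ, hsumΨ⟩, hΨ₀⟩
  obtain ⟨y, hy⟩ := hE.exists_eq_of_kernel_one fun p => kernelNormSq_ne_top (hκ p) 1
  -- This multiplier is the projection onto degree one; it isolates the linear kernel without any
  -- uniqueness statement for the kernels.
  obtain ⟨Φ, hΦ, hgraph⟩ := hμ.exists_graph_of_kernels hΔ hev hε hsum hae (hκ p)
    (hΨ₀.trans (Eventually.of_forall fun φ => (hsumΨ φ).tsum_eq.symm))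
    (f := fun n => if n = 1 then 1 else 0) (a := 0) fun n => by split_ifs <;> simp
  have hΦy : Φ =ᵐ[μ] fun φ : StrongDual ℂ E => φ y := by
    filter_upwards [hΦ, hae] with φ hφ hφ'
    obtain ⟨v, -, hv⟩ := hφ'
    rw [hφ, tsum_eq_single 1 fun n hn => by simp [hn]]
    simp only [if_true, Complex.ofReal_one, one_mul]
    rw [hv, hy]
  have hcoef : ∀ n, Δ (g n) y = (1 / 2) ^ n := fun n => by
    have h1 := hgraph.integral_mul_conj hμ hΔ hev (eval_mem_homPoly_one (g n))
    have h2 : ∫ φ, Φ φ * conj (φ (g n)) ∂μ = Δ (g n) y := by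
      rw [← hμ.integral_eval_mul_conj hΔ hev]
      refine integral_congr_ae ?_
      filter_upwards [hΦy] with φ hφ
      rw [hφ]
    have h3 := tendsto_integral_mul_conj
      (fun k => memLp_finsetSum (Finset.range k) fun n _ => hu2 n) hΨ (hg2 n)
    have h4 : ∀ k, n < k →
        ∫ φ, (∑ i ∈ Finset.range k, u i φ) * conj (φ (g n)) ∂μ = (1 / 2) ^ n := fun k hk => by
      have h5 : ∀ φ, (∑ i ∈ Finset.range k, u i φ) * conj (φ (g n)) =
          ∑ i ∈ Finset.range k, (1 / 2 : ℂ) ^ i * (φ (g i) * conj (φ (g n))) := fun φ => by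
        rw [Finset.sum_mul]
        exact Finset.sum_congr rfl fun i _ => by simp [hu, mul_assoc]
      simp_rw [h5]
      have hint : ∀ i, Integrable (fun φ : StrongDual ℂ E =>
          (1 / 2 : ℂ) ^ i * (φ (g i) * conj (φ (g n)))) μ := fun i =>
        ((hg2 i).integrable_mul (hg2 n).star).const_mul _
      rw [integral_finsetSum _ fun i _ => hint i]
      simp_rw [integral_const_mul, hμ.integral_eval_mul_conj hΔ hev, hg _ _]
      simp [hk]
    have h6 : ∫ φ, Ψ φ * conj (φ (g n)) ∂μ = (1 / 2) ^ n :=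
      tendsto_nhds_unique h3 (tendsto_const_nhds.congr' (by
        filter_upwards [eventually_gt_atTop n] with k hk using (h4 k hk).symm))
    simpa [h2, h6] using h1
  obtain ⟨n, hn⟩ := pow_unbounded_of_one_lt ‖j p y‖ (one_lt_two (α := ℝ))
  have h7 := hdecay n y
  rw [hcoef] at h7
  have h8 : (1 / 4 : ℝ) ^ n * ‖j p y‖ < (1 / 4 : ℝ) ^ n * 2 ^ n := by gcongr
  have h9 : (1 / 4 : ℝ) ^ n * 2 ^ n = (1 / 2) ^ n := by rw [← mul_pow]; norm_num
  have h10 : ‖(1 / 2 : ℂ) ^ n‖ = (1 / 2 : ℝ) ^ n := by simp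
  linarith

/-- Thus `λ = p` is admissible in the norm estimate, which gives membership in `𝔻^{p,m}` for every
`p ≥ 1`. -/
lemma two_rpow_neg_mul_le_one (p : ℕ) : (2 : ℝ) ^ (-(p : ℝ)) * ((p : ℝ) - 1) ≤ 1 := by
  rw [Real.rpow_neg zero_le_two, Real.rpow_natCast, inv_mul_le_iff₀ (by positivity), mul_one]
  have : (p : ℝ) < 2 ^ p := by exact_mod_cast Nat.lt_two_pow_self
  linarith

end HidaGauss

end

theorem corollaryA2 {E : Type*} [AddCommGroup E] [Module ℂ E] [TopologicalSpace E]
    {H : ℕ → Type*} [∀ p, NormedAddCommGroup (H p)] [∀ p, InnerProductSpace ℂ (H p)]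
    [∀ p, CompleteSpace (H p)] [∀ p, TopologicalSpace.SeparableSpace (H p)]
    (j : ∀ p, E →L[ℂ] H p) (T : ∀ p, H (p + 1) →L[ℂ] H p)
    (hE : HidaGauss.IsNuclearFrechet j T) (hdim : ¬ FiniteDimensional ℂ E)
    [MeasurableSpace (StrongDual ℂ E)] [BorelSpace (StrongDual ℂ E)]
    (Δ : E →ₗ⋆[ℂ] E →ₗ[ℂ] ℂ) (hΔ : HidaGauss.IsCovariance Δ)
    (μ : Measure (StrongDual ℂ E)) (hμ : HidaGauss.IsComplexGaussian Δ μ) :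
    HidaGauss.hidaSpace j μ ⊂ HidaGauss.spaceG μ ∧
    (HidaGauss.spaceG μ ⊂ ⋂ (p : ℕ) (_ : 1 ≤ p) (m : ℕ), HidaGauss.grossSobolev μ p m) ∧
    ∀ Ψ ∈ HidaGauss.spaceG μ, ∀ (p m : ℕ) (lam : ℝ), 1 ≤ p → 0 ≤ lam →
      (2 : ℝ) ^ (-lam) * ((p : ℝ) - 1) ≤ 1 →
      ∃ Φ Φ' : StrongDual ℂ E →ₘ[μ] ℂ,
        HidaGauss.NumberOpGraph μ p (fun n => (1 + n : ℝ) ^ ((m : ℝ) / 2)) Ψ Φ ∧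
        HidaGauss.NumberOpGraph μ 2 (fun n => (2 : ℝ) ^ ((lam + m) * n / 2)) Ψ Φ' ∧
        eLpNorm Φ p μ ≤ ENNReal.ofReal ((2 : ℝ) ^ ((m : ℝ) / 2)) * eLpNorm Φ' 2 μ := by
  have := hE.continuousSMul
  have hev : ∀ x : E, Measurable fun φ : StrongDual ℂ E => φ x := fun x =>
    (by fun_prop : Continuous fun φ : StrongDual ℂ E => φ x).measurable
  refine ⟨⟨HidaGauss.hidaSpace_subset_spaceG hμ hΔ hE hdim hev, fun h => ?_⟩,
    ⟨fun Ψ hΨ => ?_, fun h => ?_⟩, fun Ψ hΨ p m lam hp hlam hpl => ?_⟩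
  · obtain ⟨Ψ, hΨ, hΨ'⟩ := HidaGauss.exists_mem_spaceG_notMem_hidaSpace hμ hΔ hE hdim hev
    exact hΨ' (h hΨ)
  · simp only [Set.mem_iInter]
    intro p hp m
    obtain ⟨Φ, -, hΦ, -⟩ := HidaGauss.exists_number_estimate hμ hΔ hev hΨ m hp p.cast_nonneg
      (HidaGauss.two_rpow_neg_mul_le_one p)
    exact ⟨Φ, hΦ⟩
  · obtain ⟨Ψ, hΨ, hΨ'⟩ := HidaGauss.exists_mem_grossSobolev_notMem_spaceG hμ hΔ hev hdim
    refine hΨ' (h ?_)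
    simp only [Set.mem_iInter]
    exact fun p hp m => hΨ p m hp
  · obtain ⟨Φ, Φ', hΦ, hΦ', hle⟩ := HidaGauss.exists_number_estimate hμ hΔ hev hΨ m hp hlam hpl
    -- The estimate is already available with constant `1`; the factor `2^{m/2} ≥ 1` only weakens
    -- it.
    refine ⟨Φ, Φ', hΦ, hΦ', hle.trans (le_mul_of_one_le_left zero_le ?_)⟩
    rw [ENNReal.one_le_ofReal]
    exact Real.one_le_rpow one_le_two (by positivity)
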